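/- Let $n\ge 0$, let $\Omega\subset\mathbb R^n$ be a bounded open set (for instance a bounded smooth domain), let $1<p<\infty$ and $0<T\le\infty$. Let $\alpha:\Omega\times\mathbb R\to\mathbb R$ be continuous and suppose that for some $K\ge 0$ $$0\le\alpha(x,r)\le Kr\quad(x\in\Omega,\ r\ge 0),\qquad |\alpha(x,r_2)-\alpha(x,r_1)|\le K|r_2-r_1|\quad(x\in\Omega,\ r_1,r_2\in\mathbb R).$$ Put $q=\max\{2,p\}$. A *weak sub-solution* of $$w_t-\Delta_p w+\alpha(x,w)=0\quad\text{in }\Omega\times(0,T)\qquad(*)$$ is a function $w$ such that $w\in L^q(0,b;W^{1,p}(\Omega))\cap L^2(\Omega\times(0,b))$ for every finite $b<T$, $w(\cdot,t)\in L^2(\Omega)$ for every $t\in[0,T)$, and $$\int_V w\varphi\,dx\,\Big|_{t_1}^{t_2}+\int_{t_1}^{t_2}\!\!\int_V\Big(-w\varphi_t+|\nabla w|^{p-2}\nabla w\cdot\nabla\varphi+\alpha(x,w)\varphi\Big)\,dx\,dt\le 0$$ for all $0\le t_1\le t_2<T$, all open $V$ with compact closure $\overline V\subset\Omega$, and all $\varphi\ge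 0$ such that, for every finite $b<T$, $\varphi\in L^q(0,b;W^{1,p}_0(V))\cap L^2(V\times(0,b))$ and $\varphi_t\in L^2(V\times(0,b))$. Here $\varphi(\cdot,t)\in L^2(V)$ denotes the representative with $\varphi(\cdot,t)-\varphi(\cdot,s)=\int_s^t\varphi_t(\cdot,\tau)\,d\tau$ for $0\le s\le t<T$. A *weak super-solution* is defined with $\ge 0$ in place of $\le 0$. (i) (Comparison principle.) Let $w_1$ be a weak sub-solution and $w_2$ a weak super-solution of $(*)$ with $w_1\le w_2$ on the parabolic boundary, that is, $w_1(\cdot,0)\le w_2(\cdot,0)$ a.e. in $\Omega$, and $w_1\le w_2$ on $\partial\Omega\times(0,T)$ in the sense that $(w_1-w_2)^+(\cdot,t)\in W^{1,p}_0(\Omega)$ for a.e. $t\in(0,T)$. Then $w_1\le w_2$ in $\Omega\times[0,T)$; precisely, for every $t\in[0,T)$, $w_1(\cdot,t)\le w_2(\cdot,t)$ a.e. in $\Omega$. (ii) (Uniqueness.) Let $\sigma:\partial\Omega\to\mathbb R$ and $v_0:\Omega\to\mathbb R$. The problem consisting of $(*)$, $w=\sigma$ on $\partial\Omega\times(0,T)$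 and $w(\cdot,0)=v_0$ has at most one weak solution: any two weak solutions coincide a.e. in $\Omega$ at every time $t\in[0,T)$. Here a weak solution is a function $w$ that is both a weak sub-solution and a weak super-solution of $(*)$, with $w(\cdot,0)=v_0$ a.e. in $\Omega$, and for which there is a function $g\in W^{1,p}(\Omega)\cap C(\overline\Omega)$ with $g=\sigma$ on $\partial\Omega$ and $w(\cdot,t)-g\in W^{1,p}_0(\Omega)$ for a.e. $t\in(0,T)$. -/

import Mathlib

open MeasureTheory Set
open scoped ContDiff ENNReal

noncomputable section

namespace PParabolic

/-- The Euclidean space `ℝⁿ`. -/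
abbrev Space (n : ℕ) : Type := EuclideanSpace ℝ (Fin n)

variable {n : ℕ}

/-- `η ∈ C_c^∞(Ω)`. -/
structure IsBump (Ω : Set (Space n)) (η : Space n → ℝ) : Prop where
  smooth : ContDiff ℝ ∞ η
  compact_support : HasCompactSupport η
  support_subset : tsupport η ⊆ Ω

/-- `g` is the weak gradient of `u` in `Ω`: both are locally integrable in `Ω` and
`∫_Ω u ∂ᵢη = -∫_Ω gᵢ η` for all `η ∈ C_c^∞(Ω)` and all `i`. -/
structure HasWeakGradient (Ω : Set (Space n)) (u : Space n → ℝ) (g : Space n → Space n) :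
    Prop where
  locallyIntegrableOn_fun : LocallyIntegrableOn u Ω
  locallyIntegrableOn_grad : LocallyIntegrableOn g Ω
  integral_eq : ∀ η : Space n → ℝ, IsBump Ω η → ∀ i : Fin n,
    ∫ x in Ω, u x * gradient η x i = -∫ x in Ω, g x i * η x

/-- `u ∈ W^{1,p}(Ω)`, with weak gradient `g`. -/
structure MemSobolev (p : ℝ) (Ω : Set (Space n)) (u : Space n → ℝ) (g : Space n → Space n) :
    Prop where
  weakGradient : HasWeakGradient Ω u g
  memLp_fun : MemLp u (ENNReal.ofReal p) (volume.restrict Ω)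
  memLp_grad : MemLp g (ENNReal.ofReal p) (volume.restrict Ω)

/-- `u ∈ W₀^{1,p}(Ω)`, the closure of `C_c^∞(Ω)` in `W^{1,p}(Ω)`, with weak gradient `g`. -/
structure MemSobolevZero (p : ℝ) (Ω : Set (Space n)) (u : Space n → ℝ)
    (g : Space n → Space n) : Prop where
  memSobolev : MemSobolev p Ω u g
  approx : ∀ ε : ℝ≥0∞, 0 < ε → ∃ η : Space n → ℝ, IsBump Ω η ∧
    eLpNorm (fun x => u x - η x) (ENNReal.ofReal p) (volume.restrict Ω) < ε ∧
    eLpNorm (fun x => g x - gradient η x) (ENNReal.ofReal p) (volume.restrict Ω) < ε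

/-- Product Lebesgue measure on the cylinder `(0, b) × Ω`. Functions on space-time are written
`w : ℝ → Space n → ℝ`, time first. -/
def cylinder (b : ℝ) (Ω : Set (Space n)) : Measure (ℝ × Space n) :=
  (volume.restrict (Ioo 0 b)).prod (volume.restrict Ω)

/-- `w ∈ L^q(0, b; W^{1,p}(Ω))` for every finite `b` with `b < T`, where `q = max 2 p`, and `G` is
the spatial weak gradient of `w`. For `p ≤ 2` this is `L²` in time; for `p > 2` the exponent `p` is
the one for which the products `|∇w|^{p-2} ∇w · ∇φ` are integrable. Here `T = ⊤` is allowed.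
(Joint measurability is Bochner measurability, as `W^{1,p}(Ω)` is separable.) -/
structure MemBochnerSobolev (p : ℝ) (Ω : Set (Space n)) (T : EReal)
    (w : ℝ → Space n → ℝ) (G : ℝ → Space n → Space n) : Prop where
  measurable_fun : ∀ b : ℝ, (b : EReal) < T →
    AEStronglyMeasurable (Function.uncurry w) (cylinder b Ω)
  measurable_grad : ∀ b : ℝ, (b : EReal) < T →
    AEStronglyMeasurable (Function.uncurry G) (cylinder b Ω)
  slice : ∀ᵐ t : ℝ, 0 < t → (t : EReal) < T → MemSobolev p Ω (w t) (G t)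
  finite : ∀ b : ℝ, (b : EReal) < T →
    ∫⁻ t in Ioo 0 b,
      (eLpNorm (w t) (ENNReal.ofReal p) (volume.restrict Ω) +
        eLpNorm (G t) (ENNReal.ofReal p) (volume.restrict Ω)) ^ max 2 p < ⊤

/-- `w(·, t) ∈ L²(Ω)` for every `t ∈ [0, T)`, and `w ∈ L²(Ω × (0, b))` for every finite
`b < T`. -/
structure MemL2 (Ω : Set (Space n)) (T : EReal) (w : ℝ → Space n → ℝ) : Prop where
  slice : ∀ t : ℝ, 0 ≤ t → (t : EReal) < T → MemLp (w t) 2 (volume.restrict Ω)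
  cylinder : ∀ b : ℝ, (b : EReal) < T → MemLp (Function.uncurry w) 2 (cylinder b Ω)

/-- Admissible test functions on `V × [0, T)`: nonnegative `φ` in the Bochner-Sobolev class,
vanishing on `∂V × (0, T)` (that is, `φ(·, t) ∈ W₀^{1,p}(V)` for a.e. `t`), with spatial weak
gradient `Gφ` and time derivative `φt ∈ L²`. The last means that `t ↦ φ(·, t)` is the absolutely
continuous representative, `φ(·, t) - φ(·, s) = ∫_s^t φt(·, τ) dτ`. -/
structure IsTest (p : ℝ) (V : Set (Space n)) (T : EReal)
    (φ φt : ℝ → Space n → ℝ) (Gφ : ℝ → Space n → Space n) : Prop where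
  memBochnerSobolev : MemBochnerSobolev p V T φ Gφ
  vanish : ∀ᵐ t : ℝ, 0 < t → (t : EReal) < T → MemSobolevZero p V (φ t) (Gφ t)
  memL2 : MemL2 V T φ
  memLp_deriv : ∀ b : ℝ, (b : EReal) < T → MemLp (Function.uncurry φt) 2 (cylinder b V)
  deriv : ∀ s t : ℝ, 0 ≤ s → s ≤ t → (t : EReal) < T →
    ∀ᵐ x ∂volume.restrict V, φ t x - φ s x = ∫ τ in s..t, φt τ x
  nonneg : ∀ t : ℝ, 0 ≤ t → (t : EReal) < T → ∀ᵐ x ∂volume.restrict V, 0 ≤ φ t x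

/-- `∫_V w φ |_{t₁}^{t₂} + ∫_{t₁}^{t₂} ∫_V (-w φ_t + |∇w|^{p-2} ∇w · ∇φ + α(x, w) φ)`. -/
def weakForm (p : ℝ) (α : Space n → ℝ → ℝ) (V : Set (Space n))
    (w : ℝ → Space n → ℝ) (G : ℝ → Space n → Space n)
    (φ φt : ℝ → Space n → ℝ) (Gφ : ℝ → Space n → Space n) (t₁ t₂ : ℝ) : ℝ :=
  ((∫ x in V, w t₂ x * φ t₂ x) - ∫ x in V, w t₁ x * φ t₁ x) +
    ∫ t in t₁..t₂, ∫ x in V,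
      (-(w t x * φt t x) + ‖G t x‖ ^ (p - 2) * inner ℝ (G t x) (Gφ t x) +
        α x (w t x) * φ t x)

/-- `w` is a weak sub-solution of `w_t - Δ_p w + α(x, w) = 0` in `Ω × (0, T)`. -/
def IsWeakSubsolution (p : ℝ) (α : Space n → ℝ → ℝ) (Ω : Set (Space n)) (T : EReal)
    (w : ℝ → Space n → ℝ) : Prop :=
  ∃ G : ℝ → Space n → Space n, MemBochnerSobolev p Ω T w G ∧ MemL2 Ω T w ∧
    ∀ V : Set (Space n), IsOpen V → IsCompact (closure V) → closure V ⊆ Ω →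
      ∀ (φ φt : ℝ → Space n → ℝ) (Gφ : ℝ → Space n → Space n), IsTest p V T φ φt Gφ →
        ∀ t₁ t₂ : ℝ, 0 ≤ t₁ → t₁ ≤ t₂ → (t₂ : EReal) < T →
          weakForm p α V w G φ φt Gφ t₁ t₂ ≤ 0

/-- `w` is a weak super-solution of `w_t - Δ_p w + α(x, w) = 0` in `Ω × (0, T)`. -/
def IsWeakSupersolution (p : ℝ) (α : Space n → ℝ → ℝ) (Ω : Set (Space n)) (T : EReal)
    (w : ℝ → Space n → ℝ) : Prop :=
  ∃ G : ℝ → Space n → Space n, MemBochnerSobolev p Ω T w G ∧ MemL2 Ω T w ∧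
    ∀ V : Set (Space n), IsOpen V → IsCompact (closure V) → closure V ⊆ Ω →
      ∀ (φ φt : ℝ → Space n → ℝ) (Gφ : ℝ → Space n → Space n), IsTest p V T φ φt Gφ →
        ∀ t₁ t₂ : ℝ, 0 ≤ t₁ → t₁ ≤ t₂ → (t₂ : EReal) < T →
          0 ≤ weakForm p α V w G φ φt Gφ t₁ t₂

/-- `w₁ ≤ w₂` on the parabolic boundary of `Ω × (0, T)`: almost everywhere in `Ω` at time `0`, and
on `∂Ω` at almost every time in the Sobolev sense `(w₁ - w₂)⁺ ∈ W₀^{1,p}(Ω)`. -/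
def LeOnParabolicBoundary (p : ℝ) (Ω : Set (Space n)) (T : EReal)
    (w₁ w₂ : ℝ → Space n → ℝ) : Prop :=
  (∀ᵐ x ∂volume.restrict Ω, w₁ 0 x ≤ w₂ 0 x) ∧
    ∀ᵐ t : ℝ, 0 < t → (t : EReal) < T →
      ∃ D : Space n → Space n, MemSobolevZero p Ω (fun x => max (w₁ t x - w₂ t x) 0) D

/-- `w = σ` on `∂Ω × (0, T)` in the Sobolev sense: for a function `g ∈ W^{1,p}(Ω) ∩ C(closure Ω)`
with `g = σ` on `∂Ω`, one has `w(·, t) - g ∈ W₀^{1,p}(Ω)` for almost every `t`. -/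
def HasLateralBoundaryValues (p : ℝ) (Ω : Set (Space n)) (T : EReal) (σ : Space n → ℝ)
    (w : ℝ → Space n → ℝ) : Prop :=
  ∃ (g : Space n → ℝ) (Dg : Space n → Space n), MemSobolev p Ω g Dg ∧
    ContinuousOn g (closure Ω) ∧ (∀ x ∈ frontier Ω, g x = σ x) ∧
    ∀ᵐ t : ℝ, 0 < t → (t : EReal) < T →
      ∃ D : Space n → Space n, MemSobolevZero p Ω (fun x => w t x - g x) D

/-- `w` is a weak solution of `w_t - Δ_p w + α(x, w) = 0` in `Ω × (0, T)` with `w = σ` on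
`∂Ω × (0, T)` and `w(·, 0) = v₀`. -/
structure IsWeakSolution (p : ℝ) (α : Space n → ℝ → ℝ) (Ω : Set (Space n)) (T : EReal)
    (σ v₀ : Space n → ℝ) (w : ℝ → Space n → ℝ) : Prop where
  subsolution : IsWeakSubsolution p α Ω T w
  supersolution : IsWeakSupersolution p α Ω T w
  lateral : HasLateralBoundaryValues p Ω T σ w
  initial : ∀ᵐ x ∂volume.restrict Ω, w 0 x = v₀ x

end PParabolic

end

/-! Formally, one tests the inequality for `W = w₁ - w₂` with a nonnegative increasing function of
`W⁺`. The field `ξ ↦ |ξ|^{p-2} ξ` is monotone, so the diffusion term has a sign. The Lipschitz bound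
on the reaction leaves a Gronwall inequality. The obstacle is that `W⁺` has no time derivative in
`L²` and is therefore not an admissible test function.

The way around is to use only test functions that do not depend on time. For these the two weak
inequalities subtract to `∫ (W(t) - W(s)) η ≤ -∫_s^t ∫ (a · ∇η + c η)`, with `a` and `c` the
differences of fluxes and reactions (`exists_weak_inequality`). For almost every `t`, `η` can
approach `ψ(t) = truncation (W(t)⁺)`, frozen at the upper endpoint `t`, because `W(t)⁺ ∈ W₀^{1,p}`
(`exists_isBump_tendsto_truncation`). Now `truncation r⁺` is the derivative of the convex function
`entropy`. By convexity the left side dominates the increment of `∫ entropy W` (`entropy_step`).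

On the right the flux at time `s` meets the test function at time `t`, so monotonicity does not
apply yet. Taking time lag `τ` and integrating over `t` turns the right side into an average over `r
∈ (0, τ]` of pairings of the flux at time `t - r` with `ψ(t)` (`primitive_energy_sub_le`).
Translations are continuous in `L^{p'}`, so as `τ → 0` the average tends to the equal-time pairing
(`tendsto_timePairing`), which is bounded below by monotonicity and the Lipschitz bound
(`le_timePairing_zero`). Hence the primitive `Y` of the energy satisfies `Y' ≤ 3 K Y` in the sense
of a left Dini derivative, and `Y 0 = 0`. Gronwall gives `Y = 0`, so `W ≤ 0` at almost every time.
The weak inequality with stationary test functions then carries this to every time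
(`ae_nonpos_final`).

For uniqueness, two continuous Sobolev extensions of the same boundary values differ by an element
of `W₀^{1,p}` (`MemSobolev.memSobolevZero_of_continuousOn`). Two solutions are thus ordered on the
parabolic boundary in both directions. -/

noncomputable section

namespace PParabolic

open Filter Topology

variable {n : ℕ}

/-! ### Translation and mollification in `L^p`. -/

section Translation

variable {Z E : Type*} [NormedAddCommGroup Z] [MeasurableSpace Z] [BorelSpace Z]
  [LocallyCompactSpace Z] [SecondCountableTopology Z] {μ : Measure Z} [μ.IsAddHaarMeasure]
  [NormedAddCommGroup E]

/-- Translation is continuous in `L^p` for finite `p`. -/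
theorem tendsto_eLpNorm_translate_sub {p : ℝ≥0∞} (hp : 1 ≤ p) (hp' : p ≠ ⊤) {u : Z → E}
    (hu : MemLp u p μ) :
    Tendsto (fun y => eLpNorm (fun x => u (x - y) - u x) p μ) (𝓝 0) (𝓝 0) := by
  have : Fact (1 ≤ p) := ⟨hp⟩
  let g : Z → C(Z, Z) := fun y => ⟨fun x => x - y, by fun_prop⟩
  have hg : Continuous g :=
    (ContinuousMap.curry ⟨fun q : Z × Z => q.2 - q.1, by fun_prop⟩).continuous
  have hm : ∀ y, MeasurePreserving (g y) μ μ := fun y => measurePreserving_sub_right μ y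
  have h := Filter.Tendsto.compMeasurePreservingLp (l := 𝓝 (0 : Z))
    (tendsto_const_nhds (x := hu.toLp u)) (hg.tendsto 0) hm (hm 0) hp'
  have h' := (tendsto_iff_edist_tendsto_0.1 h)
  refine h'.congr fun y => ?_
  rw [Lp.edist_def]
  refine eLpNorm_congr_ae ?_
  have e : ∀ y, (Lp.compMeasurePreserving (g y) (hm y) (hu.toLp u) : Z → E) =ᵐ[μ]
      fun x => u (x - y) := fun y =>
    (Lp.coeFn_compMeasurePreserving _ (hm y)).trans
      ((hm y).quasiMeasurePreserving.ae_eq_comp hu.coeFn_toLp)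
  filter_upwards [e y, e 0] with x h1 h2
  rw [Pi.sub_apply, h1, h2, sub_zero]

end Translation

section Mollifier

variable {E : Type*} [NormedAddCommGroup E] [NormedSpace ℝ E]

/-- The mollification of `u` by the normalized bump function `ρ`. -/
def mollify (ρ : ContDiffBump (0 : Space n)) (u : Space n → E) : Space n → E :=
  convolution (ρ.normed volume) u (ContinuousLinearMap.lsmul ℝ ℝ) volume

/-- A sequence of bump functions whose supports shrink to the origin. -/
def mollifier (n : ℕ) (k : ℕ) : ContDiffBump (0 : Space n) where
  rIn := 1 / (2 * (k + 1))
  rOut := 1 / (k + 1)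
  rIn_pos := by positivity
  rIn_lt_rOut := by
    apply one_div_lt_one_div_of_lt <;> nlinarith [Nat.cast_nonneg (α := ℝ) k]

theorem tendsto_mollifier_rOut : Tendsto (fun k => (mollifier n k).rOut) atTop (𝓝 0) :=
  tendsto_one_div_add_atTop_nhds_zero_nat

/-- A bounded ratio of radii is what almost everywhere convergence of mollifications at Lebesgue
points requires. -/
theorem mollifier_rOut_le (k : ℕ) : (mollifier n k).rOut ≤ 2 * (mollifier n k).rIn := by
  simp only [mollifier]
  apply le_of_eq
  field_simp

theorem contDiff_mollify (ρ : ContDiffBump (0 : Space n)) {u : Space n → E}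
    (hu : LocallyIntegrable u) : ContDiff ℝ ∞ (mollify ρ u) :=
  HasCompactSupport.contDiff_convolution_left _ ρ.hasCompactSupport_normed ρ.contDiff_normed hu

theorem mollify_apply (ρ : ContDiffBump (0 : Space n)) (u : Space n → E) (x : Space n) :
    mollify ρ u x = ∫ y, ρ.normed volume y • u (x - y) := rfl

theorem mollify_apply' (ρ : ContDiffBump (0 : Space n)) (u : Space n → E) (x : Space n) :
    mollify ρ u x = ∫ y, ρ.normed volume (x - y) • u y := by
  rw [mollify_apply, ← integral_sub_left_eq_self _ volume x]
  simp

theorem integrable_mollify_integrand (ρ : ContDiffBump (0 : Space n)) {u : Space n → E}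
    (hu : LocallyIntegrable u) (x : Space n) :
    Integrable fun y => ρ.normed volume y • u (x - y) :=
  (ρ.hasCompactSupport_normed.convolutionExists_left (ContinuousLinearMap.lsmul ℝ ℝ)
    ρ.continuous_normed hu) x

/-- The mollification error in `L^p` is controlled by small translations. -/
theorem eLpNorm_mollify_sub_le [CompleteSpace E] (ρ : ContDiffBump (0 : Space n))
    {p : ℝ≥0∞} (hp : 1 ≤ p) (hp' : p ≠ ⊤) {u : Space n → E} (hu : MemLp u p volume) {ε : ℝ≥0∞}
    (h : ∀ y ∈ Metric.ball (0 : Space n) ρ.rOut, eLpNorm (fun x => u (x - y) - u x) p volume ≤ ε) :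
    eLpNorm (fun x => mollify ρ u x - u x) p volume ≤ ε := by
  have hloc : LocallyIntegrable u := hu.locallyIntegrable hp
  have hp0 : p ≠ 0 := (zero_lt_one.trans_le hp).ne'
  have hpr : 0 < p.toReal := ENNReal.toReal_pos hp0 hp'
  -- The kernel is a probability density, so Jensen's inequality takes the form of monotonicity of
  -- `L^p(ν)` norms in the exponent.
  set ν : Measure (Space n) := volume.withDensity fun y => ENNReal.ofReal (ρ.normed volume y)
  have hρm : Measurable fun y => ENNReal.ofReal (ρ.normed volume y) :=
    (ENNReal.continuous_ofReal.comp ρ.continuous_normed).measurable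
  have hν : IsProbabilityMeasure ν := by
    constructor
    rw [withDensity_apply _ MeasurableSet.univ, setLIntegral_univ,
      ← ofReal_integral_eq_lintegral_ofReal ρ.integrable_normed
        (ae_of_all _ ρ.nonneg_normed), ρ.integral_normed, ENNReal.ofReal_one]
  have hsub : AEStronglyMeasurable (fun z : Space n × Space n => u (z.1 - z.2) - u z.1)
      (volume.prod volume) := by
    refine AEStronglyMeasurable.sub ?_ hu.1.comp_fst
    exact hu.1.comp_quasiMeasurePreserving
      (quasiMeasurePreserving_sub_of_right_invariant volume volume)
  have hpt : ∀ᵐ x, ‖mollify ρ u x - u x‖ₑ ^ p.toReal ≤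
      ∫⁻ y, ENNReal.ofReal (ρ.normed volume y) * ‖u (x - y) - u x‖ₑ ^ p.toReal := by
    filter_upwards [hsub.prodMk_left] with x hx
    have e : mollify ρ u x - u x = ∫ y, ρ.normed volume y • (u (x - y) - u x) := by
      simp_rw [smul_sub]
      rw [integral_sub (integrable_mollify_integrand ρ hloc x)
        (ρ.integrable_normed.smul_const _), integral_smul_const, ρ.integral_normed, one_smul,
        mollify_apply]
    have hx' : AEStronglyMeasurable (fun y => u (x - y) - u x) ν :=
      hx.mono_ac (withDensity_absolutelyContinuous _ _)
    calc ‖mollify ρ u x - u x‖ₑ ^ p.toReal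
        ≤ (∫⁻ y, ‖u (x - y) - u x‖ₑ ∂ν) ^ p.toReal := by
          gcongr
          rw [e, lintegral_withDensity_eq_lintegral_mul₀ hρm.aemeasurable hx.enorm]
          refine (enorm_integral_le_lintegral_enorm _).trans (lintegral_mono fun y => ?_)
          rw [enorm_smul, Real.enorm_eq_ofReal (ρ.nonneg_normed y)]
          rfl
      _ = (eLpNorm (fun y => u (x - y) - u x) 1 ν) ^ p.toReal := by
          rw [eLpNorm_one_eq_lintegral_enorm]
      _ ≤ (eLpNorm (fun y => u (x - y) - u x) p ν) ^ p.toReal := by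
          gcongr
          exact eLpNorm_le_eLpNorm_of_exponent_le hp hx'
      _ = ∫⁻ y, ‖u (x - y) - u x‖ₑ ^ p.toReal ∂ν := by
          rw [eLpNorm_eq_lintegral_rpow_enorm_toReal hp0 hp', ← ENNReal.rpow_mul,
            one_div_mul_cancel hpr.ne', ENNReal.rpow_one]
      _ = _ := by
          rw [lintegral_withDensity_eq_lintegral_mul₀ hρm.aemeasurable (hx.enorm.pow_const _)]
          rfl
  rw [eLpNorm_eq_lintegral_rpow_enorm_toReal hp0 hp', one_div,
    ENNReal.rpow_inv_le_iff hpr]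
  calc ∫⁻ x, ‖mollify ρ u x - u x‖ₑ ^ p.toReal
      ≤ ∫⁻ x, ∫⁻ y, ENNReal.ofReal (ρ.normed volume y) * ‖u (x - y) - u x‖ₑ ^ p.toReal :=
        lintegral_mono_ae hpt
    _ = ∫⁻ y, ∫⁻ x, ENNReal.ofReal (ρ.normed volume y) * ‖u (x - y) - u x‖ₑ ^ p.toReal := by
        refine lintegral_lintegral_swap ?_
        exact ((hρm.comp measurable_snd).aemeasurable).mul (hsub.enorm.pow_const _)
    _ ≤ ∫⁻ y, ENNReal.ofReal (ρ.normed volume y) * ε ^ p.toReal := by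
        refine lintegral_mono fun y => ?_
        dsimp only
        rw [lintegral_const_mul' _ _ ENNReal.ofReal_ne_top]
        by_cases hy : y ∈ Metric.ball (0 : Space n) ρ.rOut
        · gcongr
          have := h y hy
          rwa [eLpNorm_eq_lintegral_rpow_enorm_toReal hp0 hp', one_div,
            ENNReal.rpow_inv_le_iff hpr] at this
        · have : ρ.normed volume y = 0 := by
            rw [← Function.notMem_support, ρ.support_normed_eq]; exact hy
          simp [this]
    _ = ε ^ p.toReal := by
        rw [lintegral_mul_const _ hρm, ← setLIntegral_univ,
          ← withDensity_apply _ MeasurableSet.univ]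
        change ν univ * _ = _
        rw [measure_univ, one_mul]

theorem tendsto_eLpNorm_mollify_sub [CompleteSpace E] {p : ℝ≥0∞} (hp : 1 ≤ p) (hp' : p ≠ ⊤)
    {u : Space n → E} (hu : MemLp u p volume) :
    Tendsto (fun k => eLpNorm (fun x => mollify (mollifier n k) u x - u x) p volume)
      atTop (𝓝 0) := by
  rw [ENNReal.tendsto_nhds_zero]
  intro ε hε
  have h := ENNReal.tendsto_nhds_zero.1 (tendsto_eLpNorm_translate_sub (μ := volume) hp hp' hu) ε hε
  obtain ⟨δ, hδ, hδ'⟩ := Metric.eventually_nhds_iff_ball.1 h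
  filter_upwards [tendsto_mollifier_rOut.eventually_lt_const hδ] with k hk
  exact eLpNorm_mollify_sub_le _ hp hp' hu fun y hy => hδ' y (Metric.ball_subset_ball hk.le hy)

end Mollifier

/-! ### Limits and duality pairings in `L^p`. -/

section LpLimits

variable {X E : Type*} [MeasurableSpace X] {μ : Measure X} [NormedAddCommGroup E]

/-- Dominated convergence in `L^p`. -/
theorem tendsto_eLpNorm_sub_of_dominated {p : ℝ≥0∞} (hp : 1 ≤ p) (hp' : p ≠ ⊤)
    {f : ℕ → X → E} {f₀ : X → E} {B : X → ℝ} (hf : ∀ k, AEStronglyMeasurable (f k) μ)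
    (hf₀ : AEStronglyMeasurable f₀ μ) (hB : MemLp B p μ)
    (hle : ∀ k, ∀ᵐ x ∂μ, ‖f k x - f₀ x‖ ≤ B x)
    (hlim : ∀ᵐ x ∂μ, Tendsto (fun k => f k x) atTop (𝓝 (f₀ x))) :
    Tendsto (fun k => eLpNorm (fun x => f k x - f₀ x) p μ) atTop (𝓝 0) := by
  have hp0 : p ≠ 0 := (zero_lt_one.trans_le hp).ne'
  have hpr : 0 < p.toReal := ENNReal.toReal_pos hp0 hp'
  have h : Tendsto (fun k => ∫⁻ x, ‖f k x - f₀ x‖ₑ ^ p.toReal ∂μ) atTop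
      (𝓝 (∫⁻ _, 0 ∂μ)) := by
    refine tendsto_lintegral_of_dominated_convergence' (fun x => ‖B x‖ₑ ^ p.toReal)
      (fun k => (((hf k).sub hf₀).enorm).pow_const _) (fun k => ?_) ?_ ?_
    · filter_upwards [hle k] with x hx
      refine ENNReal.rpow_le_rpow ?_ hpr.le
      rw [← ofReal_norm, ← ofReal_norm]
      exact ENNReal.ofReal_le_ofReal (hx.trans (le_abs_self _))
    · exact (lintegral_rpow_enorm_lt_top_of_eLpNorm_lt_top hp0 hp' hB.2).ne
    · filter_upwards [hlim] with x hx
      have h1 : Tendsto (fun k => ‖f k x - f₀ x‖ₑ) atTop (𝓝 0) := by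
        have := (hx.sub_const (f₀ x)).enorm
        simpa using this
      have := (ENNReal.continuous_rpow_const (y := p.toReal)).tendsto 0 |>.comp h1
      simpa [ENNReal.zero_rpow_of_pos hpr, Function.comp_def] using this
  rw [lintegral_zero] at h
  have h2 := (ENNReal.continuous_rpow_const (y := 1 / p.toReal)).tendsto 0 |>.comp h
  rw [ENNReal.zero_rpow_of_pos (by positivity)] at h2
  refine h2.congr fun k => ?_
  rw [eLpNorm_eq_lintegral_rpow_enorm_toReal hp0 hp']
  rfl

variable [NormedSpace ℝ E]

/-- Convergence of `v_k → v`, `G_k → G` in `L^p` passes to `m(v_k) • G_k` for bounded continuous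
`m`, along a subsequence for which moreover `v_k → v` almost everywhere. -/
theorem exists_subseq_tendsto_smul {p : ℝ≥0∞} (hp : 1 ≤ p) (hp' : p ≠ ⊤)
    {v : ℕ → X → ℝ} {v₀ : X → ℝ} {G : ℕ → X → E} {G₀ : X → E}
    (hv : ∀ k, AEStronglyMeasurable (v k) μ) (hv₀ : AEStronglyMeasurable v₀ μ)
    (hG : ∀ k, AEStronglyMeasurable (G k) μ) (hG₀ : MemLp G₀ p μ)
    (hvlim : Tendsto (fun k => eLpNorm (fun x => v k x - v₀ x) p μ) atTop (𝓝 0))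
    (hGlim : Tendsto (fun k => eLpNorm (fun x => G k x - G₀ x) p μ) atTop (𝓝 0))
    {m : ℝ → ℝ} (hm : Continuous m) {C : ℝ} (hC : ∀ r, |m r| ≤ C) :
    ∃ ns : ℕ → ℕ, StrictMono ns ∧
      (∀ᵐ x ∂μ, Tendsto (fun k => v (ns k) x) atTop (𝓝 (v₀ x))) ∧
      Tendsto (fun k => eLpNorm (fun x => m (v (ns k) x) • G (ns k) x - m (v₀ x) • G₀ x) p μ)
        atTop (𝓝 0) := by
  have hp0 : p ≠ 0 := (zero_lt_one.trans_le hp).ne'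
  obtain ⟨ns, hns, hae⟩ :=
    (tendstoInMeasure_of_tendsto_eLpNorm hp0 hv hv₀ hvlim).exists_seq_tendsto_ae
  refine ⟨ns, hns, hae, ?_⟩
  have h1 : Tendsto (fun k => eLpNorm (fun x => m (v (ns k) x) • G₀ x - m (v₀ x) • G₀ x) p μ)
      atTop (𝓝 0) := by
    refine tendsto_eLpNorm_sub_of_dominated hp hp' (B := fun x => (2 * C) * ‖G₀ x‖)
      (fun k => (hm.comp_aestronglyMeasurable (hv _)).smul hG₀.1)
      ((hm.comp_aestronglyMeasurable hv₀).smul hG₀.1) (hG₀.norm.const_mul _)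
      (fun k => ae_of_all _ fun x => ?_) ?_
    · rw [← sub_smul, norm_smul]
      gcongr
      calc ‖m (v (ns k) x) - m (v₀ x)‖ ≤ ‖m (v (ns k) x)‖ + ‖m (v₀ x)‖ := norm_sub_le _ _
        _ ≤ C + C := add_le_add (hC _) (hC _)
        _ = 2 * C := by ring
    · filter_upwards [hae] with x hx
      exact ((hm.tendsto _).comp hx).smul_const _
  have h2 : Tendsto (fun k => ENNReal.ofReal C *
      eLpNorm (fun x => G (ns k) x - G₀ x) p μ +
      eLpNorm (fun x => m (v (ns k) x) • G₀ x - m (v₀ x) • G₀ x) p μ) atTop (𝓝 0) := by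
    have := (ENNReal.Tendsto.const_mul (hGlim.comp hns.tendsto_atTop)
      (Or.inr (ENNReal.ofReal_ne_top (r := C)))).add h1
    simpa using this
  refine tendsto_of_tendsto_of_tendsto_of_le_of_le tendsto_const_nhds h2 (fun _ => zero_le)
    fun k => ?_
  have e : (fun x => m (v (ns k) x) • G (ns k) x - m (v₀ x) • G₀ x) =
      (fun x => m (v (ns k) x) • (G (ns k) x - G₀ x)) +
        fun x => m (v (ns k) x) • G₀ x - m (v₀ x) • G₀ x := by
    ext x; simp only [Pi.add_apply, smul_sub]; abel
  dsimp only
  rw [e]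
  have hmv : ∀ k, AEStronglyMeasurable (fun x => m (v k x)) μ :=
    fun k => hm.comp_aestronglyMeasurable (hv k)
  refine (eLpNorm_add_le ((hmv _).smul ((hG _).sub hG₀.1))
    (((hmv _).smul hG₀.1).sub ((hm.comp_aestronglyMeasurable hv₀).smul hG₀.1)) hp).trans
      (add_le_add ?_ le_rfl)
  refine eLpNorm_le_mul_eLpNorm_of_ae_le_mul (ae_of_all _ fun x => ?_) p
  change ‖m (v (ns k) x) • (G (ns k) x - G₀ x)‖ ≤ _
  rw [norm_smul]
  gcongr
  exact hC _

end LpLimits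

section Pairing

variable {X E : Type*} [MeasurableSpace X] {μ : Measure X} [NormedAddCommGroup E]
  [InnerProductSpace ℝ E] {p q : ℝ≥0∞} [ENNReal.HolderTriple q p 1]

theorem eLpNorm_inner_le {u v : X → E} (hu : AEStronglyMeasurable u μ)
    (hv : AEStronglyMeasurable v μ) :
    eLpNorm (fun x => inner ℝ (u x) (v x)) 1 μ ≤ eLpNorm u q μ * eLpNorm v p μ := by
  have := eLpNorm_le_eLpNorm_mul_eLpNorm'_of_norm (p := q) (q := p) (r := 1) hu hv
    (fun a b => (inner ℝ a b : ℝ)) 1 (ae_of_all _ fun x => by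
      simpa using abs_real_inner_le_norm (u x) (v x))
  simpa using this

theorem integrable_inner_of_memLp {u v : X → E} (hu : MemLp u q μ) (hv : MemLp v p μ) :
    Integrable (fun x => inner ℝ (u x) (v x)) μ := by
  rw [← memLp_one_iff_integrable]
  exact ⟨hu.1.inner hv.1, (eLpNorm_inner_le hu.1 hv.1).trans_lt
    (ENNReal.mul_lt_top hu.2 hv.2)⟩

/-- The duality pairing of `L^q` and `L^p` is continuous in its second argument. -/
theorem tendsto_integral_inner {ι : Type*} {l : Filter ι} {u : X → E} {v : ι → X → E} {v₀ : X → E}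
    (hu : MemLp u q μ) (hv : ∀ k, MemLp (v k) p μ) (hv₀ : MemLp v₀ p μ)
    (hlim : Tendsto (fun k => eLpNorm (fun x => v k x - v₀ x) p μ) l (𝓝 0)) :
    Tendsto (fun k => ∫ x, inner ℝ (u x) (v k x) ∂μ) l (𝓝 (∫ x, inner ℝ (u x) (v₀ x) ∂μ)) := by
  refine tendsto_integral_of_L1' _ (hu.1.inner hv₀.1)
    (Eventually.of_forall fun k => integrable_inner_of_memLp hu (hv k)) ?_
  have h : Tendsto (fun k => eLpNorm u q μ * eLpNorm (fun x => v k x - v₀ x) p μ) l (𝓝 0) := by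
    simpa using ENNReal.Tendsto.const_mul hlim (Or.inr hu.2.ne)
  refine tendsto_of_tendsto_of_tendsto_of_le_of_le tendsto_const_nhds h (fun _ => zero_le)
    fun k => ?_
  have e : ((fun x => inner ℝ (u x) (v k x)) - fun x => inner ℝ (u x) (v₀ x)) =
      fun x => (inner ℝ (u x) (v k x - v₀ x) : ℝ) := by
    ext x; simp [inner_sub_right]
  dsimp only
  rw [e]
  exact eLpNorm_inner_le hu.1 ((hv k).1.sub hv₀.1)

end Pairing

/-! ### Classical gradients, bump functions and cutoffs. -/

section Gradient

theorem gradient_apply (η : Space n → ℝ) (x : Space n) (i : Fin n) :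
    gradient η x i = fderiv ℝ η x (EuclideanSpace.single i 1) := by
  rw [← inner_gradient_left, EuclideanSpace.inner_single_right]
  simp

theorem continuous_gradient {η : Space n → ℝ} (h : ContDiff ℝ 1 η) : Continuous (gradient η) :=
  (InnerProductSpace.toDual ℝ (Space n)).symm.continuous.comp (h.continuous_fderiv one_ne_zero)

theorem gradient_comp {f : ℝ → ℝ} {v : Space n → ℝ} {x : Space n}
    (hf : DifferentiableAt ℝ f (v x)) (hv : DifferentiableAt ℝ v x) :
    gradient (fun y => f (v y)) x = deriv f (v x) • gradient v x := by
  ext i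
  simp only [PiLp.smul_apply, gradient_apply]
  rw [show (fun y => f (v y)) = f ∘ v from rfl, fderiv_comp x hf hv]
  simp only [ContinuousLinearMap.comp_apply, smul_eq_mul]
  rw [fderiv_eq_smul_deriv, smul_eq_mul, mul_comm]

theorem gradient_mul {u v : Space n → ℝ} {x : Space n}
    (hu : DifferentiableAt ℝ u x) (hv : DifferentiableAt ℝ v x) :
    gradient (fun y => u y * v y) x = u x • gradient v x + v x • gradient u x := by
  ext i
  simp only [PiLp.smul_apply, PiLp.add_apply, gradient_apply]
  rw [show (fun y => u y * v y) = u * v from rfl, fderiv_mul hu hv]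
  simp

theorem gradient_add {u v : Space n → ℝ} {x : Space n}
    (hu : DifferentiableAt ℝ u x) (hv : DifferentiableAt ℝ v x) :
    gradient (fun y => u y + v y) x = gradient u x + gradient v x := by
  ext i
  simp only [PiLp.add_apply, gradient_apply]
  rw [show (fun y => u y + v y) = u + v from rfl, fderiv_add hu hv]
  simp

theorem gradient_of_notMem_tsupport {η : Space n → ℝ} {x : Space n} (hx : x ∉ tsupport η) :
    gradient η x = 0 := by
  have : fderiv ℝ η x = 0 := by
    by_contra h
    exact hx (support_fderiv_subset ℝ h)
  simp [gradient, this]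

theorem gradient_eq_zero_of_eventuallyEq_const {η : Space n → ℝ} {x : Space n} {c : ℝ}
    (h : η =ᶠ[𝓝 x] fun _ => c) : gradient η x = 0 := by
  rw [h.gradient_eq]; simp

end Gradient

namespace IsBump

variable {Ω : Set (Space n)} {η : Space n → ℝ}

theorem differentiable (h : IsBump Ω η) : Differentiable ℝ η :=
  h.smooth.differentiable (by simp)

theorem continuous (h : IsBump Ω η) : Continuous η := h.smooth.continuous

theorem continuous_gradient (h : IsBump Ω η) : Continuous (gradient η) :=
  PParabolic.continuous_gradient (h.smooth.of_le (by simp))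

theorem hasCompactSupport_gradient (h : IsBump Ω η) : HasCompactSupport (gradient η) :=
  h.compact_support.mono' fun x hx => by
    by_contra hx'
    exact hx (gradient_of_notMem_tsupport hx')

theorem eq_zero_of_notMem (h : IsBump Ω η) {x : Space n} (hx : x ∉ Ω) : η x = 0 :=
  image_eq_zero_of_notMem_tsupport fun h' => hx (h.support_subset h')

theorem gradient_eq_zero_of_notMem (h : IsBump Ω η) {x : Space n} (hx : x ∉ Ω) :
    gradient η x = 0 :=
  gradient_of_notMem_tsupport fun h' => hx (h.support_subset h')

theorem memLp (h : IsBump Ω η) (p : ℝ≥0∞) (μ : Measure (Space n)) [IsFiniteMeasureOnCompacts μ] :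
    MemLp η p μ :=
  h.continuous.memLp_of_hasCompactSupport h.compact_support

theorem memLp_gradient (h : IsBump Ω η) (p : ℝ≥0∞) (μ : Measure (Space n))
    [IsFiniteMeasureOnCompacts μ] : MemLp (gradient η) p μ :=
  h.continuous_gradient.memLp_of_hasCompactSupport h.hasCompactSupport_gradient

theorem exists_bound_gradient (h : IsBump Ω η) : ∃ C, ∀ x, ‖gradient η x‖ ≤ C :=
  h.continuous_gradient.bounded_above_of_compact_support h.hasCompactSupport_gradient

theorem comp (h : IsBump Ω η) {f : ℝ → ℝ} (hf : ContDiff ℝ ∞ f) (hf0 : f 0 = 0) :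
    IsBump Ω (fun x => f (η x)) where
  smooth := hf.comp h.smooth
  compact_support := h.compact_support.comp_left hf0
  support_subset := (closure_mono (Function.support_comp_subset hf0 η)).trans h.support_subset

theorem mul (h : IsBump Ω η) {χ : Space n → ℝ} (hχ : ContDiff ℝ ∞ χ) :
    IsBump Ω (fun x => χ x * η x) where
  smooth := hχ.mul h.smooth
  compact_support := h.compact_support.mul_left
  support_subset := (tsupport_mul_subset_right).trans h.support_subset

theorem add (h : IsBump Ω η) {ζ : Space n → ℝ} (hζ : IsBump Ω ζ) :
    IsBump Ω (fun x => η x + ζ x) where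
  smooth := h.smooth.add hζ.smooth
  compact_support := h.compact_support.add hζ.compact_support
  support_subset := (tsupport_add η ζ).trans (union_subset h.support_subset hζ.support_subset)

end IsBump

/-- Equality to `1` near each point of `K`, not merely on `K`, makes the gradient of the cutoff
vanish on `K` as well. -/
theorem exists_isBump_eventually_eq_one {Ω K : Set (Space n)} (hΩ : IsOpen Ω) (hK : IsCompact K)
    (hKΩ : K ⊆ Ω) : ∃ χ : Space n → ℝ, IsBump Ω χ ∧ ∀ x ∈ K, χ =ᶠ[𝓝 x] fun _ => 1 := by
  obtain ⟨V, hVo, hKV, hVΩ, hVc⟩ := exists_open_between_and_isCompact_closure hK hΩ hKΩ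
  obtain ⟨U, hUo, hKU, hUV, hUc⟩ := exists_open_between_and_isCompact_closure hK hVo hKV
  obtain ⟨f, hf, -, hsupp, hone⟩ := exists_contMDiff_support_eq_eq_one_iff
    (modelWithCornersSelf ℝ (Space n)) (n := ⊤) hVo isClosed_closure hUV
  have hts : tsupport f ⊆ closure V := by rw [tsupport, hsupp]
  refine ⟨f, ⟨hf.contDiff, hVc.of_isClosed_subset (isClosed_tsupport f) hts, hts.trans hVΩ⟩,
    fun x hx => ?_⟩
  filter_upwards [hUo.mem_nhds (hKU hx)] with y hy
  exact (hone y).1 (subset_closure hy)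

/-! ### Weak gradients: localization, mollification, uniqueness, chain rule. -/

section WeakGradient

variable {Ω : Set (Space n)}

theorem setIntegral_eq_integral_of_isBump {E : Type*} [NormedAddCommGroup E] [NormedSpace ℝ E]
    {η : Space n → ℝ} (_ : IsBump Ω η) {F : Space n → E} (hF : ∀ x ∉ tsupport η, F x = 0) :
    ∫ x in Ω, F x = ∫ x, F x :=
  setIntegral_eq_integral_of_forall_compl_eq_zero fun x hx =>
    hF x fun h' => hx (IsBump.support_subset ‹_› h')

/-- A locally integrable function times a continuous function compactly supported in `Ω`. -/
theorem integrable_smul_of_locallyIntegrableOn {E : Type*} [NormedAddCommGroup E] [NormedSpace ℝ E]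
    {c : Space n → ℝ} {u : Space n → E} {K : Set (Space n)} (hu : LocallyIntegrableOn u Ω)
    (hc : Continuous c) (hK : IsCompact K) (hKΩ : K ⊆ Ω) (h0 : ∀ x ∉ K, c x = 0) :
    Integrable (fun x => c x • u x) := by
  rw [← integrableOn_iff_integrable_of_support_subset (s := K)]
  · exact (hu.integrableOn_compact_subset hKΩ hK).continuousOn_smul hc.continuousOn hK
  · intro x hx
    by_contra h
    exact hx (by simp [h0 x h])

theorem integrable_mul_of_locallyIntegrableOn
    {c u : Space n → ℝ} {K : Set (Space n)} (hu : LocallyIntegrableOn u Ω)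
    (hc : Continuous c) (hK : IsCompact K) (hKΩ : K ⊆ Ω) (h0 : ∀ x ∉ K, c x = 0) :
    Integrable (fun x => u x * c x) := by
  simpa [mul_comm] using integrable_smul_of_locallyIntegrableOn hu hc hK hKΩ h0

theorem locallyIntegrableOn_coord {g : Space n → Space n} (hg : LocallyIntegrableOn g Ω)
    (i : Fin n) : LocallyIntegrableOn (fun x => g x i) Ω := fun x hx => by
  obtain ⟨s, hs, hi⟩ := hg x hx
  exact ⟨s, hs, (EuclideanSpace.proj (𝕜 := ℝ) i).integrable_comp hi⟩

theorem continuous_gradient_coord {η : Space n → ℝ} (h : IsBump Ω η) (i : Fin n) :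
    Continuous fun x => gradient η x i :=
  (EuclideanSpace.proj (𝕜 := ℝ) i).continuous.comp h.continuous_gradient

theorem coord_gradient_of_notMem_tsupport {η : Space n → ℝ} {x : Space n}
    (hx : x ∉ tsupport η) (i : Fin n) : gradient η x i = 0 := by
  rw [gradient_of_notMem_tsupport hx]; rfl

namespace HasWeakGradient

variable {u : Space n → ℝ} {g : Space n → Space n}

theorem integral_eq' (h : HasWeakGradient Ω u g) {η : Space n → ℝ} (hη : IsBump Ω η)
    (i : Fin n) : ∫ x, u x * gradient η x i = -∫ x, g x i * η x := by
  have := h.integral_eq η hη i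
  rwa [setIntegral_eq_integral_of_isBump hη fun x hx => by
      rw [coord_gradient_of_notMem_tsupport hx, mul_zero],
    setIntegral_eq_integral_of_isBump hη fun x hx => by
      rw [image_eq_zero_of_notMem_tsupport hx, mul_zero]] at this

theorem of_integral_eq (hu : LocallyIntegrableOn u Ω) (hg : LocallyIntegrableOn g Ω)
    (h : ∀ η : Space n → ℝ, IsBump Ω η → ∀ i : Fin n,
      ∫ x, u x * gradient η x i = -∫ x, g x i * η x) : HasWeakGradient Ω u g :=
  ⟨hu, hg, fun η hη i => by
    rw [setIntegral_eq_integral_of_isBump hη fun x hx => by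
        rw [coord_gradient_of_notMem_tsupport hx, mul_zero],
      setIntegral_eq_integral_of_isBump hη fun x hx => by
        rw [image_eq_zero_of_notMem_tsupport hx, mul_zero]]
    exact h η hη i⟩

end HasWeakGradient

/-- Integration by parts of a `C¹` function against a bump function. -/
theorem integral_mul_gradient_of_contDiff {u η : Space n → ℝ} (hu : ContDiff ℝ 1 u)
    (hη : IsBump Ω η) (i : Fin n) :
    ∫ x, u x * gradient η x i = -∫ x, gradient u x i * η x := by
  have hcu : Continuous fun x => gradient u x i :=
    (EuclideanSpace.proj (𝕜 := ℝ) i).continuous.comp (continuous_gradient hu)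
  have hcη := continuous_gradient_coord hη i
  have hsη : HasCompactSupport fun x => gradient η x i :=
    hη.compact_support.mono' fun x hx => by
      by_contra hx'
      exact hx (coord_gradient_of_notMem_tsupport hx' i)
  simp only [gradient_apply] at *
  refine integral_mul_fderiv_eq_neg_fderiv_mul_of_integrable ?_ ?_ ?_
    (fun x _ => hu.differentiable one_ne_zero x) (fun x _ => hη.differentiable x)
  · exact (hcu.mul hη.continuous).integrable_of_hasCompactSupport hη.compact_support.mul_left
  · exact (hu.continuous.mul hcη).integrable_of_hasCompactSupport hsη.mul_left
  · exact (hu.continuous.mul hη.continuous).integrable_of_hasCompactSupport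
      hη.compact_support.mul_left

theorem hasWeakGradient_of_contDiff {u : Space n → ℝ} (hu : ContDiff ℝ 1 u) :
    HasWeakGradient Ω u (gradient u) :=
  .of_integral_eq (hu.continuous.locallyIntegrable.locallyIntegrableOn _)
    ((continuous_gradient hu).locallyIntegrable.locallyIntegrableOn _)
    fun _ hη i => integral_mul_gradient_of_contDiff hu hη i

/-- Multiplication by a cutoff function extends a weakly differentiable function to `ℝⁿ`. -/
theorem HasWeakGradient.bump_mul {u : Space n → ℝ} {g : Space n → Space n}
    (h : HasWeakGradient Ω u g) {χ : Space n → ℝ} (hχ : IsBump Ω χ) :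
    HasWeakGradient univ (fun x => χ x * u x) (fun x => χ x • g x + u x • gradient χ x) ∧
      Integrable (fun x => χ x * u x) ∧
      Integrable (fun x => χ x • g x + u x • gradient χ x) := by
  have hK := hχ.compact_support.isCompact
  have hKΩ := hχ.support_subset
  have h0 : ∀ x ∉ tsupport χ, χ x = 0 := fun x hx => image_eq_zero_of_notMem_tsupport hx
  have i1 : Integrable (fun x => χ x * u x) :=
    integrable_smul_of_locallyIntegrableOn h.locallyIntegrableOn_fun hχ.continuous hK hKΩ h0
  have i2 : Integrable (fun x => χ x • g x) :=
    integrable_smul_of_locallyIntegrableOn h.locallyIntegrableOn_grad hχ.continuous hK hKΩ h0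
  have i3 : Integrable (fun x => u x • gradient χ x) := by
    rw [← integrableOn_iff_integrable_of_support_subset (s := tsupport χ)]
    · exact (h.locallyIntegrableOn_fun.integrableOn_compact_subset hKΩ hK).smul_continuousOn
        hχ.continuous_gradient.continuousOn hK
    · intro x hx
      by_contra hx'
      exact hx (by simp [gradient_of_notMem_tsupport hx'])
  refine ⟨.of_integral_eq (i1.locallyIntegrable.locallyIntegrableOn _)
    ((i2.add i3).locallyIntegrable.locallyIntegrableOn _) fun η hη i => ?_, i1, i2.add i3⟩
  -- Testing `u` with `η χ` is legitimate in `Ω`; the product rule moves the term `u η ∇χ` into the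
  -- new gradient.
  have hηχ : IsBump Ω (fun x => η x * χ x) := hχ.mul hη.smooth
  have key := h.integral_eq' hηχ i
  have e1 : ∀ x, u x * gradient (fun x => η x * χ x) x i =
      χ x * u x * gradient η x i + u x * gradient χ x i * η x := fun x => by
    rw [gradient_mul (hη.differentiable x) (hχ.differentiable x)]
    simp only [PiLp.add_apply, PiLp.smul_apply, smul_eq_mul]
    ring
  have j1 : Integrable (fun x => χ x * u x * gradient η x i) := by
    have := integrable_mul_of_locallyIntegrableOn h.locallyIntegrableOn_fun
      (hχ.continuous.mul (continuous_gradient_coord hη i)) hK hKΩ fun x hx => by simp [h0 x hx]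
    refine this.congr (ae_of_all _ fun x => ?_)
    simp only [Pi.mul_apply]; ring
  have j2 : Integrable (fun x => u x * gradient χ x i * η x) := by
    have := integrable_mul_of_locallyIntegrableOn h.locallyIntegrableOn_fun
      ((continuous_gradient_coord hχ i).mul hη.continuous) hK hKΩ fun x hx => by
        simp [coord_gradient_of_notMem_tsupport hx]
    refine this.congr (ae_of_all _ fun x => ?_)
    simp only [Pi.mul_apply]; ring
  have j3 : Integrable (fun x => g x i * (η x * χ x)) :=
    integrable_mul_of_locallyIntegrableOn (locallyIntegrableOn_coord h.locallyIntegrableOn_grad i)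
      (hη.continuous.mul hχ.continuous) hK hKΩ fun x hx => by simp [h0 x hx]
  simp_rw [e1] at key
  rw [integral_add j1 j2] at key
  have e2 : ∀ x, (χ x • g x + u x • gradient χ x) i * η x =
      g x i * (η x * χ x) + u x * gradient χ x i * η x := fun x => by
    simp only [PiLp.add_apply, PiLp.smul_apply, smul_eq_mul]
    ring
  simp_rw [e2]
  rw [integral_add j3 j2]
  linarith

/-- The derivative falls on the kernel, and `y ↦ ρ (x - y)` is itself a test function, so the weak
gradient identity moves it back onto `u`. -/
theorem gradient_mollify {u : Space n → ℝ} {g : Space n → Space n}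
    (h : HasWeakGradient univ u g) (ρ : ContDiffBump (0 : Space n)) (x : Space n) :
    gradient (mollify ρ u) x = mollify ρ g x := by
  have hu : LocallyIntegrable u := locallyIntegrableOn_univ.1 h.locallyIntegrableOn_fun
  have hg : LocallyIntegrable g := locallyIntegrableOn_univ.1 h.locallyIntegrableOn_grad
  have hρ : ContDiff ℝ 1 (ρ.normed volume) := ρ.contDiff_normed
  ext i
  rw [gradient_apply, mollify, ← convolution_flip,
    (HasCompactSupport.hasFDerivAt_convolution_right _ ρ.hasCompactSupport_normed hu hρ x).fderiv,
    convolution_precompR_apply _ hu (ρ.hasCompactSupport_normed.fderiv ℝ)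
      (hρ.continuous_fderiv one_ne_zero)]
  set η : Space n → ℝ := fun y => ρ.normed volume (x - y)
  have hη : IsBump univ η := by
    refine ⟨ρ.contDiff_normed.comp (contDiff_const.sub contDiff_id), ?_, subset_univ _⟩
    exact ρ.hasCompactSupport_normed.comp_homeomorph (Homeomorph.subLeft x)
  have hgrad : ∀ y, gradient η y i =
      -fderiv ℝ (ρ.normed volume) (x - y) (EuclideanSpace.single i 1) := fun y => by
    rw [gradient_apply]
    have h1 : HasFDerivAt η _ y := ((hρ.differentiable one_ne_zero (x - y)).hasFDerivAt).comp y
      ((hasFDerivAt_id y).const_sub x)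
    rw [h1.fderiv]
    simp
  have key := h.integral_eq' hη i
  rw [convolution_def, mollify_apply', show ∀ v : Space n, v i = EuclideanSpace.proj (𝕜 := ℝ) i v
    from fun v => rfl, ← ContinuousLinearMap.integral_comp_comm]
  · simp_rw [hgrad, mul_neg, integral_neg] at key
    simp only [ContinuousLinearMap.flip_apply, ContinuousLinearMap.lsmul_apply, smul_eq_mul,
      map_smul]
    have e : ∀ y, ρ.normed volume (x - y) * EuclideanSpace.proj (𝕜 := ℝ) i (g y) =
        g y i * η y := fun y => mul_comm _ _
    simp_rw [e, mul_comm _ (u _)]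
    linarith
  · exact integrable_smul_of_locallyIntegrableOn h.locallyIntegrableOn_grad hη.continuous
      hη.compact_support.isCompact (subset_univ _)
      fun y hy => image_eq_zero_of_notMem_tsupport (f := η) hy

/-- Fundamental lemma of the calculus of variations, applied to each coordinate of `g - g'`. -/
theorem HasWeakGradient.unique (hΩ : IsOpen Ω) {u : Space n → ℝ} {g g' : Space n → Space n}
    (h : HasWeakGradient Ω u g) (h' : HasWeakGradient Ω u g') :
    ∀ᵐ x ∂volume.restrict Ω, g x = g' x := by
  have : ∀ i : Fin n, ∀ᵐ x, x ∈ Ω → g x i - g' x i = 0 := fun i => by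
    have l1 := locallyIntegrableOn_coord h.locallyIntegrableOn_grad i
    have l2 := locallyIntegrableOn_coord h'.locallyIntegrableOn_grad i
    refine hΩ.ae_eq_zero_of_integral_contDiff_smul_eq_zero (l1.sub l2) fun η h1 h2 h3 => ?_
    have hη : IsBump Ω η := ⟨h1, h2, h3⟩
    have e1 := h.integral_eq' hη i
    have e2 := h'.integral_eq' hη i
    have k1 := integrable_mul_of_locallyIntegrableOn l1 hη.continuous h2 h3
      fun x hx => image_eq_zero_of_notMem_tsupport hx
    have k2 := integrable_mul_of_locallyIntegrableOn l2 hη.continuous h2 h3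
      fun x hx => image_eq_zero_of_notMem_tsupport hx
    calc ∫ x, η x • (g x i - g' x i) = ∫ x, (g x i * η x - g' x i * η x) := by
          congr 1; ext x; simp only [smul_eq_mul]; ring
      _ = 0 := by rw [integral_sub k1 k2]; linarith
  rw [ae_restrict_iff' hΩ.measurableSet]
  filter_upwards [ae_all_iff.2 this] with x hx hxΩ
  ext i
  exact sub_eq_zero.1 (hx i hxΩ)

end WeakGradient

/-- All translates of `u` have the same norm, so the mollification error is at most `2 ‖u‖`. -/
theorem memLp_mollify {E : Type*} [NormedAddCommGroup E] [NormedSpace ℝ E] [CompleteSpace E]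
    (ρ : ContDiffBump (0 : Space n)) {p : ℝ≥0∞} (hp : 1 ≤ p) (hp' : p ≠ ⊤) {u : Space n → E}
    (hu : MemLp u p volume) : MemLp (mollify ρ u) p volume := by
  have h : MemLp (fun x => mollify ρ u x - u x) p volume := by
    refine ⟨(contDiff_mollify ρ (hu.locallyIntegrable hp)).continuous.aestronglyMeasurable.sub hu.1,
      (eLpNorm_mollify_sub_le ρ hp hp' hu (ε := 2 * eLpNorm u p volume) fun y _ => ?_).trans_lt
        (ENNReal.mul_lt_top (by simp) hu.2)⟩
    have hm := measurePreserving_sub_right volume y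
    have hu' := hu.comp_measurePreserving hm
    refine (eLpNorm_sub_le hu'.1 hu.1 hp).trans ?_
    rw [eLpNorm_comp_measurePreserving hu.1 hm, two_mul]
  have := h.add hu
  refine this.congr_norm (this.1.congr (ae_of_all _ fun x => ?_)) (ae_of_all _ fun x => ?_) <;> simp

theorem abs_sub_le_of_abs_deriv_le {Φ : ℝ → ℝ} (hΦ : ContDiff ℝ 1 Φ) {C : ℝ}
    (hC : ∀ r, |deriv Φ r| ≤ C) (a b : ℝ) : |Φ a - Φ b| ≤ C * |a - b| :=
  convex_univ.norm_image_sub_le_of_norm_deriv_le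
    (fun x _ => hΦ.differentiable one_ne_zero x) (fun x _ => hC x) (mem_univ b) (mem_univ a)

section ChainRule

variable {Ω : Set (Space n)} {u : Space n → ℝ} {g : Space n → Space n}

theorem LocallyIntegrableOn.of_norm_le {E F : Type*} [NormedAddCommGroup E] [NormedAddCommGroup F]
    {u : Space n → E} {v : Space n → F} {C : ℝ}
    (hu : LocallyIntegrableOn u Ω) (hv : AEStronglyMeasurable v (volume.restrict Ω))
    (h : ∀ x, ‖v x‖ ≤ C * ‖u x‖) : LocallyIntegrableOn v Ω := fun x hx => by
  obtain ⟨s, hs, hi⟩ := hu x hx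
  refine ⟨s ∩ Ω, inter_mem hs self_mem_nhdsWithin, ?_⟩
  refine Integrable.mono' ((hi.mono_set inter_subset_left).norm.const_mul C)
    (hv.mono_measure (Measure.restrict_mono inter_subset_right le_rfl)) (ae_of_all _ h)

/-- Chain rule for weak gradients. -/
theorem HasWeakGradient.comp (hΩ : IsOpen Ω) (h : HasWeakGradient Ω u g) {Φ : ℝ → ℝ}
    (hΦ : ContDiff ℝ 1 Φ) (hΦ0 : Φ 0 = 0) {C : ℝ} (hC : ∀ r, |deriv Φ r| ≤ C) :
    HasWeakGradient Ω (fun x => Φ (u x)) (fun x => deriv Φ (u x) • g x) := by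
  have hdΦ : Continuous (deriv Φ) := hΦ.continuous_deriv le_rfl
  have hum := h.locallyIntegrableOn_fun.aestronglyMeasurable
  have hgm := h.locallyIntegrableOn_grad.aestronglyMeasurable
  have hle : ∀ a, |Φ a| ≤ C * |a| := fun a => by
    simpa [hΦ0] using abs_sub_le_of_abs_deriv_le hΦ hC a 0
  refine .of_integral_eq
    (LocallyIntegrableOn.of_norm_le h.locallyIntegrableOn_fun
      (hΦ.continuous.comp_aestronglyMeasurable hum) (fun x => hle _))
    (LocallyIntegrableOn.of_norm_le h.locallyIntegrableOn_grad
      ((hdΦ.comp_aestronglyMeasurable hum).smul hgm) (C := C) (fun x => ?_)) fun η hη i => ?_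
  · rw [norm_smul]; gcongr; exact hC _
  -- Near the support of `η` the function `u` may be replaced by `χ u`, which is weakly
  -- differentiable on all of `ℝⁿ` and can be mollified. Since `η` and its gradient are bounded,
  -- `L¹` convergence suffices.
  obtain ⟨χ, hχ, hχ1⟩ := exists_isBump_eventually_eq_one hΩ hη.compact_support.isCompact
    hη.support_subset
  obtain ⟨hw, hv, hγ⟩ := h.bump_mul hχ
  set v : Space n → ℝ := fun x => χ x * u x
  set γ : Space n → Space n := fun x => χ x • g x + u x • gradient χ x
  have hv1 : MemLp v 1 volume := memLp_one_iff_integrable.2 hv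
  have hγ1 : MemLp γ 1 volume := memLp_one_iff_integrable.2 hγ
  set V : ℕ → Space n → ℝ := fun k => mollify (mollifier n k) v
  set Γ : ℕ → Space n → Space n := fun k => mollify (mollifier n k) γ
  have hVs : ∀ k, ContDiff ℝ ∞ (V k) := fun k => contDiff_mollify _ hv.locallyIntegrable
  have hVm : ∀ k, MemLp (V k) 1 volume := fun k => memLp_mollify _ le_rfl ENNReal.one_ne_top hv1
  have hΓm : ∀ k, MemLp (Γ k) 1 volume := fun k => memLp_mollify _ le_rfl ENNReal.one_ne_top hγ1
  obtain ⟨ns, hns, -, hlim⟩ := exists_subseq_tendsto_smul le_rfl ENNReal.one_ne_top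
    (fun k => (hVm k).1) hv1.1 (fun k => (hΓm k).1) hγ1
    (tendsto_eLpNorm_mollify_sub le_rfl ENNReal.one_ne_top hv1)
    (tendsto_eLpNorm_mollify_sub le_rfl ENNReal.one_ne_top hγ1) hdΦ hC
  have hlimΦ : Tendsto (fun k => eLpNorm (fun x => Φ (V (ns k) x) - Φ (v x)) 1 volume)
      atTop (𝓝 0) := by
    have h2 := ENNReal.Tendsto.const_mul ((tendsto_eLpNorm_mollify_sub le_rfl
      ENNReal.one_ne_top hv1).comp hns.tendsto_atTop) (Or.inr (ENNReal.ofReal_ne_top (r := C)))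
    rw [mul_zero] at h2
    exact tendsto_of_tendsto_of_tendsto_of_le_of_le tendsto_const_nhds h2 (fun _ => zero_le)
      fun k => eLpNorm_le_mul_eLpNorm_of_ae_le_mul
        (ae_of_all _ fun x => abs_sub_le_of_abs_deriv_le hΦ hC _ _) 1
  have hΦm : ∀ {w : Space n → ℝ}, MemLp w 1 volume → MemLp (fun x => Φ (w x)) 1 volume :=
    fun hw => hw.of_le_mul (hΦ.continuous.comp_aestronglyMeasurable hw.1)
      (ae_of_all _ fun x => hle _)
  have hdm : ∀ {w : Space n → ℝ} {G : Space n → Space n}, MemLp w 1 volume → MemLp G 1 volume →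
      MemLp (fun x => deriv Φ (w x) • G x) 1 volume := fun hw hG =>
    hG.of_le_mul (c := C) ((hdΦ.comp_aestronglyMeasurable hw.1).smul hG.1)
      (ae_of_all _ fun x => by
        rw [norm_smul]; gcongr; exact hC _)
  have hcη := continuous_gradient_coord hη i
  have hsη : HasCompactSupport fun x => gradient η x i :=
    hη.compact_support.mono' fun x hx => by
      by_contra hx'
      exact hx (coord_gradient_of_notMem_tsupport hx' i)
  have t1 := tendsto_integral_inner (hcη.memLp_of_hasCompactSupport (p := ⊤) (μ := volume) hsη)
    (fun k => hΦm (hVm (ns k))) (hΦm hv1) hlimΦ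
  have hEη : MemLp (fun x => EuclideanSpace.single i (η x) : Space n → Space n) ⊤ volume := by
    have e : (fun x => EuclideanSpace.single i (η x) : Space n → Space n) =
        fun x => η x • EuclideanSpace.single i (1 : ℝ) := by
      ext x j; simp
    rw [e]
    exact (hη.continuous.smul continuous_const).memLp_of_hasCompactSupport
      hη.compact_support.smul_right
  have t2 := tendsto_integral_inner hEη (fun k => hdm (hVm (ns k)) (hΓm (ns k)))
    (hdm hv1 hγ1) hlim
  simp only [EuclideanSpace.inner_single_left, RCLike.inner_apply, conj_trivial] at t1 t2
  have key : ∀ k, ∫ x, Φ (V k x) * gradient η x i =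
      -∫ x, η x * (deriv Φ (V k x) • Γ k x) i := fun k => by
    have h1 : ContDiff ℝ 1 (V k) := (hVs k).of_le (by simp)
    refine (integral_mul_gradient_of_contDiff (hΦ.comp h1) hη i).trans ?_
    congr 1
    refine integral_congr_ae (ae_of_all _ fun x => ?_)
    dsimp only
    rw [show Φ ∘ V k = fun y => Φ (V k y) from rfl,
      gradient_comp (hΦ.differentiable one_ne_zero _) (h1.differentiable one_ne_zero _),
      gradient_mollify hw, mul_comm]
  simp_rw [key] at t1
  have hfin := tendsto_nhds_unique t1 t2.neg
  have hx1 : ∀ x ∈ tsupport η, v x = u x ∧ γ x = g x := fun x hx => by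
    have := hχ1 x hx
    simp [v, γ, this.self_of_nhds, gradient_eq_zero_of_eventuallyEq_const this]
  calc ∫ x, Φ (u x) * gradient η x i = ∫ x, Φ (v x) * gradient η x i := by
        refine integral_congr_ae (ae_of_all _ fun x => ?_)
        by_cases hx : x ∈ tsupport η
        · simp only [(hx1 x hx).1]
        · simp [coord_gradient_of_notMem_tsupport hx]
    _ = _ := by
        rw [hfin]
        congr 1
        refine integral_congr_ae (ae_of_all _ fun x => ?_)
        by_cases hx : x ∈ tsupport η
        · simp only [(hx1 x hx).1, (hx1 x hx).2, mul_comm]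
        · simp [image_eq_zero_of_notMem_tsupport hx]

end ChainRule

/-! ### The space `W₀^{1,p}`: closedness, sums, smooth composition. -/

section SobolevZero

variable {Ω : Set (Space n)} {p : ℝ} {u : Space n → ℝ} {g : Space n → Space n}

theorem one_le_ofReal (hp : 1 < p) : 1 ≤ ENNReal.ofReal p := by
  rw [← ENNReal.ofReal_one]; exact ENNReal.ofReal_le_ofReal hp.le

theorem locallyIntegrableOn_of_memLp [IsFiniteMeasure (volume.restrict Ω)] (hp : 1 < p)
    {E : Type*} [NormedAddCommGroup E] {u : Space n → E}
    (hu : MemLp u (ENNReal.ofReal p) (volume.restrict Ω)) : LocallyIntegrableOn u Ω :=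
  IntegrableOn.locallyIntegrableOn (hu.integrable (one_le_ofReal hp))

/-- A limit in `W^{1,p}(Ω)` of bump functions belongs to `W₀^{1,p}(Ω)`. -/
theorem MemSobolevZero.of_tendsto_isBump [IsFiniteMeasure (volume.restrict Ω)] (hp : 1 < p)
    {η : ℕ → Space n → ℝ} (hη : ∀ k, IsBump Ω (η k))
    (hu : MemLp u (ENNReal.ofReal p) (volume.restrict Ω))
    (hg : MemLp g (ENNReal.ofReal p) (volume.restrict Ω))
    (hlim : Tendsto (fun k => eLpNorm (fun x => η k x - u x) (ENNReal.ofReal p)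
      (volume.restrict Ω)) atTop (𝓝 0))
    (hlim' : Tendsto (fun k => eLpNorm (fun x => gradient (η k) x - g x) (ENNReal.ofReal p)
      (volume.restrict Ω)) atTop (𝓝 0)) : MemSobolevZero p Ω u g := by
  have hconj := (ENNReal.HolderConjugate.conjExponent (one_le_ofReal hp)).symm
  have h1 : HasWeakGradient Ω u g := by
    refine ⟨locallyIntegrableOn_of_memLp hp hu, locallyIntegrableOn_of_memLp hp hg,
      fun ζ hζ i => ?_⟩
    set q := (ENNReal.ofReal p).conjExponent
    have hsζ : HasCompactSupport fun x => gradient ζ x i :=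
      hζ.compact_support.mono' fun x hx => by
        by_contra hx'
        exact hx (coord_gradient_of_notMem_tsupport hx' i)
    -- Both sides of the integration by parts are pairings with fixed elements of the dual `L^q`, so
    -- the identity passes from the bump functions to the limit.
    have t1 := tendsto_integral_inner (q := q) (p := ENNReal.ofReal p)
      ((continuous_gradient_coord hζ i).memLp_of_hasCompactSupport (μ := volume.restrict Ω) hsζ)
      (fun k => (hη k).memLp (ENNReal.ofReal p) (volume.restrict Ω)) hu hlim
    have hEζ : MemLp (fun x => EuclideanSpace.single i (ζ x) : Space n → Space n) q
        (volume.restrict Ω) := by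
      have e : (fun x => EuclideanSpace.single i (ζ x) : Space n → Space n) =
          fun x => ζ x • EuclideanSpace.single i (1 : ℝ) := by
        ext x j; simp
      rw [e]
      exact (hζ.continuous.smul continuous_const).memLp_of_hasCompactSupport
        hζ.compact_support.smul_right
    have t2 := tendsto_integral_inner hEζ
      (fun k => (hη k).memLp_gradient (ENNReal.ofReal p) (volume.restrict Ω)) hg hlim'
    simp only [EuclideanSpace.inner_single_left, RCLike.inner_apply, conj_trivial] at t1 t2
    have key : ∀ k, ∫ x in Ω, η k x * gradient ζ x i = -∫ x in Ω, ζ x * gradient (η k) x i :=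
      fun k => by
        simp_rw [mul_comm (ζ _)]
        exact (hasWeakGradient_of_contDiff ((hη k).smooth.of_le (by simp))).integral_eq ζ hζ i
    simp_rw [key] at t1
    rw [tendsto_nhds_unique t1 t2.neg]
    simp_rw [mul_comm (ζ _)]
  refine ⟨⟨h1, hu, hg⟩, fun ε hε => ?_⟩
  obtain ⟨k, hk, hk'⟩ := ((hlim.eventually_lt_const hε).and (hlim'.eventually_lt_const hε)).exists
  refine ⟨η k, hη k, ?_, ?_⟩
  · rwa [show (fun x => u x - η k x) = -(fun x => η k x - u x) by ext; simp, eLpNorm_neg]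
  · rwa [show (fun x => g x - gradient (η k) x) = -(fun x => gradient (η k) x - g x) by
      ext; simp, eLpNorm_neg]

theorem MemSobolevZero.exists_seq (h : MemSobolevZero p Ω u g) :
    ∃ η : ℕ → Space n → ℝ, (∀ k, IsBump Ω (η k)) ∧
      Tendsto (fun k => eLpNorm (fun x => η k x - u x) (ENNReal.ofReal p)
        (volume.restrict Ω)) atTop (𝓝 0) ∧
      Tendsto (fun k => eLpNorm (fun x => gradient (η k) x - g x) (ENNReal.ofReal p)
        (volume.restrict Ω)) atTop (𝓝 0) := by
  obtain ⟨ε, -, hε, hε0⟩ := exists_seq_strictAnti_tendsto' (zero_lt_one' ℝ≥0∞)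
  choose η hη h1 h2 using fun k => h.approx (ε k) (hε k).1
  refine ⟨η, hη, ?_, ?_⟩
  · refine tendsto_of_tendsto_of_tendsto_of_le_of_le tendsto_const_nhds hε0 (fun _ => zero_le)
      fun k => ?_
    dsimp only
    rw [show (fun x => η k x - u x) = -(fun x => u x - η k x) by ext; simp, eLpNorm_neg]
    exact (h1 k).le
  · refine tendsto_of_tendsto_of_tendsto_of_le_of_le tendsto_const_nhds hε0 (fun _ => zero_le)
      fun k => ?_
    dsimp only
    rw [show (fun x => gradient (η k) x - g x) = -(fun x => g x - gradient (η k) x) by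
      ext; simp, eLpNorm_neg]
    exact (h2 k).le

/-- `W₀^{1,p}(Ω)` is closed in `W^{1,p}(Ω)`. -/
theorem MemSobolevZero.of_tendsto [IsFiniteMeasure (volume.restrict Ω)] (hp : 1 < p)
    {v : ℕ → Space n → ℝ} {G : ℕ → Space n → Space n} (hv : ∀ k, MemSobolevZero p Ω (v k) (G k))
    (hu : MemLp u (ENNReal.ofReal p) (volume.restrict Ω))
    (hg : MemLp g (ENNReal.ofReal p) (volume.restrict Ω))
    (hlim : Tendsto (fun k => eLpNorm (fun x => v k x - u x) (ENNReal.ofReal p)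
      (volume.restrict Ω)) atTop (𝓝 0))
    (hlim' : Tendsto (fun k => eLpNorm (fun x => G k x - g x) (ENNReal.ofReal p)
      (volume.restrict Ω)) atTop (𝓝 0)) : MemSobolevZero p Ω u g := by
  obtain ⟨ε, -, hε, hε0⟩ := exists_seq_strictAnti_tendsto' (zero_lt_one' ℝ≥0∞)
  choose η hη h1 h2 using fun k => (hv k).approx (ε k) (hε k).1
  refine .of_tendsto_isBump hp hη hu hg ?_ ?_
  · have := hε0.add hlim
    rw [add_zero] at this
    refine tendsto_of_tendsto_of_tendsto_of_le_of_le tendsto_const_nhds this (fun _ => zero_le)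
      fun k => ?_
    have e : (fun x => η k x - u x) = -(fun x => v k x - η k x) + fun x => v k x - u x := by
      ext x; simp
    have m1 := (hv k).memSobolev.memLp_fun
    dsimp only
    rw [e]
    refine (eLpNorm_add_le (m1.1.sub ((hη k).memLp (ENNReal.ofReal p) _).1).neg (m1.1.sub hu.1)
      (one_le_ofReal hp)).trans ?_
    rw [eLpNorm_neg]
    exact add_le_add (h1 k).le le_rfl
  · have := hε0.add hlim'
    rw [add_zero] at this
    refine tendsto_of_tendsto_of_tendsto_of_le_of_le tendsto_const_nhds this (fun _ => zero_le)
      fun k => ?_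
    have e : (fun x => gradient (η k) x - g x) = -(fun x => G k x - gradient (η k) x) +
        fun x => G k x - g x := by
      ext x; simp
    have m1 := (hv k).memSobolev.memLp_grad
    dsimp only
    rw [e]
    refine (eLpNorm_add_le (m1.1.sub ((hη k).memLp_gradient (ENNReal.ofReal p) _).1).neg
      (m1.1.sub hg.1) (one_le_ofReal hp)).trans ?_
    rw [eLpNorm_neg]
    exact add_le_add (h2 k).le le_rfl

theorem MemSobolevZero.add [IsFiniteMeasure (volume.restrict Ω)] (hp : 1 < p)
    {v : Space n → ℝ} {G : Space n → Space n}
    (h : MemSobolevZero p Ω u g) (h' : MemSobolevZero p Ω v G) :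
    MemSobolevZero p Ω (fun x => u x + v x) (fun x => g x + G x) := by
  obtain ⟨η, hη, l1, l2⟩ := h.exists_seq
  obtain ⟨ζ, hζ, l3, l4⟩ := h'.exists_seq
  refine .of_tendsto_isBump hp (fun k => (hη k).add (hζ k))
    (h.memSobolev.memLp_fun.add h'.memSobolev.memLp_fun)
    (h.memSobolev.memLp_grad.add h'.memSobolev.memLp_grad) ?_ ?_
  · have := l1.add l3
    rw [add_zero] at this
    refine tendsto_of_tendsto_of_tendsto_of_le_of_le tendsto_const_nhds this (fun _ => zero_le)
      fun k => ?_
    have e : (fun x => η k x + ζ k x - (u x + v x)) =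
        (fun x => η k x - u x) + fun x => ζ k x - v x := by
      ext x; simp only [Pi.add_apply]; ring
    dsimp only
    rw [e]
    exact eLpNorm_add_le (((hη k).memLp (ENNReal.ofReal p) _).1.sub h.memSobolev.memLp_fun.1)
      (((hζ k).memLp (ENNReal.ofReal p) _).1.sub h'.memSobolev.memLp_fun.1) (one_le_ofReal hp)
  · have := l2.add l4
    rw [add_zero] at this
    refine tendsto_of_tendsto_of_tendsto_of_le_of_le tendsto_const_nhds this (fun _ => zero_le)
      fun k => ?_
    have e : (fun x => gradient (fun x => η k x + ζ k x) x - (g x + G x)) =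
        (fun x => gradient (η k) x - g x) + fun x => gradient (ζ k) x - G x := by
      ext1 x
      rw [gradient_add ((hη k).differentiable x) ((hζ k).differentiable x)]
      simp only [Pi.add_apply]; abel
    dsimp only
    rw [e]
    exact eLpNorm_add_le
      (((hη k).memLp_gradient (ENNReal.ofReal p) _).1.sub h.memSobolev.memLp_grad.1)
      (((hζ k).memLp_gradient (ENNReal.ofReal p) _).1.sub h'.memSobolev.memLp_grad.1)
      (one_le_ofReal hp)

/-- Smooth functions with bounded derivative that vanish at `0` act on `W₀^{1,p}(Ω)`; the
approximating bump functions are compositions, and may be taken to converge almost everywhere. -/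
theorem MemSobolevZero.exists_seq_comp (hp : 1 < p) (h : MemSobolevZero p Ω u g) {f : ℝ → ℝ}
    (hf : ContDiff ℝ ∞ f) {C : ℝ} (hC : ∀ r, |deriv f r| ≤ C) :
    ∃ η : ℕ → Space n → ℝ, (∀ k, IsBump Ω (η k)) ∧
      (∀ᵐ x ∂volume.restrict Ω, Tendsto (fun k => η k x) atTop (𝓝 (u x))) ∧
      Tendsto (fun k => eLpNorm (fun x => f (η k x) - f (u x)) (ENNReal.ofReal p)
        (volume.restrict Ω)) atTop (𝓝 0) ∧
      Tendsto (fun k => eLpNorm (fun x => gradient (fun y => f (η k y)) x - deriv f (u x) • g x)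
        (ENNReal.ofReal p) (volume.restrict Ω)) atTop (𝓝 0) := by
  obtain ⟨η, hη, l1, l2⟩ := h.exists_seq
  have hf1 : ContDiff ℝ 1 f := hf.of_le (by simp)
  obtain ⟨ns, hns, hae, hlim⟩ := exists_subseq_tendsto_smul (one_le_ofReal hp)
    ENNReal.ofReal_ne_top (fun k => ((hη k).memLp (ENNReal.ofReal p) _).1)
    h.memSobolev.memLp_fun.1 (fun k => ((hη k).memLp_gradient (ENNReal.ofReal p) _).1)
    h.memSobolev.memLp_grad l1 l2 (hf1.continuous_deriv le_rfl) hC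
  refine ⟨fun k => η (ns k), fun k => hη _, hae, ?_, hlim.congr fun k => ?_⟩
  · have h2 := ENNReal.Tendsto.const_mul (l1.comp hns.tendsto_atTop)
      (Or.inr (ENNReal.ofReal_ne_top (r := C)))
    rw [mul_zero] at h2
    exact tendsto_of_tendsto_of_tendsto_of_le_of_le tendsto_const_nhds h2 (fun _ => zero_le)
      fun k => eLpNorm_le_mul_eLpNorm_of_ae_le_mul
        (ae_of_all _ fun x => abs_sub_le_of_abs_deriv_le hf1 hC _ _) _
  · congr 1
    ext1 x
    rw [gradient_comp (hf1.differentiable one_ne_zero _) ((hη _).differentiable x)]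

theorem memLp_comp {μ : Measure (Space n)} {P : ℝ≥0∞} (hu : MemLp u P μ) {f : ℝ → ℝ}
    (hf : ContDiff ℝ 1 f) (hf0 : f 0 = 0) {C : ℝ} (hC : ∀ r, |deriv f r| ≤ C) :
    MemLp (fun x => f (u x)) P μ :=
  hu.of_le_mul (c := C) (hf.continuous.comp_aestronglyMeasurable hu.1) (ae_of_all _ fun x => by
    simpa [hf0] using abs_sub_le_of_abs_deriv_le hf hC (u x) 0)

theorem memLp_deriv_smul {μ : Measure (Space n)} {P : ℝ≥0∞} (hu : AEStronglyMeasurable u μ)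
    (hg : MemLp g P μ) {f : ℝ → ℝ}
    (hf : ContDiff ℝ 1 f) {C : ℝ} (hC : ∀ r, |deriv f r| ≤ C) :
    MemLp (fun x => deriv f (u x) • g x) P μ :=
  hg.of_le_mul (c := C) (((hf.continuous_deriv le_rfl).comp_aestronglyMeasurable hu).smul hg.1)
    (ae_of_all _ fun x => by
      rw [norm_smul]; gcongr; exact hC _)

theorem MemSobolevZero.comp [IsFiniteMeasure (volume.restrict Ω)] (hp : 1 < p)
    (h : MemSobolevZero p Ω u g) {f : ℝ → ℝ}
    (hf : ContDiff ℝ ∞ f) (hf0 : f 0 = 0) {C : ℝ} (hC : ∀ r, |deriv f r| ≤ C) :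
    MemSobolevZero p Ω (fun x => f (u x)) (fun x => deriv f (u x) • g x) := by
  obtain ⟨η, hη, -, l1, l2⟩ := h.exists_seq_comp hp hf hC
  have hf1 : ContDiff ℝ 1 f := hf.of_le (by simp)
  exact .of_tendsto_isBump hp (fun k => (hη k).comp hf hf0)
    (memLp_comp h.memSobolev.memLp_fun hf1 hf0 hC)
    (memLp_deriv_smul h.memSobolev.memLp_fun.1 h.memSobolev.memLp_grad hf1 hC) l1 l2

end SobolevZero

/-! ### The truncation and its convex primitive. -/

section Truncation

/-- A smooth bounded nonnegative truncation, vanishing exactly at `0`. -/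
def truncation (r : ℝ) : ℝ := r ^ 2 / (1 + r ^ 2)

/-- The convex primitive of `r ↦ truncation r⁺`. -/
def entropy (r : ℝ) : ℝ := max r 0 - Real.arctan (max r 0)

theorem contDiff_truncation : ContDiff ℝ ∞ truncation :=
  (contDiff_id.pow 2).div (contDiff_const.add (contDiff_id.pow 2)) fun r => by
    positivity

theorem truncation_zero : truncation 0 = 0 := by simp [truncation]

theorem truncation_nonneg (r : ℝ) : 0 ≤ truncation r := by unfold truncation; positivity

theorem truncation_le_one (r : ℝ) : truncation r ≤ 1 := by
  unfold truncation
  rw [div_le_one (by positivity)]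
  linarith

theorem abs_truncation_le_one (r : ℝ) : |truncation r| ≤ 1 := by
  rw [abs_of_nonneg (truncation_nonneg r)]; exact truncation_le_one r

theorem truncation_pos {r : ℝ} (hr : 0 < r) : 0 < truncation r := by unfold truncation; positivity

theorem hasDerivAt_truncation (r : ℝ) :
    HasDerivAt truncation (2 * r / (1 + r ^ 2) ^ 2) r := by
  have h := ((hasDerivAt_id r).pow 2).div (((hasDerivAt_id r).pow 2).const_add 1)
    (by simp only [id]; positivity : (1 : ℝ) + (id r) ^ 2 ≠ 0)
  refine h.congr_deriv ?_
  simp only [id]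
  congr 1
  simp
  ring

theorem deriv_truncation (r : ℝ) : deriv truncation r = 2 * r / (1 + r ^ 2) ^ 2 :=
  (hasDerivAt_truncation r).deriv

theorem deriv_truncation_nonneg {r : ℝ} (hr : 0 ≤ r) : 0 ≤ deriv truncation r := by
  rw [deriv_truncation]; positivity

theorem abs_deriv_truncation_le (r : ℝ) : |deriv truncation r| ≤ 1 := by
  rw [deriv_truncation, abs_div, abs_of_nonneg (by positivity : (0 : ℝ) ≤ (1 + r ^ 2) ^ 2),
    div_le_one (by positivity), abs_le]
  constructor <;> nlinarith [sq_nonneg (r - 1), sq_nonneg (r + 1), sq_nonneg (r ^ 2)]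

theorem truncation_mono {a b : ℝ} (ha : 0 ≤ a) (hab : a ≤ b) : truncation a ≤ truncation b := by
  unfold truncation
  rw [div_le_div_iff₀ (by positivity) (by positivity)]
  nlinarith [mul_self_le_mul_self ha hab]

theorem hasDerivAt_sub_arctan (r : ℝ) :
    HasDerivAt (fun r => r - Real.arctan r) (truncation r) r := by
  refine ((hasDerivAt_id r).sub (Real.hasDerivAt_arctan r)).congr_deriv ?_
  unfold truncation
  field_simp
  ring

theorem continuous_entropy : Continuous entropy := by unfold entropy; fun_prop

/-- Only `r = 0` needs care: there the derivative is obtained as the limit of the derivatives on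
both sides. -/
theorem hasDerivAt_entropy (r : ℝ) : HasDerivAt entropy (truncation (max r 0)) r := by
  have hne : ∀ r : ℝ, r ≠ 0 → HasDerivAt entropy (truncation (max r 0)) r := fun r hr => by
    rcases lt_or_gt_of_ne hr with h | h
    · rw [max_eq_right h.le, truncation_zero]
      refine (hasDerivAt_const r 0).congr_of_eventuallyEq ?_
      filter_upwards [gt_mem_nhds h] with s hs
      simp [entropy, max_eq_right hs.le]
    · rw [max_eq_left h.le]
      refine (hasDerivAt_sub_arctan r).congr_of_eventuallyEq ?_
      filter_upwards [lt_mem_nhds h] with s hs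
      simp [entropy, max_eq_left hs.le]
  by_cases hr : r = 0
  · subst hr
    exact hasDerivAt_of_hasDerivAt_of_ne (fun y hy => hne y hy) continuous_entropy.continuousAt
      (contDiff_truncation.continuous.comp (continuous_id.max continuous_const)).continuousAt
  · exact hne r hr

theorem deriv_entropy (r : ℝ) : deriv entropy r = truncation (max r 0) :=
  (hasDerivAt_entropy r).deriv

theorem contDiff_entropy : ContDiff ℝ 1 entropy := by
  rw [contDiff_one_iff_deriv]
  refine ⟨fun r => (hasDerivAt_entropy r).differentiableAt, ?_⟩
  rw [show deriv entropy = fun r => truncation (max r 0) from funext deriv_entropy]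
  exact contDiff_truncation.continuous.comp (continuous_id.max continuous_const)

theorem entropy_of_nonpos {r : ℝ} (hr : r ≤ 0) : entropy r = 0 := by
  simp [entropy, max_eq_right hr]

theorem entropy_max (r : ℝ) : entropy (max r 0) = entropy r := by simp [entropy]

theorem abs_deriv_entropy_le (r : ℝ) : |deriv entropy r| ≤ 1 := by
  rw [deriv_entropy]; exact abs_truncation_le_one _

theorem entropy_sub_le (a b : ℝ) :
    entropy b - entropy a ≤ truncation (max b 0) * (b - a) := by
  have hd : ∀ x y : ℝ, x < y → ∃ c ∈ Ioo x y,
      truncation (max c 0) * (y - x) = entropy y - entropy x := fun x y h => by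
    obtain ⟨c, hc, h'⟩ := exists_hasDerivAt_eq_slope entropy _ h
      continuous_entropy.continuousOn fun z _ => hasDerivAt_entropy z
    refine ⟨c, hc, ?_⟩
    rw [h', div_mul_cancel₀ _ (by linarith)]
  rcases lt_trichotomy a b with h | h | h
  · obtain ⟨c, hc, h'⟩ := hd a b h
    rw [← h']
    have := truncation_mono (le_max_right c 0) (max_le_max_right 0 hc.2.le)
    exact mul_le_mul_of_nonneg_right this (by linarith)
  · simp [h]
  · obtain ⟨c, hc, h'⟩ := hd b a h
    have := truncation_mono (le_max_right b 0) (max_le_max_right 0 hc.1.le)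
    nlinarith

theorem entropy_nonneg (r : ℝ) : 0 ≤ entropy r := by
  have := entropy_sub_le r 0
  simp only [max_self, truncation_zero, zero_mul, entropy_of_nonpos le_rfl] at this
  linarith

theorem entropy_le_abs (r : ℝ) : entropy r ≤ |r| := by
  simpa [entropy_of_nonpos le_rfl, abs_of_nonneg (entropy_nonneg r)] using
    abs_sub_le_of_abs_deriv_le contDiff_entropy abs_deriv_entropy_le r 0

/-- This converts the reaction term back into entropy and so closes the Gronwall argument. The
constant `3` is sharp at the origin, where `s * truncation s ~ s³` and `s - arctan s ~ s³ / 3`. -/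
theorem max_mul_truncation_le (r : ℝ) :
    max r 0 * truncation (max r 0) ≤ 3 * entropy r := by
  rw [← entropy_max]
  have h0 : 0 ≤ max r 0 := le_max_right _ _
  generalize max r 0 = s at h0
  have hd : ∀ x : ℝ, HasDerivAt (fun x => 3 * (x - Real.arctan x) - x * truncation x)
      (3 * truncation x - (1 * truncation x + x * (2 * x / (1 + x ^ 2) ^ 2))) x := fun x =>
    ((hasDerivAt_sub_arctan x).const_mul 3).sub ((hasDerivAt_id x).mul (hasDerivAt_truncation x))
  have hm : Monotone (fun x => 3 * (x - Real.arctan x) - x * truncation x) := by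
    refine monotone_of_deriv_nonneg (fun x => (hd x).differentiableAt) fun x => ?_
    rw [(hd x).deriv]
    have : 3 * truncation x - (1 * truncation x + x * (2 * x / (1 + x ^ 2) ^ 2)) =
        2 * x ^ 4 / (1 + x ^ 2) ^ 2 := by
      unfold truncation
      field_simp
      ring
    rw [this]
    positivity
  have := hm h0
  simp only [Real.arctan_zero, sub_zero, mul_zero, zero_mul] at this
  simp only [entropy, max_eq_left h0]
  linarith

theorem nonpos_of_entropy_eq_zero {r : ℝ} (h : entropy r = 0) : r ≤ 0 := by
  by_contra! hr
  have h1 := max_mul_truncation_le r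
  rw [max_eq_left hr.le, h] at h1
  nlinarith [mul_pos hr (truncation_pos hr)]

end Truncation

/-! ### Positive parts, zero boundary values and truncations in `W₀^{1,p}`. -/

section Lattice

variable {Ω : Set (Space n)} {p : ℝ}

section PosPart

/-- A smooth approximation of the positive part. -/
def smoothPos (ε r : ℝ) : ℝ := (√(r ^ 2 + ε ^ 2) + r - ε) / 2

theorem contDiff_smoothPos {ε : ℝ} (hε : 0 < ε) : ContDiff ℝ ∞ (smoothPos ε) := by
  unfold smoothPos
  refine ((((contDiff_id.pow 2).add contDiff_const).sqrt fun r => ?_).add contDiff_id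
    |>.sub contDiff_const).div_const 2
  simp only [id]; positivity

theorem smoothPos_zero {ε : ℝ} (hε : 0 < ε) : smoothPos ε 0 = 0 := by
  simp [smoothPos, Real.sqrt_sq hε.le]

theorem deriv_smoothPos {ε : ℝ} (hε : 0 < ε) (r : ℝ) :
    deriv (smoothPos ε) r = (r / √(r ^ 2 + ε ^ 2) + 1) / 2 := by
  have h0 : r ^ 2 + ε ^ 2 ≠ 0 := by positivity
  have h := (((((hasDerivAt_id r).pow 2).add_const (ε ^ 2)).sqrt
    (by simpa using h0)).add (hasDerivAt_id r) |>.sub_const ε).div_const 2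
  refine (h.congr_deriv ?_).deriv
  simp only [id]
  congr 2
  simp
  ring

theorem abs_div_sqrt_le (r ε : ℝ) : |r / √(r ^ 2 + ε ^ 2)| ≤ 1 := by
  rw [abs_div, abs_of_nonneg (Real.sqrt_nonneg _)]
  refine div_le_one_of_le₀ ?_ (Real.sqrt_nonneg _)
  rw [← Real.sqrt_sq_eq_abs]
  exact Real.sqrt_le_sqrt (by nlinarith [sq_nonneg ε])

theorem abs_deriv_smoothPos_le {ε : ℝ} (hε : 0 < ε) (r : ℝ) : |deriv (smoothPos ε) r| ≤ 1 := by
  rw [deriv_smoothPos hε]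
  have := abs_le.1 (abs_div_sqrt_le r ε)
  rw [abs_le]
  constructor <;> linarith [this.1, this.2]

theorem tendsto_sqrt_sq_add (r : ℝ) :
    Tendsto (fun k : ℕ => √(r ^ 2 + (1 / ((k : ℝ) + 1)) ^ 2)) atTop (𝓝 |r|) := by
  have h := ((tendsto_one_div_add_atTop_nhds_zero_nat (𝕜 := ℝ)).pow 2).const_add (r ^ 2)
  have := (Real.continuous_sqrt.tendsto _).comp h
  simpa [Real.sqrt_sq_eq_abs, Function.comp_def] using this

/-- `W₀^{1,p}(Ω)` is stable under positive parts. -/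
theorem MemSobolevZero.posPart [IsFiniteMeasure (volume.restrict Ω)] (hp : 1 < p)
    {u : Space n → ℝ} {g : Space n → Space n} (h : MemSobolevZero p Ω u g) :
    ∃ D, MemSobolevZero p Ω (fun x => max (u x) 0) D := by
  have hu := h.memSobolev.memLp_fun
  have hg := h.memSobolev.memLp_grad
  let ε : ℕ → ℝ := fun k => 1 / ((k : ℝ) + 1)
  have hε : ∀ k, 0 < ε k := fun k => by positivity
  have hε0 : Tendsto ε atTop (𝓝 0) := tendsto_one_div_add_atTop_nhds_zero_nat
  -- The pointwise limit of the derivatives of `smoothPos`. At `r = 0` the convention `0 / 0 = 0`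
  -- gives `1 / 2`, which is the true limit there, so nothing about the gradient on `{u = 0}` is
  -- needed.
  let d : ℝ → ℝ := fun r => (r / |r| + 1) / 2
  have hdm : Measurable d := by fun_prop
  have hd : ∀ r, |d r| ≤ 1 := fun r => by
    have : abs (r / |r|) ≤ 1 := by
      rw [abs_div, abs_abs]; exact div_self_le_one _
    have := abs_le.1 this
    simp only [d, abs_le]
    constructor <;> linarith [this.1, this.2]
  have h1 : ∀ k, ContDiff ℝ 1 (smoothPos (ε k)) := fun k =>
    (contDiff_smoothPos (hε k)).of_le (by simp)
  have hv : ∀ k, MemSobolevZero p Ω (fun x => smoothPos (ε k) (u x))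
      (fun x => deriv (smoothPos (ε k)) (u x) • g x) := fun k =>
    h.comp hp (contDiff_smoothPos (hε k)) (smoothPos_zero (hε k)) (abs_deriv_smoothPos_le (hε k))
  have hdu : AEStronglyMeasurable (fun x => d (u x)) (volume.restrict Ω) :=
    (hdm.comp_aemeasurable hu.1.aemeasurable).aestronglyMeasurable
  have hDm : MemLp (fun x => d (u x) • g x) (ENNReal.ofReal p) (volume.restrict Ω) :=
    hg.of_le_mul (c := 1) (hdu.smul hg.1) (ae_of_all _ fun x => by
      rw [norm_smul]; gcongr; exact hd _)
  have hPm : MemLp (fun x => max (u x) 0) (ENNReal.ofReal p) (volume.restrict Ω) :=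
    hu.of_le_mul (c := 1) (hu.1.sup aestronglyMeasurable_const) (ae_of_all _ fun x => by
      rw [one_mul, Real.norm_eq_abs, Real.norm_eq_abs, abs_of_nonneg (le_max_right _ _)]
      exact max_le (le_abs_self _) (abs_nonneg _))
  refine ⟨fun x => d (u x) • g x, .of_tendsto hp hv hPm hDm ?_ ?_⟩
  · refine tendsto_eLpNorm_sub_of_dominated (one_le_ofReal hp) ENNReal.ofReal_ne_top
      (B := fun x => 2 * |u x|)
      (fun k => (hv k).memSobolev.memLp_fun.1) hPm.1 (hu.norm.const_mul 2)
      (fun k => ae_of_all _ fun x => ?_) (ae_of_all _ fun x => ?_)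
    · have e1 : |smoothPos (ε k) (u x)| ≤ 1 * |u x| := by
        simpa [smoothPos_zero (hε k)] using
          abs_sub_le_of_abs_deriv_le (h1 k) (abs_deriv_smoothPos_le (hε k)) (u x) 0
      have e2 : |max (u x) 0| ≤ |u x| := by
        rw [abs_of_nonneg (le_max_right _ _)]
        exact max_le (le_abs_self _) (abs_nonneg _)
      have := norm_sub_le (smoothPos (ε k) (u x)) (max (u x) 0)
      simp only [Real.norm_eq_abs] at this ⊢
      linarith
    · have := ((tendsto_sqrt_sq_add (u x)).add_const (u x)).sub hε0 |>.div_const 2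
      have e : (|u x| + u x - 0) / 2 = max (u x) 0 := by
        rcases le_total 0 (u x) with h | h
        · rw [max_eq_left h, abs_of_nonneg h]; ring
        · rw [max_eq_right h, abs_of_nonpos h]; ring
      rw [e] at this
      exact this
  · refine tendsto_eLpNorm_sub_of_dominated (one_le_ofReal hp) ENNReal.ofReal_ne_top
      (B := fun x => 2 * ‖g x‖)
      (fun k => (hv k).memSobolev.memLp_grad.1) hDm.1 (hg.norm.const_mul 2)
      (fun k => ae_of_all _ fun x => ?_) (ae_of_all _ fun x => ?_)
    · rw [← sub_smul, norm_smul]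
      gcongr
      have := norm_sub_le (deriv (smoothPos (ε k)) (u x)) (d (u x))
      have e1 := abs_deriv_smoothPos_le (hε k) (u x)
      have e2 := hd (u x)
      simp only [Real.norm_eq_abs] at this ⊢
      linarith
    · refine Tendsto.smul_const ?_ _
      simp_rw [fun k => deriv_smoothPos (hε k)]
      refine (Tendsto.add_const 1 ?_).div_const 2
      by_cases hx : u x = 0
      · simp [hx]
      · exact tendsto_const_nhds.div (tendsto_sqrt_sq_add (u x)) (abs_ne_zero.2 hx)

end PosPart

section Boundary

theorem memLp_of_memLp_restrict {E : Type*} [NormedAddCommGroup E] {P : ℝ≥0∞} (hΩ : IsOpen Ω)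
    {v : Space n → E} (hv : MemLp v P (volume.restrict Ω)) (h0 : ∀ x ∉ Ω, v x = 0) :
    MemLp v P volume := by
  rw [← memLp_indicator_iff_restrict hΩ.measurableSet] at hv
  rwa [indicator_eq_self.2 fun x hx => by_contra fun h => hx (h0 x h)] at hv

-- Mollification enlarges the support by at most the outer radius, which eventually is smaller than
-- the distance from `K` to the complement of `Ω`.
open scoped Pointwise in
theorem isBump_mollify (hΩ : IsOpen Ω) {v : Space n → ℝ} (hv : LocallyIntegrable v)
    {K : Set (Space n)} (hK : IsCompact K) (hKΩ : K ⊆ Ω) (h0 : ∀ x ∉ K, v x = 0) :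
    ∀ᶠ k in atTop, IsBump Ω (mollify (mollifier n k) v) := by
  obtain ⟨δ, hδ, hδΩ⟩ := hK.exists_cthickening_subset_open hΩ hKΩ
  filter_upwards [(tendsto_mollifier_rOut (n := n)).eventually_lt_const hδ] with k hk
  have hc : IsCompact (Metric.closedBall (0 : Space n) δ + K) :=
    (isCompact_closedBall _ _).add hK
  have hs : tsupport (mollify (mollifier n k) v) ⊆ Metric.closedBall (0 : Space n) δ + K := by
    refine closure_minimal ?_ hc.isClosed
    refine (support_convolution_subset _).trans (add_subset_add ?_ ?_)
    · rw [ContDiffBump.support_normed_eq]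
      exact Metric.ball_subset_closedBall.trans (Metric.closedBall_subset_closedBall hk.le)
    · intro x hx
      by_contra h
      exact hx (h0 x h)
  refine ⟨contDiff_mollify _ hv, hc.of_isClosed_subset (isClosed_tsupport _) hs, hs.trans ?_⟩
  rintro _ ⟨y, hy, z, hz, rfl⟩
  refine hδΩ (Metric.mem_cthickening_of_dist_le _ z δ K hz ?_)
  simpa [dist_eq_norm] using hy

/-- The product, extended by zero, is a Sobolev function on `ℝⁿ` with compact support in `Ω`; its
mollifications are the approximating bump functions from some index `k₀` on. -/
theorem MemSobolev.bump_mul [IsFiniteMeasure (volume.restrict Ω)] (hΩ : IsOpen Ω) (hp : 1 < p)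
    {u : Space n → ℝ} {g : Space n → Space n} (h : MemSobolev p Ω u g)
    {χ : Space n → ℝ} (hχ : IsBump Ω χ) :
    MemSobolevZero p Ω (fun x => χ x * u x) (fun x => χ x • g x + u x • gradient χ x) := by
  obtain ⟨hw, hv, hγ⟩ := h.weakGradient.bump_mul hχ
  have hP := one_le_ofReal hp
  obtain ⟨C, hC⟩ := hχ.continuous.bounded_above_of_compact_support hχ.compact_support
  obtain ⟨C', hC'⟩ := hχ.exists_bound_gradient
  have hvΩ : MemLp (fun x => χ x * u x) (ENNReal.ofReal p) (volume.restrict Ω) :=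
    h.memLp_fun.of_le_mul (c := C) (hχ.continuous.aestronglyMeasurable.mul h.memLp_fun.1)
      (ae_of_all _ fun x => by rw [norm_mul]; gcongr; exact hC x)
  have hγΩ : MemLp (fun x => χ x • g x + u x • gradient χ x) (ENNReal.ofReal p)
      (volume.restrict Ω) := by
    refine MemLp.add ?_ ?_
    · exact h.memLp_grad.of_le_mul (c := C)
        (hχ.continuous.aestronglyMeasurable.smul h.memLp_grad.1)
        (ae_of_all _ fun x => by rw [norm_smul]; gcongr; exact hC x)
    · exact h.memLp_fun.of_le_mul (c := C')
        (h.memLp_fun.1.smul hχ.continuous_gradient.aestronglyMeasurable)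
        (ae_of_all _ fun x => by rw [norm_smul, mul_comm]; gcongr; exact hC' x)
  have hvp := memLp_of_memLp_restrict hΩ hvΩ fun x hx => by simp [hχ.eq_zero_of_notMem hx]
  have hγp := memLp_of_memLp_restrict hΩ hγΩ fun x hx => by
    simp [hχ.eq_zero_of_notMem hx, hχ.gradient_eq_zero_of_notMem hx]
  obtain ⟨k₀, hk₀⟩ := eventually_atTop.1 (isBump_mollify hΩ hv.locallyIntegrable
    hχ.compact_support.isCompact hχ.support_subset fun x hx => by
      simp [image_eq_zero_of_notMem_tsupport hx])
  have hshift : Tendsto (fun k : ℕ => k + k₀) atTop atTop := tendsto_add_atTop_nat k₀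
  refine .of_tendsto_isBump hp (η := fun k => mollify (mollifier n (k + k₀)) _)
    (fun k => hk₀ _ (Nat.le_add_left _ _)) hvΩ hγΩ ?_ ?_
  · refine tendsto_of_tendsto_of_tendsto_of_le_of_le tendsto_const_nhds
      ((tendsto_eLpNorm_mollify_sub hP ENNReal.ofReal_ne_top hvp).comp hshift)
      (fun _ => zero_le) fun k => eLpNorm_mono_measure _ Measure.restrict_le_self
  · refine tendsto_of_tendsto_of_tendsto_of_le_of_le tendsto_const_nhds
      ((tendsto_eLpNorm_mollify_sub hP ENNReal.ofReal_ne_top hγp).comp hshift)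
      (fun _ => zero_le) fun k => ?_
    simp_rw [gradient_mollify hw]
    exact eLpNorm_mono_measure _ Measure.restrict_le_self

/-- Rescaled, `θ` removes the small values of a function and keeps the large ones, with a derivative
bound independent of the scale. -/
theorem exists_smooth_flat : ∃ θ : ℝ → ℝ, ContDiff ℝ ∞ θ ∧ (∀ r, |r| ≤ 1 → θ r = 0) ∧
    (∀ r, 2 ≤ |r| → θ r = r) ∧ ∃ C, ∀ r, |deriv θ r| ≤ C := by
  let b : ContDiffBump (0 : ℝ) := ⟨1, 2, one_pos, one_lt_two⟩
  have hb : ContDiff ℝ ∞ (fun r : ℝ => r * b r) := contDiff_id.mul b.contDiff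
  have hbs : HasCompactSupport (fun r : ℝ => r * b r) := b.hasCompactSupport.mul_left
  obtain ⟨C, hC⟩ := (hb.continuous_deriv (by simp)).bounded_above_of_compact_support hbs.deriv
  refine ⟨fun r => r - r * b r, contDiff_id.sub hb, fun r hr => ?_, fun r hr => ?_,
    1 + C, fun r => ?_⟩
  · simp [b.one_of_mem_closedBall (x := r) (by simpa [b] using hr)]
  · simp [b.zero_of_le_dist (x := r) (by simpa [b] using hr)]
  · have := ((hasDerivAt_id r).sub (hb.differentiable (by simp) r).hasDerivAt)
    rw [show deriv (fun r => r - r * b r) r = _ from this.deriv]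
    refine (norm_sub_le (1 : ℝ) _).trans ?_
    rw [norm_one]
    exact add_le_add le_rfl (hC r)

/-- A Sobolev function continuous up to the boundary and vanishing there is in `W₀^{1,p}(Ω)`. -/
theorem MemSobolev.memSobolevZero_of_continuousOn (hΩ : IsOpen Ω) (hΩb : Bornology.IsBounded Ω)
    (hp : 1 < p) {h : Space n → ℝ} {g : Space n → Space n} (hs : MemSobolev p Ω h g)
    (hc : ContinuousOn h (closure Ω)) (h0 : ∀ x ∈ frontier Ω, h x = 0) :
    ∃ D, MemSobolevZero p Ω h D := by
  have hfin : IsFiniteMeasure (volume.restrict Ω) :=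
    isFiniteMeasure_restrict.2 hΩb.measure_lt_top.ne
  obtain ⟨θ, hθ, hθ0, hθ1, C, hC⟩ := exists_smooth_flat
  have hθz : θ 0 = 0 := hθ0 0 (by simp)
  have hθd : Differentiable ℝ θ := hθ.differentiable (by simp)
  let Θ : ℕ → ℝ → ℝ := fun k r => θ (((k : ℝ) + 1) * r) / ((k : ℝ) + 1)
  have hk : ∀ k : ℕ, (0 : ℝ) < (k : ℝ) + 1 := fun k => by positivity
  have hΘ : ∀ k, ContDiff ℝ 1 (Θ k) := fun k =>
    ((hθ.comp (contDiff_const.mul contDiff_id)).div_const _).of_le (by simp)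
  have hΘ' : ∀ k r, deriv (Θ k) r = deriv θ (((k : ℝ) + 1) * r) := fun k r => by
    have h1 := ((hθd (((k : ℝ) + 1) * r)).hasDerivAt.comp r
      ((hasDerivAt_id r).const_mul ((k : ℝ) + 1))).div_const ((k : ℝ) + 1)
    refine (h1.congr_deriv ?_).deriv
    field_simp [(hk k).ne']
  have hΘC : ∀ k r, |deriv (Θ k) r| ≤ C := fun k r => by rw [hΘ']; exact hC _
  have hΘ0 : ∀ k, Θ k 0 = 0 := fun k => by simp [Θ, hθz]
  have hθdz : ∀ r, |r| < 1 → deriv θ r = 0 := fun r hr => by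
    have : θ =ᶠ[𝓝 r] fun _ => 0 := by
      filter_upwards [(isOpen_lt continuous_abs continuous_const).mem_nhds hr] with s hs
      exact hθ0 s (le_of_lt hs)
    rw [this.deriv_eq]; simp
  have hθdo : ∀ r, 2 < |r| → deriv θ r = 1 := fun r hr => by
    have : θ =ᶠ[𝓝 r] id := by
      filter_upwards [(isOpen_lt continuous_const continuous_abs).mem_nhds hr] with s hs
      exact hθ1 s (le_of_lt hs)
    rw [this.deriv_eq]; simp
  -- Inside `Ω`, `Θ k ∘ h` vanishes off `K k`. This set is closed by continuity of `h` up to the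
  -- boundary and misses `frontier Ω`, where `h = 0`; hence it is a compact subset of `Ω`.
  let K : ℕ → Set (Space n) := fun k => closure Ω ∩ {x | 1 ≤ |((k : ℝ) + 1) * h x|}
  have hKc : ∀ k, IsCompact (K k) := fun k => by
    refine hΩb.isCompact_closure.of_isClosed_subset ?_ inter_subset_left
    have : ContinuousOn (fun x => |((k : ℝ) + 1) * h x|) (closure Ω) :=
      (continuousOn_const.mul hc).abs
    exact this.preimage_isClosed_of_isClosed isClosed_closure isClosed_Ici
  have hKΩ : ∀ k, K k ⊆ Ω := fun k x hx => by
    by_contra hxΩ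
    have : x ∈ frontier Ω := by
      rw [frontier, hΩ.interior_eq]; exact ⟨hx.1, hxΩ⟩
    have h2 : 1 ≤ |((k : ℝ) + 1) * h x| := hx.2
    rw [h0 x this, mul_zero, abs_zero] at h2
    linarith
  choose χ hχ hχ1 using fun k => exists_isBump_eventually_eq_one hΩ (hKc k) (hKΩ k)
  have hcomp : ∀ k, MemSobolev p Ω (fun x => Θ k (h x)) (fun x => deriv (Θ k) (h x) • g x) :=
    fun k => ⟨hs.weakGradient.comp hΩ (hΘ k) (hΘ0 k) (hΘC k),
      memLp_comp hs.memLp_fun (hΘ k) (hΘ0 k) (hΘC k),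
      memLp_deriv_smul hs.memLp_fun.1 hs.memLp_grad (hΘ k) (hΘC k)⟩
  have hW := fun k => (hcomp k).bump_mul hΩ hp (hχ k)
  -- The cutoff changes nothing: it is `1` near `K k`, and off `K k` both `Θ k (h x)` and its
  -- derivative factor vanish.
  have hval : ∀ k, ∀ x ∈ Ω, χ k x * Θ k (h x) = Θ k (h x) ∧
      χ k x • deriv (Θ k) (h x) • g x + Θ k (h x) • gradient (χ k) x =
        deriv (Θ k) (h x) • g x := fun k x hx => by
    by_cases hxK : x ∈ K k
    · have := hχ1 k x hxK
      simp [this.self_of_nhds, gradient_eq_zero_of_eventuallyEq_const this]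
    · have hlt : |((k : ℝ) + 1) * h x| < 1 := by
        by_contra! hle
        exact hxK ⟨subset_closure hx, hle⟩
      have e1 : Θ k (h x) = 0 := by simp only [Θ]; rw [hθ0 _ hlt.le, zero_div]
      have e2 : deriv (Θ k) (h x) = 0 := by rw [hΘ', hθdz _ hlt]
      simp [e1, e2]
  have hae : ∀ᵐ x ∂volume.restrict Ω, x ∈ Ω := ae_restrict_mem hΩ.measurableSet
  classical
  -- Limit of `deriv (Θ k)`. The gradient found for `h` is `g` on `{h ≠ 0}` and `0` elsewhere, which
  -- again avoids any statement about `g` on the zero set.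
  let d : ℝ → ℝ := fun r => if r = 0 then 0 else 1
  have hdm : Measurable d := Measurable.ite (measurableSet_singleton 0) measurable_const
    measurable_const
  have hd : ∀ r, |d r| ≤ 1 := fun r => by simp only [d]; split_ifs <;> simp
  have hdu : AEStronglyMeasurable (fun x => d (h x)) (volume.restrict Ω) :=
    (hdm.comp_aemeasurable hs.memLp_fun.1.aemeasurable).aestronglyMeasurable
  have hDm : MemLp (fun x => d (h x) • g x) (ENNReal.ofReal p) (volume.restrict Ω) :=
    hs.memLp_grad.of_le_mul (c := 1) (hdu.smul hs.memLp_grad.1) (ae_of_all _ fun x => by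
      rw [norm_smul]; gcongr; exact hd _)
  have hlarge : ∀ r : ℝ, r ≠ 0 → ∀ᶠ k : ℕ in atTop, 2 < |((k : ℝ) + 1) * r| := fun r hr => by
    have h1 : Tendsto (fun k : ℕ => ((k : ℝ) + 1) * |r|) atTop atTop :=
      (tendsto_atTop_add_const_right _ 1 tendsto_natCast_atTop_atTop).atTop_mul_const
        (abs_pos.2 hr)
    filter_upwards [h1.eventually_gt_atTop 2] with k hk2
    rwa [abs_mul, abs_of_pos (hk k)]
  refine ⟨fun x => d (h x) • g x, .of_tendsto hp hW hs.memLp_fun hDm ?_ ?_⟩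
  · refine tendsto_eLpNorm_sub_of_dominated (one_le_ofReal hp) ENNReal.ofReal_ne_top
      (B := fun x => (C + 1) * |h x|)
      (fun k => (hW k).memSobolev.memLp_fun.1) hs.memLp_fun.1 (hs.memLp_fun.norm.const_mul _)
      (fun k => ?_) ?_
    · filter_upwards [hae] with x hx
      rw [(hval k x hx).1]
      have e1 : |Θ k (h x)| ≤ C * |h x| := by
        simpa [hΘ0] using abs_sub_le_of_abs_deriv_le (hΘ k) (hΘC k) (h x) 0
      have := norm_sub_le (Θ k (h x)) (h x)
      simp only [Real.norm_eq_abs] at this ⊢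
      linarith
    · filter_upwards [hae] with x hx
      simp_rw [fun k => (hval k x hx).1]
      by_cases hx0 : h x = 0
      · simp [hx0, hΘ0]
      · refine tendsto_const_nhds.congr' ?_
        filter_upwards [hlarge _ hx0] with k hk2
        simp only [Θ]
        rw [hθ1 _ hk2.le]
        field_simp [(hk k).ne']
  · refine tendsto_eLpNorm_sub_of_dominated (one_le_ofReal hp) ENNReal.ofReal_ne_top
      (B := fun x => (C + 1) * ‖g x‖)
      (fun k => (hW k).memSobolev.memLp_grad.1) hDm.1 (hs.memLp_grad.norm.const_mul _)
      (fun k => ?_) ?_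
    · filter_upwards [hae] with x hx
      rw [(hval k x hx).2, ← sub_smul, norm_smul]
      gcongr
      refine (norm_sub_le _ _).trans (add_le_add (hΘC k _) (hd _))
    · filter_upwards [hae] with x hx
      simp_rw [fun k => (hval k x hx).2]
      refine Tendsto.smul_const ?_ _
      by_cases hx0 : h x = 0
      · simp only [hΘ', hx0, mul_zero, d, if_true]
        rw [hθdz 0 (by simp)]
        exact tendsto_const_nhds
      · simp only [d, if_neg hx0]
        refine tendsto_const_nhds.congr' ?_
        filter_upwards [hlarge _ hx0] with k hk2
        rw [hΘ', hθdo _ hk2]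

end Boundary

section TruncatedPosPart

/-- The gradient of the truncation of `u⁺` does not depend on the gradient chosen for `u⁺`. -/
theorem deriv_truncation_smul_eq (hΩ : IsOpen Ω) {u : Space n → ℝ} {g D : Space n → Space n}
    (hu : HasWeakGradient Ω u g) (hD : HasWeakGradient Ω (fun x => max (u x) 0) D) :
    ∀ᵐ x ∂volume.restrict Ω,
      deriv truncation (max (u x) 0) • D x = deriv truncation (max (u x) 0) • g x := by
  have h0 := entropy_of_nonpos le_rfl
  -- `entropy u` and `entropy u⁺` are the same function, so the two chain rules give the same
  -- gradient; where `u > 0` the common factor `truncation u` cancels.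
  have h1 := hu.comp hΩ contDiff_entropy h0 abs_deriv_entropy_le
  have h2 := hD.comp hΩ contDiff_entropy h0 abs_deriv_entropy_le
  simp only [entropy_max] at h2
  filter_upwards [h1.unique hΩ h2] with x hx
  rcases le_or_gt (u x) 0 with h | h
  · rw [max_eq_right h, deriv_truncation]; simp
  · simp only [deriv_entropy, max_eq_left h.le] at hx
    rw [smul_right_injective _ (truncation_pos h).ne' hx]

/-- Nonnegative bump functions approximating the truncation of `u⁺ ∈ W₀^{1,p}(Ω)`. -/
theorem exists_isBump_tendsto_truncation (hΩ : IsOpen Ω) (hp : 1 < p) {u : Space n → ℝ}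
    {g D : Space n → Space n}
    (hu : HasWeakGradient Ω u g) (hD : MemSobolevZero p Ω (fun x => max (u x) 0) D) :
    ∃ φ : ℕ → Space n → ℝ, (∀ k, IsBump Ω (φ k)) ∧ (∀ k x, 0 ≤ φ k x) ∧ (∀ k x, φ k x ≤ 1) ∧
      (∀ᵐ x ∂volume.restrict Ω,
        Tendsto (fun k => φ k x) atTop (𝓝 (truncation (max (u x) 0)))) ∧
      Tendsto (fun k => eLpNorm (fun x => gradient (φ k) x -
        deriv truncation (max (u x) 0) • g x) (ENNReal.ofReal p) (volume.restrict Ω))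
        atTop (𝓝 0) := by
  obtain ⟨η, hη, hae, -, hlim⟩ := hD.exists_seq_comp hp contDiff_truncation
    abs_deriv_truncation_le
  -- The approximants `η k` of `u⁺` may change sign, but `truncation` takes values in `[0, 1]` on
  -- the whole line.
  refine ⟨fun k x => truncation (η k x), fun k => (hη k).comp contDiff_truncation truncation_zero,
    fun k x => truncation_nonneg _, fun k x => truncation_le_one _, ?_, hlim.congr fun k => ?_⟩
  · filter_upwards [hae] with x hx
    exact (contDiff_truncation.continuous.tendsto _).comp hx
  · refine eLpNorm_congr_ae ?_
    filter_upwards [deriv_truncation_smul_eq hΩ hu hD.memSobolev.weakGradient] with x hx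
    rw [hx]

end TruncatedPosPart

end Lattice

/-! ### The vector field of the `p`-Laplacian. -/

section Field

variable {p : ℝ}

/-- The vector field `ξ ↦ |ξ|^{p-2} ξ` of the `p`-Laplacian. -/
def pField (p : ℝ) (ξ : Space n) : Space n := ‖ξ‖ ^ (p - 2) • ξ

theorem measurable_pField : Measurable (pField p : Space n → Space n) :=
  (measurable_norm.pow_const _).smul measurable_id

theorem norm_pField (hp : 1 < p) (ξ : Space n) : ‖pField p ξ‖ = ‖ξ‖ ^ (p - 1) := by
  rw [pField, norm_smul, Real.norm_of_nonneg (by positivity)]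
  rcases eq_or_ne ξ 0 with rfl | h
  · rw [norm_zero, mul_zero, Real.zero_rpow (by linarith)]
  · rw [← Real.rpow_add_one (norm_ne_zero_iff.2 h)]
    congr 1; ring

theorem inner_pField_self (hp : 1 < p) (ξ : Space n) :
    inner ℝ (pField p ξ) ξ = ‖ξ‖ ^ (p - 1) * ‖ξ‖ := by
  rw [← norm_pField hp, pField, real_inner_smul_left, real_inner_self_eq_norm_sq, norm_smul,
    Real.norm_of_nonneg (by positivity)]
  ring

/-- Monotonicity of the `p`-Laplacian. -/
theorem inner_pField_sub_nonneg (hp : 1 < p) (ξ ζ : Space n) :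
    0 ≤ inner ℝ (pField p ξ - pField p ζ) (ξ - ζ) := by
  -- Cauchy–Schwarz on the cross terms reduces the claim to monotonicity of `r ↦ r ^ (p - 1)` on the
  -- norms.
  have h1 : inner ℝ (pField p ξ) ζ ≤ ‖ξ‖ ^ (p - 1) * ‖ζ‖ := by
    rw [← norm_pField hp]; exact real_inner_le_norm _ _
  have h2 : inner ℝ (pField p ζ) ξ ≤ ‖ζ‖ ^ (p - 1) * ‖ξ‖ := by
    rw [← norm_pField hp]; exact real_inner_le_norm _ _
  have h3 : 0 ≤ (‖ξ‖ ^ (p - 1) - ‖ζ‖ ^ (p - 1)) * (‖ξ‖ - ‖ζ‖) := by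
    rcases le_total ‖ξ‖ ‖ζ‖ with h | h
    · exact mul_nonneg_of_nonpos_of_nonpos
        (sub_nonpos.2 (Real.rpow_le_rpow (norm_nonneg _) h (by linarith))) (sub_nonpos.2 h)
    · exact mul_nonneg
        (sub_nonneg.2 (Real.rpow_le_rpow (norm_nonneg _) h (by linarith))) (sub_nonneg.2 h)
  rw [inner_sub_left, inner_sub_right, inner_sub_right, inner_pField_self hp,
    inner_pField_self hp]
  nlinarith

theorem memLp_pField {X : Type*} [MeasurableSpace X] {μ : Measure X} (hp : 1 < p)
    {G : X → Space n} (hG : MemLp G (ENNReal.ofReal p) μ) :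
    MemLp (fun x => pField p (G x)) (ENNReal.ofReal p.conjExponent) μ := by
  have h := hG.norm_rpow_div (ENNReal.ofReal (p - 1))
  rw [ENNReal.toReal_ofReal (by linarith), ← ENNReal.ofReal_div_of_pos (by linarith)] at h
  refine h.of_le_mul (c := 1)
    (measurable_pField.comp_aemeasurable hG.1.aemeasurable).aestronglyMeasurable
    (ae_of_all _ fun x => ?_)
  rw [norm_pField hp, one_mul, Real.norm_of_nonneg (by positivity)]

end Field

/-! ### Space-time integrability and stationary test functions. -/

/-- Product Lebesgue measure on `(s, t] × Ω`. -/
def slab (s t : ℝ) (Ω : Set (Space n)) : Measure (ℝ × Space n) :=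
  (volume.restrict (Ioc s t)).prod (volume.restrict Ω)

theorem cylinder_eq_slab (b : ℝ) (Ω : Set (Space n)) : cylinder b Ω = slab 0 b Ω := by
  rw [cylinder, slab, restrict_Ioo_eq_restrict_Ioc]

theorem slab_le_cylinder {s t b : ℝ} (Ω : Set (Space n)) (hs : 0 ≤ s) (ht : t ≤ b) :
    slab s t Ω ≤ cylinder b Ω := by
  rw [cylinder_eq_slab]
  exact Measure.prod_mono (Measure.restrict_mono (Ioc_subset_Ioc hs ht) le_rfl) le_rfl

instance isFiniteMeasure_slab (s t : ℝ) (Ω : Set (Space n)) [IsFiniteMeasure (volume.restrict Ω)] :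
    IsFiniteMeasure (slab s t Ω) := by
  unfold slab; infer_instance

instance isFiniteMeasure_cylinder (b : ℝ) (Ω : Set (Space n))
    [IsFiniteMeasure (volume.restrict Ω)] : IsFiniteMeasure (cylinder b Ω) := by
  unfold cylinder; infer_instance

section Data

variable {Ω : Set (Space n)} {p : ℝ} {T : EReal} {α : Space n → ℝ → ℝ} {K : ℝ}
  {w : ℝ → Space n → ℝ} {G : ℝ → Space n → Space n}

/-- The time exponent `max 2 p` is lowered to `p` by `r ^ p ≤ 1 + r ^ max 2 p`, as the time interval
is bounded. -/
theorem MemBochnerSobolev.memLp_grad (hp : 1 < p) (h : MemBochnerSobolev p Ω T w G) {b : ℝ}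
    (hb : (b : EReal) < T) : MemLp (Function.uncurry G) (ENNReal.ofReal p) (cylinder b Ω) := by
  have hP0 : ENNReal.ofReal p ≠ 0 := (zero_lt_one.trans_le (one_le_ofReal hp)).ne'
  have hpr : (ENNReal.ofReal p).toReal = p := ENNReal.toReal_ofReal (by linarith)
  refine ⟨h.measurable_grad b hb, ?_⟩
  rw [eLpNorm_lt_top_iff_lintegral_rpow_enorm_lt_top hP0 ENNReal.ofReal_ne_top, cylinder,
    lintegral_prod _ ((h.measurable_grad b hb).enorm.pow_const _), hpr]
  have hfin : ∫⁻ t in Ioo 0 b, (1 + (eLpNorm (w t) (ENNReal.ofReal p) (volume.restrict Ω) +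
        eLpNorm (G t) (ENNReal.ofReal p) (volume.restrict Ω)) ^ max 2 p) < ⊤ := by
    rw [lintegral_add_left measurable_const]
    exact ENNReal.add_lt_top.2 ⟨by simp, h.finite b hb⟩
  refine lt_of_le_of_lt (lintegral_mono fun t => ?_) hfin
  have e : ∫⁻ x in Ω, ‖Function.uncurry G (t, x)‖ₑ ^ p =
      eLpNorm (G t) (ENNReal.ofReal p) (volume.restrict Ω) ^ p := by
    rw [eLpNorm_eq_lintegral_rpow_enorm_toReal hP0 ENNReal.ofReal_ne_top, hpr, ← ENNReal.rpow_mul,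
      one_div_mul_cancel (by linarith), ENNReal.rpow_one]
    rfl
  rw [e]
  refine (ENNReal.rpow_le_rpow
    (le_add_self (b := eLpNorm (w t) (ENNReal.ofReal p) (volume.restrict Ω)))
    (by linarith : 0 ≤ p)).trans ?_
  rcases le_total (eLpNorm (w t) (ENNReal.ofReal p) (volume.restrict Ω) +
        eLpNorm (G t) (ENNReal.ofReal p) (volume.restrict Ω)) 1 with h1 | h1
  · exact (ENNReal.rpow_le_one h1 (by linarith)).trans le_self_add
  · exact (ENNReal.rpow_le_rpow_of_exponent_le h1 (le_max_right _ _)).trans le_add_self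

theorem ae_mem_cylinder (hΩ : IsOpen Ω) (b : ℝ) : ∀ᵐ z ∂cylinder b Ω, z.2 ∈ Ω :=
  Measure.quasiMeasurePreserving_snd.ae (ae_restrict_mem hΩ.measurableSet)

/-- The two-sided bound at `r = 0` forces `α x 0 = 0`; the rest is the Lipschitz condition. -/
theorem abs_reaction_le (hα_bound : ∀ x ∈ Ω, ∀ r : ℝ, 0 ≤ r → 0 ≤ α x r ∧ α x r ≤ K * r)
    (hα_lip : ∀ x ∈ Ω, ∀ r₁ r₂ : ℝ, |α x r₂ - α x r₁| ≤ K * |r₂ - r₁|) {x : Space n} (hx : x ∈ Ω)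
    (r : ℝ) : |α x r| ≤ K * |r| := by
  have h0 := hα_bound x hx 0 le_rfl
  have h00 : α x 0 = 0 := le_antisymm (by simpa using h0.2) h0.1
  simpa [h00] using hα_lip x hx 0 r

/-- Continuity of `α` is known only on `Ω × ℝ`, so measurability is obtained for its extension by
zero. -/
theorem memLp_reaction (hΩ : IsOpen Ω)
    (hα_cont : ContinuousOn (Function.uncurry α) (Ω ×ˢ (Set.univ : Set ℝ)))
    (hα_bound : ∀ x ∈ Ω, ∀ r : ℝ, 0 ≤ r → 0 ≤ α x r ∧ α x r ≤ K * r)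
    (hα_lip : ∀ x ∈ Ω, ∀ r₁ r₂ : ℝ, |α x r₂ - α x r₁| ≤ K * |r₂ - r₁|) {b : ℝ}
    (hw : MemLp (Function.uncurry w) 2 (cylinder b Ω)) :
    MemLp (fun z : ℝ × Space n => α z.2 (w z.1 z.2)) 2 (cylinder b Ω) := by
  classical
  have hs : MeasurableSet (Ω ×ˢ (univ : Set ℝ)) := hΩ.measurableSet.prod MeasurableSet.univ
  have hm : Measurable ((Ω ×ˢ (univ : Set ℝ)).piecewise (Function.uncurry α) 0) :=
    hα_cont.measurable_piecewise continuousOn_const hs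
  have h1 : AEMeasurable (fun z : ℝ × Space n => (z.2, w z.1 z.2)) (cylinder b Ω) :=
    measurable_snd.aemeasurable.prodMk hw.1.aemeasurable
  have h2 := (hm.comp_aemeasurable h1).aestronglyMeasurable
  refine hw.of_le_mul (c := K) (h2.congr ?_) ?_
  · filter_upwards [ae_mem_cylinder hΩ b] with z hz
    simp only [Function.comp]
    rw [piecewise_eq_of_mem _ _ _ (by exact ⟨hz, mem_univ _⟩)]
    rfl
  · filter_upwards [ae_mem_cylinder hΩ b] with z hz
    exact abs_reaction_le hα_bound hα_lip hz _

/-- These are the only test functions used; with `φt = 0` the term `w φ_t` disappears. -/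
theorem isTest_stationary {V : Set (Space n)} [IsFiniteMeasure (volume.restrict V)]
    {η : Space n → ℝ} (hη : IsBump V η) (h0 : ∀ x, 0 ≤ η x) :
    IsTest p V T (fun _ => η) (fun _ _ => 0) (fun _ => gradient η) := by
  have hS : MemSobolev p V η (gradient η) :=
    ⟨hasWeakGradient_of_contDiff (hη.smooth.of_le (by simp)), hη.memLp _ _, hη.memLp_gradient _ _⟩
  have hS0 : MemSobolevZero p V η (gradient η) := ⟨hS, fun ε hε => ⟨η, hη, by simpa using hε,
    by simpa using hε⟩⟩
  refine ⟨⟨fun b _ => ?_, fun b _ => ?_, ae_of_all _ fun t _ _ => hS, fun b _ => ?_⟩,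
    ae_of_all _ fun t _ _ => hS0, ⟨fun t _ _ => hη.memLp _ _, fun b _ => ?_⟩,
    fun b _ => ?_, fun s t _ _ _ => ?_, fun t _ _ => ae_of_all _ h0⟩
  · exact (hη.continuous.comp continuous_snd).aestronglyMeasurable
  · exact (hη.continuous_gradient.comp continuous_snd).aestronglyMeasurable
  · rw [setLIntegral_const]
    refine ENNReal.mul_lt_top (ENNReal.rpow_lt_top_of_nonneg (by positivity) ?_) (by simp)
    exact (ENNReal.add_lt_top.2 ⟨hS.memLp_fun.2, hS.memLp_grad.2⟩).ne
  · exact (hη.memLp 2 (volume.restrict V)).comp_snd (volume.restrict (Ioo 0 b))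
  · exact MemLp.zero
  · exact ae_of_all _ fun x => by simp

/-- The auxiliary set `V` drops out because `η` and its gradient vanish off it. -/
theorem weakForm_stationary (hΩ : IsOpen Ω) {V : Set (Space n)} (hVΩ : V ⊆ Ω) {η : Space n → ℝ}
    (hη : IsBump V η) {s t : ℝ} (hst : s ≤ t)
    (hi : Integrable (fun z : ℝ × Space n => inner ℝ (pField p (G z.1 z.2)) (gradient η z.2) +
      α z.2 (w z.1 z.2) * η z.2) (slab s t Ω)) :
    weakForm p α V w G (fun _ => η) (fun _ _ => 0) (fun _ => gradient η) s t =
      ((∫ x in Ω, w t x * η x) - ∫ x in Ω, w s x * η x) +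
        ∫ z, (inner ℝ (pField p (G z.1 z.2)) (gradient η z.2) + α z.2 (w z.1 z.2) * η z.2)
          ∂slab s t Ω := by
  have hV : ∀ F : Space n → ℝ, (∀ x ∉ V, F x = 0) → ∫ x in V, F x = ∫ x in Ω, F x := fun F hF =>
    (setIntegral_eq_of_subset_of_forall_sdiff_eq_zero hΩ.measurableSet hVΩ
      fun x hx => hF x hx.2).symm
  unfold weakForm
  rw [hV _ fun x hx => by simp [hη.eq_zero_of_notMem hx],
    hV _ fun x hx => by simp [hη.eq_zero_of_notMem hx], slab, integral_prod _ hi,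
    intervalIntegral.integral_of_le hst]
  congr 1
  refine integral_congr_ae (ae_of_all _ fun τ => ?_)
  dsimp only
  rw [hV _ fun x hx => by
    rw [hη.eq_zero_of_notMem hx, hη.gradient_eq_zero_of_notMem hx]; simp]
  refine integral_congr_ae (ae_of_all _ fun x => ?_)
  simp only [pField, real_inner_smul_left]
  ring

theorem integrable_flux_add_reaction [IsFiniteMeasure (volume.restrict Ω)] (hp : 1 < p)
    {s t : ℝ} {a : ℝ × Space n → Space n} {c : ℝ × Space n → ℝ}
    (ha : MemLp a (ENNReal.ofReal p.conjExponent) (slab s t Ω)) (hc : MemLp c 2 (slab s t Ω))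
    {η : Space n → ℝ} (hη : IsBump Ω η) :
    Integrable (fun z => inner ℝ (a z) (gradient η z.2) + c z * η z.2) (slab s t Ω) := by
  have := (Real.HolderConjugate.conjExponent hp).ennrealOfReal.symm
  refine Integrable.add ?_ ?_
  · exact integrable_inner_of_memLp ha
      ((hη.memLp_gradient (ENNReal.ofReal p) (volume.restrict Ω)).comp_snd _)
  · exact hc.integrable_mul ((hη.memLp 2 (volume.restrict Ω)).comp_snd _)

/-- The weak inequality for the difference of a sub- and a super-solution, tested with a
stationary bump function. -/
theorem exists_weak_inequality (hΩ : IsOpen Ω) [IsFiniteMeasure (volume.restrict Ω)]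
    (hp : 1 < p) (hα_cont : ContinuousOn (Function.uncurry α) (Ω ×ˢ (Set.univ : Set ℝ)))
    (hα_bound : ∀ x ∈ Ω, ∀ r : ℝ, 0 ≤ r → 0 ≤ α x r ∧ α x r ≤ K * r)
    (hα_lip : ∀ x ∈ Ω, ∀ r₁ r₂ : ℝ, |α x r₂ - α x r₁| ≤ K * |r₂ - r₁|)
    {w₁ w₂ : ℝ → Space n → ℝ} {G₁ G₂ : ℝ → Space n → Space n}
    (h₁ : MemBochnerSobolev p Ω T w₁ G₁) (h₁' : MemL2 Ω T w₁)
    (h₁'' : ∀ V : Set (Space n), IsOpen V → IsCompact (closure V) → closure V ⊆ Ω →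
      ∀ (φ φt : ℝ → Space n → ℝ) (Gφ : ℝ → Space n → Space n), IsTest p V T φ φt Gφ →
        ∀ t₁ t₂ : ℝ, 0 ≤ t₁ → t₁ ≤ t₂ → (t₂ : EReal) < T →
          weakForm p α V w₁ G₁ φ φt Gφ t₁ t₂ ≤ 0)
    (h₂ : MemBochnerSobolev p Ω T w₂ G₂) (h₂' : MemL2 Ω T w₂)
    (h₂'' : ∀ V : Set (Space n), IsOpen V → IsCompact (closure V) → closure V ⊆ Ω →
      ∀ (φ φt : ℝ → Space n → ℝ) (Gφ : ℝ → Space n → Space n), IsTest p V T φ φt Gφ →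
        ∀ t₁ t₂ : ℝ, 0 ≤ t₁ → t₁ ≤ t₂ → (t₂ : EReal) < T →
          0 ≤ weakForm p α V w₂ G₂ φ φt Gφ t₁ t₂)
    {η : Space n → ℝ} (hη : IsBump Ω η) (h0 : ∀ x, 0 ≤ η x) {s t : ℝ} (hs : 0 ≤ s) (hst : s ≤ t)
    (ht : (t : EReal) < T) :
    ∫ x in Ω, ((w₁ t x - w₂ t x) - (w₁ s x - w₂ s x)) * η x ≤
      -∫ z, (inner ℝ (pField p (G₁ z.1 z.2) - pField p (G₂ z.1 z.2)) (gradient η z.2) +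
        (α z.2 (w₁ z.1 z.2) - α z.2 (w₂ z.1 z.2)) * η z.2) ∂slab s t Ω := by
  -- An intermediate set is needed since the weak forms are available only for `V` with compact
  -- closure in `Ω`.
  obtain ⟨V, hVo, hKV, hVΩ, hVc⟩ := exists_open_between_and_isCompact_closure
    hη.compact_support.isCompact hΩ hη.support_subset
  have hVΩ' : V ⊆ Ω := subset_closure.trans hVΩ
  have hfin : IsFiniteMeasure (volume.restrict V) := isFiniteMeasure_restrict.2
    ((measure_mono subset_closure).trans_lt hVc.measure_lt_top).ne
  have hηV : IsBump V η := ⟨hη.smooth, hη.compact_support, hKV⟩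
  have htest : IsTest p V T (fun _ => η) (fun _ _ => 0) (fun _ => gradient η) :=
    isTest_stationary hηV h0
  have hle := slab_le_cylinder (s := s) Ω hs (le_refl t)
  have hi : ∀ {w G}, MemBochnerSobolev p Ω T w G → MemL2 Ω T w →
      Integrable (fun z : ℝ × Space n => inner ℝ (pField p (G z.1 z.2)) (gradient η z.2) +
        α z.2 (w z.1 z.2) * η z.2) (slab s t Ω) := fun hB hL =>
    integrable_flux_add_reaction hp
      ((memLp_pField hp (hB.memLp_grad hp ht)).mono_measure hle)
      ((memLp_reaction hΩ hα_cont hα_bound hα_lip (hL.cylinder t ht)).mono_measure hle) hη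
  have e1 := h₁'' V hVo hVc hVΩ _ _ _ htest s t hs hst ht
  have e2 := h₂'' V hVo hVc hVΩ _ _ _ htest s t hs hst ht
  rw [weakForm_stationary hΩ hVΩ' hηV hst (hi h₁ h₁')] at e1
  rw [weakForm_stationary hΩ hVΩ' hηV hst (hi h₂ h₂')] at e2
  have hj : ∀ {w}, MemL2 Ω T w → ∀ {τ : ℝ}, 0 ≤ τ → (τ : EReal) < T →
      Integrable (fun x => w τ x * η x) (volume.restrict Ω) := fun hL _ hτ hτT =>
    (hL.slice _ hτ hτT).integrable_mul (hη.memLp 2 (volume.restrict Ω))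
  have ht0 := hs.trans hst
  have hsT : (s : EReal) < T := lt_of_le_of_lt (by exact_mod_cast hst) ht
  have e3 : ∫ x in Ω, ((w₁ t x - w₂ t x) - (w₁ s x - w₂ s x)) * η x =
      ((∫ x in Ω, w₁ t x * η x) - ∫ x in Ω, w₂ t x * η x) -
        ((∫ x in Ω, w₁ s x * η x) - ∫ x in Ω, w₂ s x * η x) := by
    rw [← integral_sub (hj h₁' ht0 ht) (hj h₂' ht0 ht), ← integral_sub (hj h₁' hs hsT)
      (hj h₂' hs hsT)]
    refine Eq.trans ?_ (integral_sub ((hj h₁' ht0 ht).sub (hj h₂' ht0 ht))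
      ((hj h₁' hs hsT).sub (hj h₂' hs hsT)))
    refine integral_congr_ae (ae_of_all _ fun x => ?_)
    dsimp only
    ring
  have e4 : ∫ z, (inner ℝ (pField p (G₁ z.1 z.2) - pField p (G₂ z.1 z.2)) (gradient η z.2) +
        (α z.2 (w₁ z.1 z.2) - α z.2 (w₂ z.1 z.2)) * η z.2) ∂slab s t Ω =
      (∫ z, (inner ℝ (pField p (G₁ z.1 z.2)) (gradient η z.2) +
        α z.2 (w₁ z.1 z.2) * η z.2) ∂slab s t Ω) -
      ∫ z, (inner ℝ (pField p (G₂ z.1 z.2)) (gradient η z.2) +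
        α z.2 (w₂ z.1 z.2) * η z.2) ∂slab s t Ω := by
    rw [← integral_sub (hi h₁ h₁') (hi h₂ h₂')]
    refine integral_congr_ae (ae_of_all _ fun z => ?_)
    dsimp only
    rw [inner_sub_left]
    ring
  rw [e3, e4]
  linarith

end Data

/-! ### The difference of the two solutions and its entropy inequality. -/

/-- The data extracted from a sub-solution and a super-solution on `Ω × [0, b]`: `W` is their
difference, `g` its gradient, `a` and `c` the differences of the fluxes and of the reactions. -/
structure IsDifferenceSubsolution (p K b : ℝ) (Ω : Set (Space n)) (W : ℝ → Space n → ℝ)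
    (g : ℝ → Space n → Space n) (a : ℝ × Space n → Space n) (c : ℝ × Space n → ℝ) : Prop where
  memLp_slice : ∀ t, 0 ≤ t → t ≤ b → MemLp (W t) 2 (volume.restrict Ω)
  memLp_fun : MemLp (Function.uncurry W) 2 (cylinder b Ω)
  memLp_grad : MemLp (Function.uncurry g) (ENNReal.ofReal p) (cylinder b Ω)
  memLp_flux : MemLp a (ENNReal.ofReal p.conjExponent) (cylinder b Ω)
  memLp_reaction : MemLp c 2 (cylinder b Ω)
  weak : ∀ η, IsBump Ω η → (∀ x, 0 ≤ η x) → ∀ s t, 0 ≤ s → s ≤ t → t ≤ b →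
    ∫ x in Ω, (W t x - W s x) * η x ≤
      -∫ z, (inner ℝ (a z) (gradient η z.2) + c z * η z.2) ∂slab s t Ω
  good : ∀ᵐ t ∂volume.restrict (Ioo 0 b), HasWeakGradient Ω (W t) (g t) ∧
    MemLp (g t) (ENNReal.ofReal p) (volume.restrict Ω) ∧
    ∃ D, MemSobolevZero p Ω (fun x => max (W t x) 0) D
  inner_nonneg : ∀ᵐ z ∂cylinder b Ω, 0 ≤ inner ℝ (a z) (g z.1 z.2)
  abs_reaction_le : ∀ᵐ z ∂cylinder b Ω, |c z| ≤ K * |W z.1 z.2|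
  initial : ∀ᵐ x ∂volume.restrict Ω, W 0 x ≤ 0

/-- The truncation of `W⁺`, as a function on space-time. -/
def truncPos (W : ℝ → Space n → ℝ) (z : ℝ × Space n) : ℝ := truncation (max (W z.1 z.2) 0)

/-- The spatial gradient of `truncPos W`. -/
def gradTruncPos (W : ℝ → Space n → ℝ) (g : ℝ → Space n → Space n) (z : ℝ × Space n) : Space n :=
  deriv truncation (max (W z.1 z.2) 0) • g z.1 z.2

theorem norm_gradTruncPos_le (W : ℝ → Space n → ℝ) (g : ℝ → Space n → Space n)
    (z : ℝ × Space n) : ‖gradTruncPos W g z‖ ≤ 1 * ‖g z.1 z.2‖ := by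
  rw [gradTruncPos, norm_smul]; gcongr; exact abs_deriv_truncation_le _

theorem continuous_deriv_truncation : Continuous (deriv truncation) :=
  (contDiff_truncation.of_le (by simp) : ContDiff ℝ 1 truncation).continuous_deriv le_rfl

theorem tendsto_eLpNorm_comp_snd {X Y E : Type*} [MeasurableSpace X] [MeasurableSpace Y]
    [NormedAddCommGroup E] {μ : Measure X} [IsFiniteMeasure μ] {ν : Measure Y} [SFinite ν]
    {P : ℝ≥0∞} (hP : P ≠ ⊤) {f : ℕ → Y → E} (hf : ∀ k, AEStronglyMeasurable (f k) ν)
    (h : Tendsto (fun k => eLpNorm (f k) P ν) atTop (𝓝 0)) :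
    Tendsto (fun k => eLpNorm (fun z : X × Y => f k z.2) P (μ.prod ν)) atTop (𝓝 0) := by
  have e : ∀ k, eLpNorm (fun z : X × Y => f k z.2) P (μ.prod ν) =
      μ univ ^ (1 / P).toReal * eLpNorm (f k) P ν := fun k => by
    rw [← smul_eq_mul, ← eLpNorm_smul_measure_of_ne_top hP, ← Measure.map_snd_prod,
      eLpNorm_map_measure _ measurable_snd.aemeasurable]
    · rfl
    · rw [Measure.map_snd_prod]
      exact (hf k).smul_measure _
  simp_rw [e]
  have := ENNReal.Tendsto.const_mul h
    (Or.inr (ENNReal.rpow_ne_top_of_nonneg (y := (1 / P).toReal) (by positivity)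
      (measure_ne_top μ univ)))
  simpa using this

namespace IsDifferenceSubsolution

variable {p K b : ℝ} {Ω : Set (Space n)} {W : ℝ → Space n → ℝ} {g : ℝ → Space n → Space n}
  {a : ℝ × Space n → Space n} {c : ℝ × Space n → ℝ}

theorem integrable_entropy [IsFiniteMeasure (volume.restrict Ω)]
    (h : IsDifferenceSubsolution p K b Ω W g a c) {t : ℝ} (ht0 : 0 ≤ t) (htb : t ≤ b) :
    Integrable (fun x => entropy (W t x)) (volume.restrict Ω) :=
  ((h.memLp_slice t ht0 htb).integrable one_le_two).mono
    (continuous_entropy.comp_aestronglyMeasurable (h.memLp_slice t ht0 htb).1)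
    (ae_of_all _ fun x => by
      rw [Real.norm_of_nonneg (entropy_nonneg _)]; exact entropy_le_abs _)

/-- The flux and reaction run over `(s, t]` while the test function is frozen at `t`; this is why
integrability of the single slice `g t` is assumed. -/
theorem integrable_slab [IsFiniteMeasure (volume.restrict Ω)] (hp : 1 < p)
    (h : IsDifferenceSubsolution p K b Ω W g a c) {s t : ℝ} (hs : 0 ≤ s) (hst : s ≤ t)
    (htb : t ≤ b) (hg : MemLp (g t) (ENNReal.ofReal p) (volume.restrict Ω)) :
    Integrable (fun z => inner ℝ (a z) (gradTruncPos W g (t, z.2)) + c z * truncPos W (t, z.2))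
      (slab s t Ω) := by
  have := (Real.HolderConjugate.conjExponent hp).ennrealOfReal.symm
  have hle := slab_le_cylinder Ω hs htb
  have hW := h.memLp_slice t (hs.trans hst) htb
  have hm : AEStronglyMeasurable (fun x => max (W t x) 0) (volume.restrict Ω) :=
    hW.1.sup aestronglyMeasurable_const
  have hG : MemLp (fun x => gradTruncPos W g (t, x)) (ENNReal.ofReal p) (volume.restrict Ω) :=
    hg.of_le_mul (c := 1)
      ((continuous_deriv_truncation.comp_aestronglyMeasurable hm).smul hg.1)
      (ae_of_all _ fun x => norm_gradTruncPos_le W g (t, x))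
  refine Integrable.add ?_ ?_
  · exact integrable_inner_of_memLp (h.memLp_flux.mono_measure hle)
      (hG.comp_snd (volume.restrict (Ioc s t)))
  · refine ((h.memLp_reaction.mono_measure hle).integrable one_le_two).mul_bdd (c := 1) ?_ ?_
    · exact AEStronglyMeasurable.comp_snd (f := fun x => truncPos W (t, x))
        (contDiff_truncation.continuous.comp_aestronglyMeasurable hm)
    · exact ae_of_all _ fun z => abs_truncation_le_one _

/-- The entropy inequality between an arbitrary time and a later time at which the weak inequality
may be tested with the truncation of `W⁺`. -/
theorem entropy_step (hΩ : IsOpen Ω) [IsFiniteMeasure (volume.restrict Ω)] (hp : 1 < p)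
    (h : IsDifferenceSubsolution p K b Ω W g a c) {s t : ℝ} (hs : 0 ≤ s) (hst : s ≤ t)
    (htb : t ≤ b) (hgood : HasWeakGradient Ω (W t) (g t) ∧
      MemLp (g t) (ENNReal.ofReal p) (volume.restrict Ω) ∧
      ∃ D, MemSobolevZero p Ω (fun x => max (W t x) 0) D) :
    (∫ x in Ω, entropy (W t x)) - ∫ x in Ω, entropy (W s x) ≤
      -∫ z, (inner ℝ (a z) (gradTruncPos W g (t, z.2)) + c z * truncPos W (t, z.2))
        ∂slab s t Ω := by
  have hconj := (Real.HolderConjugate.conjExponent hp).ennrealOfReal.symm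
  obtain ⟨hwg, hg, D, hD⟩ := hgood
  obtain ⟨φ, hφ, hφ0, hφ1, hae, hlim⟩ := exists_isBump_tendsto_truncation hΩ hp hwg hD
  have hle := slab_le_cylinder Ω hs htb
  have ht0 := hs.trans hst
  have hWt := h.memLp_slice t ht0 htb
  have hWs := h.memLp_slice s hs (hst.trans htb)
  have hd : Integrable (fun x => W t x - W s x) (volume.restrict Ω) :=
    (hWt.sub hWs).integrable one_le_two
  have hm : AEStronglyMeasurable (fun x => max (W t x) 0) (volume.restrict Ω) :=
    hWt.1.sup aestronglyMeasurable_const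
  have hψm : AEStronglyMeasurable (fun x => truncPos W (t, x)) (volume.restrict Ω) :=
    contDiff_truncation.continuous.comp_aestronglyMeasurable hm
  have hG : MemLp (fun x => gradTruncPos W g (t, x)) (ENNReal.ofReal p) (volume.restrict Ω) :=
    hg.of_le_mul (c := 1)
      ((continuous_deriv_truncation.comp_aestronglyMeasurable hm).smul hg.1)
      (ae_of_all _ fun x => norm_gradTruncPos_le W g (t, x))
  have hca : Integrable c (slab s t Ω) :=
    (h.memLp_reaction.mono_measure hle).integrable one_le_two
  have hφb : ∀ k x, ‖φ k x‖ ≤ 1 := fun k x => by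
    rw [Real.norm_of_nonneg (hφ0 k x)]; exact hφ1 k x
  -- The bound `|φ k| ≤ 1` gives dominated convergence here and in `l3`; only the flux term `l2`
  -- uses convergence of gradients in `L^p`.
  have l1 : Tendsto (fun k => ∫ x in Ω, (W t x - W s x) * φ k x) atTop
      (𝓝 (∫ x in Ω, (W t x - W s x) * truncPos W (t, x))) := by
    refine tendsto_integral_of_dominated_convergence (fun x => ‖W t x - W s x‖)
      (fun k => hd.1.mul (hφ k).continuous.aestronglyMeasurable) hd.norm
      (fun k => ae_of_all _ fun x => ?_) ?_
    · rw [norm_mul]; exact mul_le_of_le_one_right (norm_nonneg _) (hφb k x)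
    · filter_upwards [hae] with x hx
      exact hx.const_mul _
  have l2 : Tendsto (fun k => ∫ z, inner ℝ (a z) (gradient (φ k) z.2) ∂slab s t Ω) atTop
      (𝓝 (∫ z, inner ℝ (a z) (gradTruncPos W g (t, z.2)) ∂slab s t Ω)) := by
    refine tendsto_integral_inner (h.memLp_flux.mono_measure hle)
      (fun k => ((hφ k).memLp_gradient (ENNReal.ofReal p) _).comp_snd _) (hG.comp_snd _) ?_
    exact tendsto_eLpNorm_comp_snd ENNReal.ofReal_ne_top
      (f := fun k x => gradient (φ k) x - gradTruncPos W g (t, x))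
      (fun k => ((hφ k).memLp_gradient (ENNReal.ofReal p) _).1.sub hG.1) hlim
  have l3 : Tendsto (fun k => ∫ z, c z * φ k z.2 ∂slab s t Ω) atTop
      (𝓝 (∫ z, c z * truncPos W (t, z.2) ∂slab s t Ω)) := by
    refine tendsto_integral_of_dominated_convergence (fun z => ‖c z‖)
      (fun k => hca.1.mul
        ((hφ k).continuous.comp continuous_snd).aestronglyMeasurable) hca.norm
      (fun k => ae_of_all _ fun z => ?_) ?_
    · rw [norm_mul]; exact mul_le_of_le_one_right (norm_nonneg _) (hφb k z.2)
    · have : ∀ᵐ z ∂slab s t Ω, Tendsto (fun k => φ k z.2) atTop (𝓝 (truncPos W (t, z.2))) :=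
        Measure.quasiMeasurePreserving_snd.ae hae
      filter_upwards [this] with z hz
      exact hz.const_mul _
  have i1 : ∀ {v : Space n → Space n}, MemLp v (ENNReal.ofReal p) (volume.restrict Ω) →
      Integrable (fun z : ℝ × Space n => inner ℝ (a z) (v z.2)) (slab s t Ω) := fun hv =>
    integrable_inner_of_memLp (h.memLp_flux.mono_measure hle) (hv.comp_snd _)
  have i2 : ∀ {v : Space n → ℝ}, AEStronglyMeasurable v (volume.restrict Ω) →
      (∀ x, ‖v x‖ ≤ 1) → Integrable (fun z : ℝ × Space n => c z * v z.2) (slab s t Ω) :=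
    fun hv hv1 => hca.mul_bdd (c := 1) hv.comp_snd (ae_of_all _ fun z => hv1 _)
  have hfin := le_of_tendsto_of_tendsto' l1 (l2.add l3).neg fun k => by
    rw [← integral_add (i1 ((hφ k).memLp_gradient _ _))
      (i2 (hφ k).continuous.aestronglyMeasurable (hφb k))]
    exact h.weak (φ k) (hφ k) (hφ0 k) s t hs hst htb
  rw [← integral_add (i1 hG) (i2 hψm fun x => abs_truncation_le_one _)] at hfin
  refine le_trans ?_ hfin
  rw [← integral_sub (h.integrable_entropy ht0 htb) (h.integrable_entropy hs (hst.trans htb))]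
  refine integral_mono ((h.integrable_entropy ht0 htb).sub
    (h.integrable_entropy hs (hst.trans htb))) ?_ fun x => ?_
  · exact hd.mul_bdd (c := 1) hψm (ae_of_all _ fun x => abs_truncation_le_one _)
  · dsimp only
    rw [mul_comm]
    exact entropy_sub_le _ _

end IsDifferenceSubsolution

/-! ### Time translates and the averaged entropy inequality. -/

section TimeTranslation

variable {E : Type*} [NormedAddCommGroup E]

/-- For fixed lag it is a translation. It yields integrability jointly in the lag and the space-time
point, as the later exchange of integrals requires. -/
theorem measurePreserving_shear (h : ℝ) :
    MeasurePreserving (fun q : ℝ × (ℝ × Space n) => (q.1, q.2 - (q.1, (0 : Space n))))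
      ((volume.restrict (Ioc 0 h)).prod (volume.prod volume))
      ((volume.restrict (Ioc 0 h)).prod (volume.prod volume)) := by
  refine (MeasurePreserving.id _).skew_product (g := fun r z => z - (r, (0 : Space n))) ?_ ?_
  · exact (continuous_snd.sub (continuous_fst.prodMk continuous_const)).measurable
  · exact ae_of_all _ fun r => (measurePreserving_sub_right _ _).map_eq

variable [InnerProductSpace ℝ E] {P Q : ℝ≥0∞} [ENNReal.HolderTriple Q P 1]

/-- Joint integrability of the pairing of all small time translates of `u` with `v`. -/
theorem integrable_inner_translate {u v : ℝ × Space n → E}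
    (hu : MemLp u Q (volume.prod volume)) (hv : MemLp v P (volume.prod volume)) (h : ℝ) :
    Integrable (fun q : ℝ × (ℝ × Space n) => inner ℝ (u (q.2 - (q.1, 0))) (v q.2))
      ((volume.restrict (Ioc 0 h)).prod (volume.prod volume)) := by
  refine integrable_inner_of_memLp (q := Q) (p := P) ?_ (hv.comp_snd _)
  exact (hu.comp_snd (volume.restrict (Ioc 0 h))).comp_measurePreserving (measurePreserving_shear h)

/-- The pairing of a time translate of `u` with `v` is continuous. -/
theorem tendsto_integral_inner_translate {u v : ℝ × Space n → E} (hQ : 1 ≤ Q) (hQ' : Q ≠ ⊤)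
    (hu : MemLp u Q (volume.prod volume)) (hv : MemLp v P (volume.prod volume)) :
    Tendsto (fun r : ℝ => ∫ z, inner ℝ (u (z - (r, 0))) (v z) ∂(volume.prod volume)) (𝓝 0)
      (𝓝 (∫ z, inner ℝ (u z) (v z) ∂(volume.prod volume))) := by
  have ht : Tendsto (fun r : ℝ => (r, (0 : Space n))) (𝓝 0) (𝓝 0) :=
    (continuous_id.prodMk continuous_const).tendsto' _ _ rfl
  have h1 := (tendsto_eLpNorm_translate_sub
    (μ := (volume : Measure ℝ).prod (volume : Measure (Space n))) hQ hQ' hu).comp ht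
  have hm : ∀ r : ℝ, MemLp (fun z => u (z - (r, 0))) Q (volume.prod volume) := fun r =>
    hu.comp_measurePreserving (measurePreserving_sub_right _ _)
  have := tendsto_integral_inner (q := P) (p := Q) hv hm hu h1
  simpa only [real_inner_comm] using this

end TimeTranslation

/-- Extension by zero of a function on `(0, b) × Ω`. -/
def extendZero {E : Type*} [Zero E] (b : ℝ) (Ω : Set (Space n)) (u : ℝ × Space n → E) :
    ℝ × Space n → E :=
  (Ioo 0 b ×ˢ Ω).indicator u

theorem memLp_extendZero {E : Type*} [NormedAddCommGroup E] {b : ℝ} {Ω : Set (Space n)}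
    (hΩ : IsOpen Ω) {P : ℝ≥0∞} {u : ℝ × Space n → E} (hu : MemLp u P (cylinder b Ω)) :
    MemLp (extendZero b Ω u) P (volume.prod volume) := by
  rw [extendZero, memLp_indicator_iff_restrict (measurableSet_Ioo.prod hΩ.measurableSet),
    ← Measure.prod_restrict]
  exact hu

theorem cylinder_mono {b b' : ℝ} (Ω : Set (Space n)) (h : b' ≤ b) :
    cylinder b' Ω ≤ cylinder b Ω := by
  rw [cylinder_eq_slab]
  exact slab_le_cylinder Ω le_rfl h

/-- The pairing of the flux and reaction at time `t - r` with the test function at time `t`,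
cut off at time `b'`. -/
def timePairing (b b' : ℝ) (Ω : Set (Space n)) (W : ℝ → Space n → ℝ) (g : ℝ → Space n → Space n)
    (a : ℝ × Space n → Space n) (c : ℝ × Space n → ℝ) (q : ℝ × (ℝ × Space n)) : ℝ :=
  inner ℝ (extendZero b Ω a (q.2 - (q.1, 0))) (extendZero b' Ω (gradTruncPos W g) q.2) +
    extendZero b Ω c (q.2 - (q.1, 0)) * extendZero b' Ω (truncPos W) q.2

/-- The entropy of `W` at the times in `(0, b)`, and zero at other times. -/
def energy (b : ℝ) (Ω : Set (Space n)) (W : ℝ → Space n → ℝ) : ℝ → ℝ :=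
  (Ioo 0 b).indicator fun t => ∫ x in Ω, entropy (W t x)

theorem energy_nonneg (b : ℝ) (Ω : Set (Space n)) (W : ℝ → Space n → ℝ) (t : ℝ) :
    0 ≤ energy b Ω W t :=
  indicator_nonneg (fun _ _ => integral_nonneg fun _ => entropy_nonneg _) t

namespace IsDifferenceSubsolution

variable {p K b b' : ℝ} {Ω : Set (Space n)} {W : ℝ → Space n → ℝ} {g : ℝ → Space n → Space n}
  {a : ℝ × Space n → Space n} {c : ℝ × Space n → ℝ}

theorem aestronglyMeasurable_posPart (h : IsDifferenceSubsolution p K b Ω W g a c) :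
    AEStronglyMeasurable (fun z : ℝ × Space n => max (W z.1 z.2) 0) (cylinder b Ω) :=
  h.memLp_fun.1.sup aestronglyMeasurable_const

theorem memLp_gradTruncPos (h : IsDifferenceSubsolution p K b Ω W g a c) :
    MemLp (gradTruncPos W g) (ENNReal.ofReal p) (cylinder b Ω) :=
  h.memLp_grad.of_le_mul (c := 1)
    ((continuous_deriv_truncation.comp_aestronglyMeasurable h.aestronglyMeasurable_posPart).smul
      h.memLp_grad.1)
    (ae_of_all _ fun z => norm_gradTruncPos_le W g z)

theorem memLp_truncPos [IsFiniteMeasure (volume.restrict Ω)]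
    (h : IsDifferenceSubsolution p K b Ω W g a c) :
    MemLp (truncPos W) 2 (cylinder b Ω) :=
  MemLp.of_bound
    (contDiff_truncation.continuous.comp_aestronglyMeasurable h.aestronglyMeasurable_posPart) 1
    (ae_of_all _ fun _ => abs_truncation_le_one _)

theorem integrable_entropy_cylinder [IsFiniteMeasure (volume.restrict Ω)]
    (h : IsDifferenceSubsolution p K b Ω W g a c) :
    Integrable (fun z : ℝ × Space n => entropy (W z.1 z.2)) (cylinder b Ω) :=
  (h.memLp_fun.integrable one_le_two).mono
    (continuous_entropy.comp_aestronglyMeasurable h.memLp_fun.1)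
    (ae_of_all _ fun x => by
      rw [Real.norm_of_nonneg (entropy_nonneg _)]; exact entropy_le_abs _)

theorem integrable_energy [IsFiniteMeasure (volume.restrict Ω)]
    (h : IsDifferenceSubsolution p K b Ω W g a c) : Integrable (energy b Ω W) := by
  rw [energy, integrable_indicator_iff measurableSet_Ioo]
  exact h.integrable_entropy_cylinder.integral_prod_left

theorem integrable_timePairing (hΩ : IsOpen Ω) [IsFiniteMeasure (volume.restrict Ω)] (hp : 1 < p)
    (h : IsDifferenceSubsolution p K b Ω W g a c) (hb' : b' ≤ b) (τ : ℝ) :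
    Integrable (timePairing b b' Ω W g a c)
      ((volume.restrict (Ioc 0 τ)).prod (volume.prod volume)) := by
  have hconj := (Real.HolderConjugate.conjExponent hp).ennrealOfReal.symm
  have hle := cylinder_mono Ω hb'
  refine Integrable.add ?_ ?_
  · exact integrable_inner_translate (memLp_extendZero hΩ h.memLp_flux)
      (memLp_extendZero hΩ (h.memLp_gradTruncPos.mono_measure hle)) τ
  · have := integrable_inner_translate (memLp_extendZero hΩ h.memLp_reaction)
      (memLp_extendZero hΩ (h.memLp_truncPos.mono_measure hle)) τ
    refine this.congr (ae_of_all _ fun q => ?_)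
    simp [mul_comm]

/-- The translate sits on the flux and the reaction, which lie in `L^{p'}` and `L²`; both exponents
are finite, so translation is continuous there. -/
theorem tendsto_timePairing (hΩ : IsOpen Ω) [IsFiniteMeasure (volume.restrict Ω)] (hp : 1 < p)
    (h : IsDifferenceSubsolution p K b Ω W g a c) (hb' : b' ≤ b) :
    Tendsto (fun r => ∫ z, timePairing b b' Ω W g a c (r, z) ∂(volume.prod volume)) (𝓝 0)
      (𝓝 (∫ z, timePairing b b' Ω W g a c (0, z) ∂(volume.prod volume))) := by
  have hreal := Real.HolderConjugate.conjExponent hp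
  have hconj := hreal.ennrealOfReal.symm
  have hle := cylinder_mono Ω hb'
  have ma := memLp_extendZero hΩ h.memLp_flux
  have mG := memLp_extendZero hΩ (h.memLp_gradTruncPos.mono_measure hle)
  have mc := memLp_extendZero hΩ h.memLp_reaction
  have mψ := memLp_extendZero hΩ (h.memLp_truncPos.mono_measure hle)
  have t1 := tendsto_integral_inner_translate (one_le_ofReal hreal.symm.lt)
    ENNReal.ofReal_ne_top ma mG
  have t2 := tendsto_integral_inner_translate one_le_two ENNReal.ofNat_ne_top mc mψ
  have ma' : ∀ r : ℝ, MemLp (fun z => extendZero b Ω a (z - (r, 0))) _ (volume.prod volume) :=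
    fun r => ma.comp_measurePreserving (measurePreserving_sub_right _ _)
  have mc' : ∀ r : ℝ, MemLp (fun z => extendZero b Ω c (z - (r, 0))) _ (volume.prod volume) :=
    fun r => mc.comp_measurePreserving (measurePreserving_sub_right _ _)
  have e : ∀ r : ℝ, ∫ z, timePairing b b' Ω W g a c (r, z) ∂(volume.prod volume) =
      (∫ z, inner ℝ (extendZero b Ω a (z - (r, 0))) (extendZero b' Ω (gradTruncPos W g) z)
        ∂(volume.prod volume)) +
      ∫ z, inner ℝ (extendZero b Ω c (z - (r, 0))) (extendZero b' Ω (truncPos W) z)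
        ∂(volume.prod volume) := fun r => by
    rw [← integral_add (integrable_inner_of_memLp (ma' r) mG)
      (integrable_inner_of_memLp (mc' r) mψ)]
    refine integral_congr_ae (ae_of_all _ fun z => ?_)
    simp [timePairing, mul_comm]
  simp only [e, Prod.mk_zero_zero, sub_zero]
  exact t1.add t2

theorem timePairing_zero_apply (hb' : b' ≤ b) (z : ℝ × Space n) :
    timePairing b b' Ω W g a c (0, z) = (Ioo 0 b' ×ˢ Ω).indicator
      (fun z => inner ℝ (a z) (gradTruncPos W g z) + c z * truncPos W z) z := by
  by_cases hz : z ∈ Ioo 0 b' ×ˢ Ω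
  · have hz' : z ∈ Ioo 0 b ×ˢ Ω := ⟨⟨hz.1.1, hz.1.2.trans_le hb'⟩, hz.2⟩
    simp only [timePairing, extendZero, indicator_of_mem hz, Prod.mk_zero_zero, sub_zero,
      indicator_of_mem hz']
  · simp [timePairing, extendZero, indicator_of_notMem hz]

/-- At equal times the pairing is bounded below, by monotonicity of the flux and the growth
condition on the reaction. -/
theorem le_timePairing_zero (hΩ : IsOpen Ω) [IsFiniteMeasure (volume.restrict Ω)] (hp : 1 < p)
    (hK : 0 ≤ K) (h : IsDifferenceSubsolution p K b Ω W g a c) (hb'0 : 0 ≤ b') (hb' : b' ≤ b) :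
    -(3 * K * ∫ t in (0)..b', energy b Ω W t) ≤
      ∫ z, timePairing b b' Ω W g a c (0, z) ∂(volume.prod volume) := by
  have hconj := (Real.HolderConjugate.conjExponent hp).ennrealOfReal.symm
  have hle := cylinder_mono Ω hb'
  have hms : MeasurableSet (Ioo 0 b' ×ˢ Ω) := measurableSet_Ioo.prod hΩ.measurableSet
  have i0 : Integrable (fun z : ℝ × Space n => entropy (W z.1 z.2)) (cylinder b' Ω) :=
    h.integrable_entropy_cylinder.mono_measure hle
  have e1 : ∫ t in (0)..b', energy b Ω W t = ∫ z, entropy (W z.1 z.2) ∂cylinder b' Ω := by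
    rw [cylinder, integral_prod _ i0, intervalIntegral.integral_of_le hb'0,
      integral_Ioc_eq_integral_Ioo]
    refine setIntegral_congr_fun measurableSet_Ioo fun t ht => ?_
    exact indicator_of_mem (show t ∈ Ioo 0 b from ⟨ht.1, ht.2.trans_le hb'⟩) _
  have e2 : ∫ z, timePairing b b' Ω W g a c (0, z) ∂(volume.prod volume) =
      ∫ z, (inner ℝ (a z) (gradTruncPos W g z) + c z * truncPos W z) ∂cylinder b' Ω := by
    simp_rw [timePairing_zero_apply hb']
    rw [integral_indicator hms, ← Measure.prod_restrict, cylinder]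
  rw [e1, e2, ← integral_const_mul, ← integral_neg]
  refine integral_mono_ae (i0.const_mul _).neg ?_ ?_
  · refine Integrable.add ?_ ?_
    · exact integrable_inner_of_memLp (h.memLp_flux.mono_measure hle)
        (h.memLp_gradTruncPos.mono_measure hle)
    · exact (h.memLp_reaction.mono_measure hle).integrable_mul (h.memLp_truncPos.mono_measure hle)
  · filter_upwards [ae_mono hle h.inner_nonneg, ae_mono hle h.abs_reaction_le] with z h1 h2
    have h3 : 0 ≤ inner ℝ (a z) (gradTruncPos W g z) := by
      rw [gradTruncPos, inner_smul_right]
      exact mul_nonneg (deriv_truncation_nonneg (le_max_right _ _)) h1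
    -- `truncPos W` vanishes where `W ≤ 0`, so `|W|` may be replaced by `W⁺`.
    have h4 : |W z.1 z.2| * truncPos W z ≤ 3 * entropy (W z.1 z.2) := by
      refine le_trans (le_of_eq ?_) (max_mul_truncation_le _)
      rw [truncPos]
      rcases le_total (W z.1 z.2) 0 with h5 | h5
      · simp [max_eq_right h5, truncation_zero]
      · rw [max_eq_left h5, abs_of_nonneg h5]
    have h5 : 0 ≤ truncPos W z := truncation_nonneg _
    have h6 := neg_abs_le (c z)
    have h7 := mul_le_mul_of_nonneg_right h2 h5
    have h8 := mul_le_mul_of_nonneg_left h4 hK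
    nlinarith

/-- Substitution `s = t - r`; the extension by zero accounts for the cut at time `0` when `τ > t`.
-/
theorem integral_slab_eq (hΩ : IsOpen Ω) [IsFiniteMeasure (volume.restrict Ω)] (hp : 1 < p)
    (h : IsDifferenceSubsolution p K b Ω W g a c) {t τ : ℝ} (ht : t ∈ Ioo 0 b') (hb' : b' ≤ b)
    (hτ : 0 ≤ τ) (hg : MemLp (g t) (ENNReal.ofReal p) (volume.restrict Ω)) :
    ∫ z, (inner ℝ (a z) (gradTruncPos W g (t, z.2)) + c z * truncPos W (t, z.2))
        ∂slab (max (t - τ) 0) t Ω =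
      ∫ r in (0)..τ, ∫ x, timePairing b b' Ω W g a c (r, (t, x)) := by
  have htb : t < b := ht.2.trans_le hb'
  have hst : max (t - τ) 0 ≤ t := max_le (by linarith) ht.1.le
  let Φ : ℝ → ℝ := fun s => ∫ x, (inner ℝ (extendZero b Ω a (s, x))
    (extendZero b' Ω (gradTruncPos W g) (t, x)) +
      extendZero b Ω c (s, x) * extendZero b' Ω (truncPos W) (t, x))
  have e1 : ∀ r, ∫ x, timePairing b b' Ω W g a c (r, (t, x)) = Φ (t - r) := fun r => by
    simp only [timePairing, Φ, Prod.mk_sub_mk, sub_zero]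
  simp_rw [e1]
  rw [intervalIntegral.integral_comp_sub_left Φ t, sub_zero,
    intervalIntegral.integral_of_le (by linarith), slab,
    integral_prod _ (h.integrable_slab hp (le_max_right _ _) hst htb.le hg),
    setIntegral_eq_of_subset_of_forall_sdiff_eq_zero (s := Ioc (max (t - τ) 0) t)
      measurableSet_Ioc (Ioc_subset_Ioc_left (le_max_left _ _))]
  · refine setIntegral_congr_fun measurableSet_Ioc fun s hs => ?_
    have hs' : s ∈ Ioo 0 b := ⟨(le_max_right _ _).trans_lt hs.1, hs.2.trans_lt htb⟩
    simp only [Φ]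
    rw [← integral_indicator hΩ.measurableSet]
    refine integral_congr_ae (ae_of_all _ fun x => ?_)
    by_cases hx : x ∈ Ω
    · have m1 : (s, x) ∈ Ioo 0 b ×ˢ Ω := ⟨hs', hx⟩
      have m2 : (t, x) ∈ Ioo 0 b' ×ˢ Ω := ⟨ht, hx⟩
      simp only [extendZero, indicator_of_mem hx, indicator_of_mem m1, indicator_of_mem m2]
    · have m1 : (s, x) ∉ Ioo 0 b ×ˢ Ω := fun h => hx h.2
      simp [extendZero, indicator_of_notMem hx, indicator_of_notMem m1]
  · intro s hs
    have hs0 : s ≤ 0 := by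
      by_contra! h0
      exact hs.2 ⟨max_lt hs.1.1 h0, hs.1.2⟩
    have m1 : ∀ x, (s, x) ∉ Ioo 0 b ×ˢ Ω := fun x h => absurd h.1.1 (not_lt.2 hs0)
    simp [Φ, extendZero, indicator_of_notMem (m1 _)]

/-- The increment of the primitive of the energy is controlled by the averaged pairings. -/
theorem primitive_energy_sub_le (hΩ : IsOpen Ω) [IsFiniteMeasure (volume.restrict Ω)] (hp : 1 < p)
    (h : IsDifferenceSubsolution p K b Ω W g a c) (hb'0 : 0 ≤ b') (hb' : b' ≤ b) {τ : ℝ}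
    (hτ : 0 ≤ τ) :
    (∫ t in (0)..b', energy b Ω W t) - ∫ t in (0)..(b' - τ), energy b Ω W t ≤
      -∫ r in (0)..τ, ∫ z, timePairing b b' Ω W g a c (r, z) ∂(volume.prod volume) := by
  have hE := h.integrable_energy
  have hH := h.integrable_timePairing hΩ hp hb' τ
  have hH' : Integrable (fun q : (ℝ × ℝ) × Space n =>
      timePairing b b' Ω W g a c (q.1.1, (q.1.2, q.2)))
      (((volume.restrict (Ioc 0 τ)).prod volume).prod volume) :=
    (measurePreserving_prodAssoc (volume.restrict (Ioc 0 τ)) volume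
      volume).integrable_comp_of_integrable hH
  have hJ := hH'.integral_prod_left
  -- Fubini makes `t` the outer variable, so that the entropy inequality can be integrated over `t`.
  have e1 : ∫ r in (0)..τ, ∫ z, timePairing b b' Ω W g a c (r, z) ∂(volume.prod volume) =
      ∫ t in Ioo 0 b', ∫ r in (0)..τ, ∫ x, timePairing b b' Ω W g a c (r, (t, x)) := by
    simp_rw [intervalIntegral.integral_of_le hτ]
    calc ∫ r in Ioc 0 τ, ∫ z, timePairing b b' Ω W g a c (r, z) ∂(volume.prod volume)
        = ∫ r in Ioc 0 τ, ∫ t, ∫ x, timePairing b b' Ω W g a c (r, (t, x)) := by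
          refine integral_congr_ae ?_
          filter_upwards [hH.prod_right_ae] with r hr
          exact integral_prod _ hr
      _ = ∫ t, ∫ r in Ioc 0 τ, ∫ x, timePairing b b' Ω W g a c (r, (t, x)) :=
          integral_integral_swap hJ
      _ = _ := by
          refine (setIntegral_eq_integral_of_forall_compl_eq_zero fun t ht => ?_).symm
          have m1 : ∀ x, (t, x) ∉ Ioo 0 b' ×ˢ Ω := fun x h => ht h.1
          simp [timePairing, extendZero, indicator_of_notMem (m1 _)]
  have hEi : ∀ u v : ℝ, IntervalIntegrable (energy b Ω W) volume u v := fun u v =>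
    hE.intervalIntegrable
  have e2 : (∫ t in (0)..b', energy b Ω W t) - ∫ t in (0)..(b' - τ), energy b Ω W t =
      ∫ t in Ioo 0 b', (energy b Ω W t - energy b Ω W (t - τ)) := by
    rw [← integral_Ioc_eq_integral_Ioo, ← intervalIntegral.integral_of_le hb'0,
      intervalIntegral.integral_sub (hEi _ _) (hE.comp_sub_right τ).intervalIntegrable,
      intervalIntegral.integral_comp_sub_right (fun t => energy b Ω W t) τ, zero_sub,
      ← intervalIntegral.integral_add_adjacent_intervals (hEi (-τ) 0) (hEi 0 (b' - τ))]
    have : ∫ t in (-τ)..0, energy b Ω W t = 0 := by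
      rw [intervalIntegral.integral_of_le (by linarith)]
      refine setIntegral_eq_zero_of_forall_eq_zero fun t ht => ?_
      exact indicator_of_notMem (fun h' => absurd h'.1 (not_lt.2 ht.2)) _
    rw [this, zero_add]
  rw [e1, e2, ← integral_neg]
  refine integral_mono_ae ((hE.sub (hE.comp_sub_right τ)).restrict) ?_ ?_
  · refine Integrable.neg ?_
    have := hJ.integral_prod_right
    simp_rw [intervalIntegral.integral_of_le hτ]
    exact this.restrict
  · have hgood := ae_mono (Measure.restrict_mono (Ioo_subset_Ioo_right hb') le_rfl) h.good
    filter_upwards [hgood, ae_restrict_mem measurableSet_Ioo] with t hgt ht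
    have htb : t < b := ht.2.trans_le hb'
    have hst : max (t - τ) 0 ≤ t := max_le (by linarith) ht.1.le
    have key := h.entropy_step hΩ hp (le_max_right (t - τ) 0) hst htb.le hgt
    rw [h.integral_slab_eq hΩ hp ht hb' hτ hgt.2.1] at key
    have e3 : energy b Ω W t = ∫ x in Ω, entropy (W t x) :=
      indicator_of_mem (show t ∈ Ioo 0 b from ⟨ht.1, htb⟩) _
    -- For `t ≤ τ` the earlier time is `0`, where `W ≤ 0` and the entropy vanishes, in agreement
    -- with the zero extension of the energy. The initial condition enters here.
    have e4 : energy b Ω W (t - τ) = ∫ x in Ω, entropy (W (max (t - τ) 0) x) := by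
      rcases le_or_gt (t - τ) 0 with h0 | h0
      · rw [max_eq_right h0, energy, indicator_of_notMem fun h' => absurd h'.1 (not_lt.2 h0)]
        refine (integral_eq_zero_of_ae ?_).symm
        filter_upwards [h.initial] with x hx
        exact entropy_of_nonpos hx
      · rw [max_eq_left h0.le]
        exact indicator_of_mem (show t - τ ∈ Ioo 0 b from ⟨h0, by linarith⟩) _
    rw [e3, e4]
    exact key

end IsDifferenceSubsolution

/-! ### The Gronwall argument and the passage to every time. -/

/-- A function whose integrals against nonnegative bump functions are nonpositive is nonpositive
almost everywhere. -/
theorem ae_nonpos_of_integral_mul_bump_nonpos {Ω : Set (Space n)} (hΩ : IsOpen Ω)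
    {u : Space n → ℝ} (hu : Integrable u (volume.restrict Ω))
    (h : ∀ η, IsBump Ω η → (∀ x, 0 ≤ η x) → ∫ x in Ω, u x * η x ≤ 0) :
    ∀ᵐ x ∂volume.restrict Ω, u x ≤ 0 := by
  have hu' : Integrable (Ω.indicator u) := (integrable_indicator_iff hΩ.measurableSet).2 hu
  have hlim := ContDiffBump.ae_convolution_tendsto_right_of_locallyIntegrable
    (tendsto_mollifier_rOut (n := n)) (Eventually.of_forall mollifier_rOut_le)
    hu'.locallyIntegrable
  rw [ae_restrict_iff' hΩ.measurableSet]
  filter_upwards [hlim] with x hx hxΩ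
  rw [indicator_of_mem hxΩ] at hx
  refine le_of_tendsto hx ?_
  obtain ⟨ε, hε, hball⟩ := Metric.isOpen_iff.1 hΩ x hxΩ
  filter_upwards [tendsto_mollifier_rOut.eventually_lt_const hε] with k hk
  set ρ := mollifier n k
  -- The reflected kernel centred at `x` is an admissible bump once its radius is small; its
  -- integral against `u` is a mollification, which tends to `u x` at almost every `x`.
  have hts : tsupport (fun y => ρ.normed volume (x - y)) ⊆ Metric.closedBall x ρ.rOut := by
    refine closure_minimal (fun y hy => ?_) Metric.isClosed_closedBall
    have : x - y ∈ Function.support (ρ.normed volume) := hy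
    rw [ρ.support_normed_eq, mem_ball_zero_iff] at this
    rw [Metric.mem_closedBall, dist_comm, dist_eq_norm]
    exact this.le
  have hη : IsBump Ω fun y => ρ.normed volume (x - y) :=
    ⟨ρ.contDiff_normed.comp (contDiff_const.sub contDiff_id),
      HasCompactSupport.of_support_subset_isCompact (isCompact_closedBall x ρ.rOut)
        (subset_closure.trans hts),
      hts.trans ((Metric.closedBall_subset_ball hk).trans hball)⟩
  refine le_trans (le_of_eq ?_) (h _ hη fun y => ρ.nonneg_normed _)
  refine (mollify_apply' ρ (Ω.indicator u) x).trans ?_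
  rw [← integral_indicator hΩ.measurableSet]
  refine integral_congr_ae (ae_of_all _ fun y => ?_)
  by_cases hy : y ∈ Ω
  · simp [indicator_of_mem hy, mul_comm]
  · simp [indicator_of_notMem hy]

namespace IsDifferenceSubsolution

variable {p K b : ℝ} {Ω : Set (Space n)} {W : ℝ → Space n → ℝ} {g : ℝ → Space n → Space n}
  {a : ℝ × Space n → Space n} {c : ℝ × Space n → ℝ}

/-- The left lower Dini derivative of the primitive of the energy. -/
theorem eventually_primitive_energy_slope_lt (hΩ : IsOpen Ω) [IsFiniteMeasure (volume.restrict Ω)]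
    (hp : 1 < p) (hK : 0 ≤ K) (h : IsDifferenceSubsolution p K b Ω W g a c) {b' : ℝ}
    (hb'0 : 0 ≤ b') (hb' : b' ≤ b) {m : ℝ} (hm : 3 * K * ∫ t in (0)..b', energy b Ω W t < m) :
    ∀ᶠ τ in 𝓝[>] 0,
      (∫ t in (0)..b', energy b Ω W t) - ∫ t in (0)..(b' - τ), energy b Ω W t < m * τ := by
  obtain ⟨m', hm1, hm2⟩ := exists_between hm
  have hlim := h.tendsto_timePairing hΩ hp hb'
  have h0 := h.le_timePairing_zero hΩ hp hK hb'0 hb'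
  -- The equal-time pairing exceeds `-m'`, hence so do all pairings with small lag, and so does
  -- their average.
  have hev := hlim.eventually_const_lt (by linarith : -m' < _)
  obtain ⟨δ, hδ, hball⟩ := Metric.eventually_nhds_iff_ball.1 hev
  filter_upwards [Ioo_mem_nhdsGT hδ] with τ hτ
  have h1 := h.primitive_energy_sub_le hΩ hp hb'0 hb' hτ.1.le
  have h2 : -m' * τ ≤
      ∫ r in (0)..τ, ∫ z, timePairing b b' Ω W g a c (r, z) ∂(volume.prod volume) := by
    have hi := (h.integrable_timePairing hΩ hp hb' τ).integral_prod_left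
    have := intervalIntegral.integral_mono_on (μ := volume) hτ.1.le
      (intervalIntegrable_const (c := -m'))
      ((intervalIntegrable_iff_integrableOn_Ioc_of_le hτ.1.le).2 hi) fun r hr => by
        refine (hball r ?_).le
        rw [mem_ball_zero_iff, Real.norm_of_nonneg hr.1]
        exact hr.2.trans_lt hτ.2
    simpa [mul_comm] using this
  have h3 := mul_lt_mul_of_pos_right hm2 hτ.1
  linarith

/-- The bound `Y' ≤ 3 K Y` concerns left difference quotients, so the right-sided Gronwall lemma is
applied in reversed time to `s ↦ -Y (b - s)`, with rate `-3 K`. At `s = b` it reads `0 ≤ -Y b * exp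
(-3 K b)`. -/
theorem integral_energy_eq_zero (hΩ : IsOpen Ω) [IsFiniteMeasure (volume.restrict Ω)]
    (hp : 1 < p) (hK : 0 ≤ K) (h : IsDifferenceSubsolution p K b Ω W g a c) (hb : 0 ≤ b) :
    ∫ t in (0)..b, energy b Ω W t = 0 := by
  set Y : ℝ → ℝ := fun s => ∫ t in (0)..s, energy b Ω W t
  have hY : Continuous Y := intervalIntegral.continuous_primitive
    (fun _ _ => h.integrable_energy.intervalIntegrable) 0
  have key := le_gronwallBound_of_liminf_deriv_right_le (f := fun s => -Y (b - s))
    (f' := fun s => 3 * K * Y (b - s)) (δ := -Y b) (K := -(3 * K)) (ε := 0) (a := 0) (b := b)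
    (hY.comp (continuous_const.sub continuous_id)).neg.continuousOn ?_ (by simp)
    (fun x _ => by linarith) b (right_mem_Icc.2 hb)
  · rw [gronwallBound_ε0] at key
    have hY0 : Y 0 = 0 := intervalIntegral.integral_same
    simp only [sub_self, hY0, neg_zero, neg_mul] at key
    refine le_antisymm ?_ (intervalIntegral.integral_nonneg hb fun t _ => energy_nonneg b Ω W t)
    have := Real.exp_pos (-(3 * K * (b - 0)))
    by_contra! hlt
    have : 0 < Y b * Real.exp (-(3 * K * (b - 0))) := mul_pos hlt this
    linarith
  · intro s hs m hm
    have hev := h.eventually_primitive_energy_slope_lt hΩ hp hK (sub_nonneg.2 hs.2.le)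
      (sub_le_self b hs.1) hm
    have ht : Tendsto (fun z => z - s) (𝓝[>] s) (𝓝[>] 0) := by
      refine tendsto_nhdsWithin_iff.2 ⟨?_, ?_⟩
      · exact (Continuous.tendsto' (f := fun z : ℝ => z - s) (by fun_prop) _ _
          (sub_self s)).mono_left nhdsWithin_le_nhds
      · filter_upwards [self_mem_nhdsWithin] with z hz
        exact sub_pos.2 (mem_Ioi.1 hz)
    refine Eventually.frequently ?_
    filter_upwards [ht.eventually hev, self_mem_nhdsWithin] with z hz hzs
    have hpos : 0 < z - s := sub_pos.2 hzs
    rw [inv_mul_lt_iff₀ hpos, mul_comm]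
    rw [show b - s - (z - s) = b - z by ring] at hz
    simp only [Y]
    linarith

theorem ae_nonpos (hΩ : IsOpen Ω) [IsFiniteMeasure (volume.restrict Ω)]
    (hp : 1 < p) (hK : 0 ≤ K) (h : IsDifferenceSubsolution p K b Ω W g a c) (hb : 0 ≤ b) :
    ∀ᵐ t ∂volume.restrict (Ioo 0 b), ∀ᵐ x ∂volume.restrict Ω, W t x ≤ 0 := by
  have h0 := h.integral_energy_eq_zero hΩ hp hK hb
  rw [intervalIntegral.integral_of_le hb, integral_eq_zero_iff_of_nonneg
    (fun t => energy_nonneg b Ω W t) h.integrable_energy.restrict] at h0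
  filter_upwards [ae_mono (Measure.restrict_mono Ioo_subset_Ioc_self le_rfl) h0,
    ae_restrict_mem measurableSet_Ioo] with t ht ht'
  rw [energy, indicator_of_mem ht', Pi.zero_apply, integral_eq_zero_iff_of_nonneg
    (fun x => entropy_nonneg _) (h.integrable_entropy ht'.1.le ht'.2.le)] at ht
  filter_upwards [ht] with x hx
  exact nonpos_of_entropy_eq_zero hx

/-- The comparison principle at the final time. -/
theorem ae_nonpos_final (hΩ : IsOpen Ω) [IsFiniteMeasure (volume.restrict Ω)]
    (hp : 1 < p) (hK : 0 ≤ K) (h : IsDifferenceSubsolution p K b Ω W g a c) (hb : 0 < b) :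
    ∀ᵐ x ∂volume.restrict Ω, W b x ≤ 0 := by
  refine ae_nonpos_of_integral_mul_bump_nonpos hΩ
    ((h.memLp_slice b hb.le le_rfl).integrable one_le_two) fun η hη hη0 => ?_
  set Φ : ℝ × Space n → ℝ := fun z => inner ℝ (a z) (gradient η z.2) + c z * η z.2
  have hle : ∀ {s}, 0 ≤ s → slab s b Ω ≤ cylinder b Ω := fun hs => slab_le_cylinder Ω hs le_rfl
  have hΦ : ∀ {s}, 0 ≤ s → Integrable Φ (slab s b Ω) := fun hs =>
    integrable_flux_add_reaction hp (h.memLp_flux.mono_measure (hle hs))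
      (h.memLp_reaction.mono_measure (hle hs)) hη
  have hΦi : IntervalIntegrable (fun t => ∫ x in Ω, Φ (t, x)) volume 0 b :=
    (intervalIntegrable_iff_integrableOn_Ioc_of_le hb.le).2 (hΦ le_rfl).integral_prod_left
  have hcont : ContinuousOn (fun s => ∫ t in s..b, ∫ x in Ω, Φ (t, x)) (Icc 0 b) := by
    have := intervalIntegral.continuousOn_primitive_interval_left
      ((intervalIntegrable_iff' (by simp)).1 hΦi)
    rwa [uIcc_of_le hb.le] at this
  have hlim : Tendsto (fun s => -∫ t in s..b, ∫ x in Ω, Φ (t, x)) (𝓝[<] b) (𝓝 0) := by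
    have h1 := (hcont b (right_mem_Icc.2 hb.le)).neg
    have h2 : 𝓝[<] b ≤ 𝓝[Icc 0 b] b := by
      rw [← nhdsWithin_Ioo_eq_nhdsLT hb]
      exact nhdsWithin_mono _ Ioo_subset_Icc_self
    refine (Tendsto.mono_left h1 h2).trans_eq ?_
    simp
  refine ge_of_tendsto_of_frequently hlim ?_
  -- Times with `W ≤ 0` have full measure, hence accumulate at `b` from the left; along them `∫ W(b)
  -- η ≤ ∫ (W(b) - W(t)) η`, and the weak inequality bounds this by a quantity tending to `0`.
  have hd := Measure.dense_of_ae ((ae_restrict_iff' measurableSet_Ioo).1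
    (h.ae_nonpos hΩ hp hK hb.le))
  rw [(nhdsLT_basis b).frequently_iff]
  intro s hs
  obtain ⟨t, htm, ht⟩ := hd.exists_mem_open isOpen_Ioo
    (nonempty_Ioo.2 (max_lt hs hb) : (Ioo (max s 0) b).Nonempty)
  have ht0 : 0 < t := (le_max_right _ _).trans_lt ht.1
  refine ⟨t, ⟨(le_max_left _ _).trans_lt ht.1, ht.2⟩, ?_⟩
  have hWt := htm ⟨ht0, ht.2⟩
  have hw := h.weak η hη hη0 t b ht0.le ht.2.le le_rfl
  rw [slab, integral_prod _ (hΦ ht0.le), ← intervalIntegral.integral_of_le ht.2.le] at hw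
  refine le_trans (integral_mono_ae ?_ ?_ ?_) hw
  · exact (h.memLp_slice b hb.le le_rfl).integrable_mul (hη.memLp 2 _)
  · exact ((h.memLp_slice b hb.le le_rfl).sub
      (h.memLp_slice t ht0.le ht.2.le)).integrable_mul (hη.memLp 2 _)
  · filter_upwards [hWt] with x hx
    have := mul_nonneg (neg_nonneg.2 hx) (hη0 x)
    simp only [sub_mul] at *
    linarith

end IsDifferenceSubsolution

/-! ### Comparison and uniqueness. -/

section Sobolev

variable {Ω : Set (Space n)} {p : ℝ} {u v : Space n → ℝ} {g G : Space n → Space n}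

theorem HasWeakGradient.sub (h : HasWeakGradient Ω u g) (h' : HasWeakGradient Ω v G) :
    HasWeakGradient Ω (fun x => u x - v x) (fun x => g x - G x) := by
  refine .of_integral_eq (h.locallyIntegrableOn_fun.sub h'.locallyIntegrableOn_fun)
    (h.locallyIntegrableOn_grad.sub h'.locallyIntegrableOn_grad) fun η hη i => ?_
  have i1 : ∀ {f : Space n → ℝ}, LocallyIntegrableOn f Ω →
      Integrable fun x => f x * gradient η x i := fun hf =>
    integrable_mul_of_locallyIntegrableOn hf
      (continuous_gradient_coord hη i) hη.compact_support.isCompact hη.support_subset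
      fun x hx => coord_gradient_of_notMem_tsupport hx i
  have i2 : ∀ {f : Space n → ℝ}, LocallyIntegrableOn f Ω → Integrable fun x => f x * η x :=
    fun hf => integrable_mul_of_locallyIntegrableOn hf hη.continuous
      hη.compact_support.isCompact hη.support_subset fun x hx => image_eq_zero_of_notMem_tsupport hx
  have l1 := locallyIntegrableOn_coord h.locallyIntegrableOn_grad i
  have l2 := locallyIntegrableOn_coord h'.locallyIntegrableOn_grad i
  simp only [PiLp.sub_apply, sub_mul]
  rw [integral_sub (i1 h.locallyIntegrableOn_fun) (i1 h'.locallyIntegrableOn_fun),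
    integral_sub (i2 l1) (i2 l2), h.integral_eq' hη, h'.integral_eq' hη]
  ring

theorem MemSobolev.sub (h : MemSobolev p Ω u g) (h' : MemSobolev p Ω v G) :
    MemSobolev p Ω (fun x => u x - v x) (fun x => g x - G x) :=
  ⟨h.weakGradient.sub h'.weakGradient, h.memLp_fun.sub h'.memLp_fun, h.memLp_grad.sub h'.memLp_grad⟩

theorem MemSobolevZero.sub [IsFiniteMeasure (volume.restrict Ω)] (hp : 1 < p)
    (h : MemSobolevZero p Ω u g) (h' : MemSobolevZero p Ω v G) :
    ∃ D, MemSobolevZero p Ω (fun x => u x - v x) D := by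
  have hneg := h'.comp hp (f := fun r => -r) contDiff_neg neg_zero (C := 1) fun r => by simp
  have := h.add hp hneg
  exact ⟨_, by simpa only [sub_eq_add_neg] using this⟩

end Sobolev

variable {Ω : Set (Space n)} {p : ℝ} {T : EReal} {α : Space n → ℝ → ℝ} {K : ℝ}
  {w₁ w₂ : ℝ → Space n → ℝ}

/-- The given time serves as the final time of the difference data, so only the bounded interval
`[0, t]` matters even if `T = ⊤`. -/
theorem comparison_principle (hΩ : IsOpen Ω) (hΩb : Bornology.IsBounded Ω)
    (hp : 1 < p) (hK : 0 ≤ K)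
    (hα_cont : ContinuousOn (Function.uncurry α) (Ω ×ˢ (univ : Set ℝ)))
    (hα_bound : ∀ x ∈ Ω, ∀ r : ℝ, 0 ≤ r → 0 ≤ α x r ∧ α x r ≤ K * r)
    (hα_lip : ∀ x ∈ Ω, ∀ r₁ r₂ : ℝ, |α x r₂ - α x r₁| ≤ K * |r₂ - r₁|)
    (h₁ : IsWeakSubsolution p α Ω T w₁) (h₂ : IsWeakSupersolution p α Ω T w₂)
    (hle : LeOnParabolicBoundary p Ω T w₁ w₂) {t : ℝ} (ht0 : 0 ≤ t) (htT : (t : EReal) < T) :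
    ∀ᵐ x ∂volume.restrict Ω, w₁ t x ≤ w₂ t x := by
  rcases ht0.eq_or_lt with rfl | ht
  · exact hle.1
  have hfin : IsFiniteMeasure (volume.restrict Ω) :=
    isFiniteMeasure_restrict.2 hΩb.measure_lt_top.ne
  obtain ⟨G₁, hB₁, hL₁, hw₁⟩ := h₁
  obtain ⟨G₂, hB₂, hL₂, hw₂⟩ := h₂
  have hltT : ∀ {s : ℝ}, s ≤ t → (s : EReal) < T := fun hs =>
    lt_of_le_of_lt (by exact_mod_cast hs) htT
  have key : IsDifferenceSubsolution p K t Ω (fun s x => w₁ s x - w₂ s x)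
      (fun s x => G₁ s x - G₂ s x)
      (fun z => pField p (G₁ z.1 z.2) - pField p (G₂ z.1 z.2))
      (fun z => α z.2 (w₁ z.1 z.2) - α z.2 (w₂ z.1 z.2)) := by
    refine ⟨fun s hs hst => (hL₁.slice s hs (hltT hst)).sub (hL₂.slice s hs (hltT hst)),
      (hL₁.cylinder t htT).sub (hL₂.cylinder t htT),
      (hB₁.memLp_grad hp htT).sub (hB₂.memLp_grad hp htT),
      (memLp_pField hp (hB₁.memLp_grad hp htT)).sub (memLp_pField hp (hB₂.memLp_grad hp htT)),
      (memLp_reaction hΩ hα_cont hα_bound hα_lip (hL₁.cylinder t htT)).sub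
        (memLp_reaction hΩ hα_cont hα_bound hα_lip (hL₂.cylinder t htT)),
      fun η hη hη0 s s' hs hss' hs't => exists_weak_inequality hΩ hp hα_cont hα_bound hα_lip
        hB₁ hL₁ hw₁ hB₂ hL₂ hw₂ hη hη0 hs hss' (hltT hs't), ?_,
      ae_of_all _ fun z => inner_pField_sub_nonneg hp _ _, ?_, ?_⟩
    · refine (ae_restrict_iff' measurableSet_Ioo).2 ?_
      filter_upwards [hB₁.slice, hB₂.slice, hle.2] with s h1 h2 h3 hs
      have hsT := hltT hs.2.le
      have h12 := (h1 hs.1 hsT).sub (h2 hs.1 hsT)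
      exact ⟨h12.weakGradient, h12.memLp_grad, h3 hs.1 hsT⟩
    · filter_upwards [ae_mem_cylinder hΩ t] with z hz
      exact hα_lip z.2 hz _ _
    · filter_upwards [hle.1] with x hx
      exact sub_nonpos.2 hx
  filter_upwards [key.ae_nonpos_final hΩ hp hK ht] with x hx
  exact sub_nonpos.1 hx

/-- The extensions `g₁`, `g₂` of `σ` may differ. In `w₁ - w₂ = (w₁ - g₁) - (w₂ - g₂) + (g₁ - g₂)`
the last term is continuous up to the boundary and vanishes there, so every term is in `W₀^{1,p}`.
-/
theorem HasLateralBoundaryValues.exists_posPart_sub (hΩ : IsOpen Ω) (hΩb : Bornology.IsBounded Ω)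
    (hp : 1 < p) {σ : Space n → ℝ} (h₁ : HasLateralBoundaryValues p Ω T σ w₁)
    (h₂ : HasLateralBoundaryValues p Ω T σ w₂) :
    ∀ᵐ t : ℝ, 0 < t → (t : EReal) < T →
      ∃ D : Space n → Space n, MemSobolevZero p Ω (fun x => max (w₁ t x - w₂ t x) 0) D := by
  have hfin : IsFiniteMeasure (volume.restrict Ω) :=
    isFiniteMeasure_restrict.2 hΩb.measure_lt_top.ne
  obtain ⟨g₁, Dg₁, hg₁, hc₁, hσ₁, hw₁⟩ := h₁
  obtain ⟨g₂, Dg₂, hg₂, hc₂, hσ₂, hw₂⟩ := h₂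
  obtain ⟨E, hE⟩ := (hg₁.sub hg₂).memSobolevZero_of_continuousOn hΩ hΩb hp (hc₁.sub hc₂)
    fun x hx => by rw [hσ₁ x hx, hσ₂ x hx, sub_self]
  filter_upwards [hw₁, hw₂] with t h1 h2 ht htT
  obtain ⟨D₁, hD₁⟩ := h1 ht htT
  obtain ⟨D₂, hD₂⟩ := h2 ht htT
  obtain ⟨D, hD⟩ := hD₁.sub hp hD₂
  have hD' := hD.add hp hE
  have e : (fun x => w₁ t x - g₁ x - (w₂ t x - g₂ x) + (g₁ x - g₂ x)) =
      fun x => w₁ t x - w₂ t x := by ext x; ring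
  rw [e] at hD'
  exact hD'.posPart hp

theorem IsWeakSolution.ae_le (hΩ : IsOpen Ω) (hΩb : Bornology.IsBounded Ω)
    (hp : 1 < p) (hK : 0 ≤ K)
    (hα_cont : ContinuousOn (Function.uncurry α) (Ω ×ˢ (univ : Set ℝ)))
    (hα_bound : ∀ x ∈ Ω, ∀ r : ℝ, 0 ≤ r → 0 ≤ α x r ∧ α x r ≤ K * r)
    (hα_lip : ∀ x ∈ Ω, ∀ r₁ r₂ : ℝ, |α x r₂ - α x r₁| ≤ K * |r₂ - r₁|) {σ v₀ : Space n → ℝ}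
    (h₁ : IsWeakSolution p α Ω T σ v₀ w₁) (h₂ : IsWeakSolution p α Ω T σ v₀ w₂)
    {t : ℝ} (ht0 : 0 ≤ t) (htT : (t : EReal) < T) :
    ∀ᵐ x ∂volume.restrict Ω, w₁ t x ≤ w₂ t x := by
  refine comparison_principle hΩ hΩb hp hK hα_cont hα_bound hα_lip h₁.subsolution
    h₂.supersolution ⟨?_, h₁.lateral.exists_posPart_sub hΩ hΩb hp h₂.lateral⟩ ht0 htT
  filter_upwards [h₁.initial, h₂.initial] with x hx hx'
  rw [hx, hx']

end PParabolic

end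

theorem theorem3p1 {n : ℕ} (Ω : Set (PParabolic.Space n)) (hΩo : IsOpen Ω)
    (hΩb : Bornology.IsBounded Ω) (p : ℝ) (hp : 1 < p) (T : EReal) (hT : 0 < T)
    (α : PParabolic.Space n → ℝ → ℝ) (K : ℝ) (hK : 0 ≤ K)
    (hα_cont : ContinuousOn (Function.uncurry α) (Ω ×ˢ (Set.univ : Set ℝ)))
    (hα_bound : ∀ x ∈ Ω, ∀ r : ℝ, 0 ≤ r → 0 ≤ α x r ∧ α x r ≤ K * r)
    (hα_lip : ∀ x ∈ Ω, ∀ r₁ r₂ : ℝ, |α x r₂ - α x r₁| ≤ K * |r₂ - r₁|) :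
    (∀ w₁ w₂ : ℝ → PParabolic.Space n → ℝ,
      PParabolic.IsWeakSubsolution p α Ω T w₁ →
      PParabolic.IsWeakSupersolution p α Ω T w₂ →
      PParabolic.LeOnParabolicBoundary p Ω T w₁ w₂ →
      ∀ t : ℝ, 0 ≤ t → (t : EReal) < T →
        ∀ᵐ x ∂MeasureTheory.volume.restrict Ω, w₁ t x ≤ w₂ t x) ∧
    (∀ (σ v₀ : PParabolic.Space n → ℝ) (w w' : ℝ → PParabolic.Space n → ℝ),
      PParabolic.IsWeakSolution p α Ω T σ v₀ w →
      PParabolic.IsWeakSolution p α Ω T σ v₀ w' →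
      ∀ t : ℝ, 0 ≤ t → (t : EReal) < T →
        ∀ᵐ x ∂MeasureTheory.volume.restrict Ω, w t x = w' t x) := by
  refine ⟨fun w₁ w₂ h₁ h₂ hle t ht0 htT => PParabolic.comparison_principle hΩo hΩb hp hK hα_cont
    hα_bound hα_lip h₁ h₂ hle ht0 htT, fun σ v₀ w w' h h' t ht0 htT => ?_⟩
  filter_upwards [h.ae_le hΩo hΩb hp hK hα_cont hα_bound hα_lip h' ht0 htT,
    h'.ae_le hΩo hΩb hp hK hα_cont hα_bound hα_lip h ht0 htT] with x hx hx'
  exact le_antisymm hx hx'
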